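/- **Setting.** Let $T>0$, and let $\mathfrak G_0,\mathfrak G_1$ be Gaussian processes on $[0,T]$ whose paths are almost surely continuous and piecewise smooth (continuously differentiable off a finite set), with equal prior probabilities $1/2$. For a decision rule $g$, which maps paths measurably to $\{0,1\}$, let $R(g)=\tfrac12 P[g(\mathfrak G_0)=1]+\tfrac12P[g(\mathfrak G_1)=0]$; the Bayes risk $R^*$ is the infimum of $R(g)$ over all such $g$. Assume that for $c=0,1$ and every $L\ge1$ the covariance matrix of $\bigl(\int_{T(i-1)/L}^{Ti/L}\mathfrak G_c(t)\,dt\bigr)_{i=1,\dots,L}$ is nonsingular. *Sampling scheme.* For each $k$ let $0=t_{k,0}<t_{k,1}<\dots<t_{k,\ell_k}=T$ and $\mathcal T_k=\{t_{k,1},\dots,t_{k,\ell_k}\}$, with $\mathcal T_k\subset\mathcal T_{k+1}$ and $\max_j(t_{k,j+1}-t_{k,j})\to0$. Let $\tilde v_1,\tilde v_2,\dots$ be i.i.d. copies of $\mathfrak G_0$ and $\tilde w_1,\tilde w_2,\dots$ i.i.d. copies of $\mathfrak G_1$, all independent. At stage $k$ the paths $\tilde v_1,\dots,\tilde v_k,\tilde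 w_1,\dots,\tilde w_k$, and any path that is to be classified, are observed at the points of $\mathcal T_k$ only, are interpolated linearly (constant on $[0,t_{k,1}]$), and the resulting functions $x$ are mapped by the $LS$-transform to $\mathbb R^{L+S}$: to the integrals of $x$ over the $L$ subintervals $[T(i-1)/L,Ti/L]$ and the integrals of $x'$ over the $S$ subintervals $[T(i-1)/S,Ti/S]$. Let $\mathcal M_k=\{L\in\mathbb N: 1\le L\le T/\min_j(t_{k,j+1}-t_{k,j})+1\}$, let $\mathcal S_k$ be any set of nonnegative integers with $0\in\mathcal S_k$ (for instance $\mathcal S_k=\{0\}$), and $\mathcal C_k=\mathcal M_k\times\mathcal S_k$. *Rules.* Quadratic discriminant analysis (QDA) assigns $z$ to the class $c$ for which $(z-\hat m_c)^\top\hat\Sigma_c^{-1}(z-\hat m_c)+\log\det\hat\Sigma_c$ is smaller, where $\hat m_c,\hat\Sigma_c$ are the empirical mean and covariance matrix of the transformed training data of class $c$; linear discriminant analysis (LDA) does the same with the pooled matrix $\tfrac12(\hat\Sigma_0+\hat\Sigma_1)$ in place of both $\hat\Sigma_c$. Ties, and all points if a required matrix is singular, go to class $0$. For $I\subseteq\{1,\dots,k\}$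 let $g_{k,I,(L,S)}$ be the rule for paths fitted to the $LS$-transforms of $\tilde v_i,\tilde w_i$, $i\in I$. *Cross-validation.* Fix $V\ge1$ and, for each $k$, disjoint training and validation sets $I_{k,u},J_{k,u}\subseteq\{1,\dots,k\}$, $u=1,\dots,V$, each of size at least $\delta k$ for all large $k$, with some $\delta>0$ (as in $V$-fold cross-validation). The cross-validated error rate $\mathrm{CV}_k(L,S)$ is the average over $u$ of the proportion of the paths $\tilde v_i,\tilde w_i$, $i\in J_{k,u}$, that are misclassified by $g_{k,I_{k,u},(L,S)}$. **Theorem 1 (Bayes optimality with respect to Gaussian processes).** QDA on the $LS$-transformed data is almost surely Bayes optimal with respect to the processes $\mathfrak G_0$ and $\mathfrak G_1$, and so is LDA if $\mathfrak G_0$ and $\mathfrak G_1$ have the same covariance function. That is, for the rule in question: (a) if $(L_k,S_k)\in\mathcal C_k$ is selected, depending on the sample in any way, such that almost surely the risk of the rule fitted to the whole sample is asymptotically optimal, $R(g_{k,\{1,\dots,k\},(L_k,S_k)})-\inf_{(L,S)\in\mathcal C_k}R(g_{k,\{1,\dots,k\},(L,S)})\to0$, then $R(g_{k,\{1,\dots,k\},(L_k,S_k)})\to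 R^*$ almost surely; (b) if $(L_k,S_k)$ minimizes $\mathrm{CV}_k$ over $\mathcal C_k$, then almost surely $R(g_{k,I_{k,u},(L_k,S_k)})\to R^*$ for each $u=1,\dots,V$; (c) if integers $d_k\to\infty$ satisfy $d_k\le k^\alpha$ for all large $k$, with some $\alpha<1/2$, and, for all large $k$, $(L_k,S_k)$ minimizes $\mathrm{CV}_k$ over $\{(L,S)\in\mathcal C_k:L+S\le d_k\}$, then $R(g_{k,\{1,\dots,k\},(L_k,S_k)})\to R^*$ almost surely, for the rule refitted to the whole sample. (The risks above are those of the fitted rules, given the training sample.) -/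

import Mathlib

open MeasureTheory ProbabilityTheory Filter Topology

/-- Real functions on the observation interval `[0, T]`. The instance-provided σ-algebra is the
product σ-algebra; on continuous functions it is the trace of the Borel σ-algebra of the supremum
norm. -/
abbrev SamplePath (T : ℝ) : Type := Set.Icc (0 : ℝ) T → ℝ

/-- Continuous on `[0, T]`, and continuously differentiable off a finite set (which may contain the
end points). -/
def IsPiecewiseSmooth {T : ℝ} (x : SamplePath T) : Prop :=
  Continuous x ∧ ∃ (f : ℝ → ℝ) (F : Set ℝ), F.Finite ∧ (∀ s : Set.Icc (0 : ℝ) T, f s = x s) ∧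
    ∀ s ∈ Set.Icc (0 : ℝ) T, s ∉ F → ContDiffAt ℝ 1 f s

/-! ### The sequential sampling scheme -/

/-- Nested grids: at stage `k` there are numbers `0 = t k 0 < t k 1 < ⋯ < t k (ℓ k) = T`, paths are
observed at `t k 1, …, t k (ℓ k)`, and the mesh tends to `0`. Values `t k j` with `j > ℓ k` are
irrelevant. -/
structure SamplingScheme (T : ℝ) where
  ℓ : ℕ → ℕ
  t : ℕ → ℕ → Set.Icc (0 : ℝ) T
  first : ∀ k, (t k 0 : ℝ) = 0
  last : ∀ k, (t k (ℓ k) : ℝ) = T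
  increasing : ∀ k, ∀ j < ℓ k, t k j < t k (j + 1)
  nested : ∀ k, t k '' Set.Icc 1 (ℓ k) ⊆ t (k + 1) '' Set.Icc 1 (ℓ (k + 1))
  mesh : Tendsto (fun k => ⨆ j : Fin (ℓ k), ((t k (j + 1) : ℝ) - t k j)) atTop (𝓝 0)

namespace SamplingScheme

variable {T : ℝ}

/-- Linear interpolation of the values of `x` at `t k 1 < ⋯ < t k (ℓ k)`, constant to the left of
`t k 1`. The factor of the `j`-th increment is `0` up to `t k j`, `1` from `t k (j + 1)` on, and
linear in between. -/
noncomputable def interpolate (𝒯 : SamplingScheme T) (k : ℕ) (x : SamplePath T) (s : ℝ) : ℝ :=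
  x (𝒯.t k 1) + ∑ j ∈ Finset.Ico 1 (𝒯.ℓ k), (x (𝒯.t k (j + 1)) - x (𝒯.t k j)) *
    max 0 (min 1 ((s - 𝒯.t k j) / (𝒯.t k (j + 1) - 𝒯.t k j)))

/-- `M_k`: the positive integers `L ≤ T / min_j (t k (j + 1) - t k j) + 1`. -/
def locationNumbers (𝒯 : SamplingScheme T) (k : ℕ) : Set ℕ :=
  {L | 1 ≤ L ∧ (L : ℝ) ≤ T / (⨅ j : Fin (𝒯.ℓ k), ((𝒯.t k (j + 1) : ℝ) - 𝒯.t k j)) + 1}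

end SamplingScheme

/-! ### The location-slope transform -/

/-- The location-slope transform: integrals of `f` over `L` equal subintervals of `[0, T]`, and
integrals of its derivative over `S` equal subintervals. -/
noncomputable def lsTransform (T : ℝ) (L S : ℕ) (f : ℝ → ℝ) : Fin L ⊕ Fin S → ℝ :=
  Sum.elim (fun i => ∫ s in (T * i / L)..(T * (i + 1) / L), f s)
    (fun i => ∫ s in (T * i / S)..(T * (i + 1) / S), deriv f s)

/-- The averages `∫ x` over `L` equal subintervals for a path `x` itself (extended outside `[0, T]`
by its end values, which plays no role). -/
noncomputable def pathLocation {T : ℝ} (hT : 0 ≤ T) (L : ℕ) (x : SamplePath T) : Fin L → ℝ :=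
  fun i => ∫ s in (T * i / L)..(T * (i + 1) / L), Set.IccExtend hT x s

/-- The location vectors of the process `X` have a nonsingular covariance matrix, for each number
of subintervals. -/
def HasNonsingularLocations {Ω : Type*} [MeasurableSpace Ω] (P : Measure Ω) {T : ℝ} (hT : 0 ≤ T)
    (X : Ω → SamplePath T) : Prop :=
  ∀ L : ℕ, 1 ≤ L → (Matrix.of fun i j : Fin L =>
    cov[fun ω => pathLocation hT L (X ω) i, fun ω => pathLocation hT L (X ω) j; P]).det ≠ 0

/-! ### Discriminant analysis in `ℝ^d` -/

section Discriminant

variable {d : Type*}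

/-- Empirical mean of the vectors `y i`, `i ∈ I`. -/
noncomputable def sampleMean (I : Finset ℕ) (y : ℕ → d → ℝ) : d → ℝ :=
  (I.card : ℝ)⁻¹ • ∑ i ∈ I, y i

/-- Empirical covariance matrix of the vectors `y i`, `i ∈ I`. -/
noncomputable def sampleCov (I : Finset ℕ) (y : ℕ → d → ℝ) : Matrix d d ℝ :=
  (I.card : ℝ)⁻¹ • ∑ i ∈ I, Matrix.vecMulVec (y i - sampleMean I y) (y i - sampleMean I y)

/-- Squared Mahalanobis distance. -/
noncomputable def sqMahalanobis [Fintype d] [DecidableEq d] (m : d → ℝ) (C : Matrix d d ℝ)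
    (z : d → ℝ) : ℝ :=
  (z - m) ⬝ᵥ (C⁻¹).mulVec (z - m)

open Classical in
/-- Quadratic discriminant analysis with equal priors, fitted to the training vectors `y c i`,
`i ∈ I`, of the classes `c = 0, 1`. If an empirical covariance matrix is singular, so that the rule
is not defined, everything is assigned to class `0`. -/
noncomputable def qda [Fintype d] [DecidableEq d] (I : Finset ℕ) (y : Fin 2 → ℕ → d → ℝ)
    (z : d → ℝ) : Fin 2 :=
  if (sampleCov I (y 0)).det ≠ 0 ∧ (sampleCov I (y 1)).det ≠ 0 ∧
      sqMahalanobis (sampleMean I (y 1)) (sampleCov I (y 1)) z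
          + Real.log (sampleCov I (y 1)).det
        < sqMahalanobis (sampleMean I (y 0)) (sampleCov I (y 0)) z
          + Real.log (sampleCov I (y 0)).det
  then 1 else 0

/-- Pooled empirical covariance matrix (the two classes have training samples of equal size). -/
noncomputable def pooledCov (I : Finset ℕ) (y : Fin 2 → ℕ → d → ℝ) : Matrix d d ℝ :=
  (2 : ℝ)⁻¹ • (sampleCov I (y 0) + sampleCov I (y 1))

open Classical in
/-- Linear discriminant analysis with equal priors. If the pooled empirical covariance matrix is
singular, everything is assigned to class `0`. -/
noncomputable def lda [Fintype d] [DecidableEq d] (I : Finset ℕ) (y : Fin 2 → ℕ → d → ℝ)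
    (z : d → ℝ) : Fin 2 :=
  if (pooledCov I y).det ≠ 0 ∧
      sqMahalanobis (sampleMean I (y 1)) (pooledCov I y) z
        < sqMahalanobis (sampleMean I (y 0)) (pooledCov I y) z
  then 1 else 0

end Discriminant

/-- A learning method for vectors in `ℝ^(L + S)`: it turns a finite set `I` of training indices and
the vectors `y c i` of both classes into a decision rule. -/
abbrev LearningMethod : Type :=
  ∀ L S : ℕ, Finset ℕ → (Fin 2 → ℕ → (Fin L ⊕ Fin S) → ℝ) → ((Fin L ⊕ Fin S) → ℝ) → Fin 2

/-- Quadratic discriminant analysis as a learning method. -/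
noncomputable def QDA : LearningMethod := fun _ _ I y z => qda I y z

/-- Linear discriminant analysis as a learning method. -/
noncomputable def LDA : LearningMethod := fun _ _ I y z => lda I y z

/-- The stage-`k` decision rule for paths: the method `D` operating on the `LS`-transforms,
`p = (L, S)`, of the interpolated data; `v c i` is the `i`-th sampled path of class `c`. -/
noncomputable def lsRule {T : ℝ} (𝒯 : SamplingScheme T) (D : LearningMethod)
    (v : Fin 2 → ℕ → SamplePath T) (k : ℕ) (I : Finset ℕ) (p : ℕ × ℕ) (x : SamplePath T) : Fin 2 :=
  D p.1 p.2 I (fun c i => lsTransform T p.1 p.2 (𝒯.interpolate k (v c i)))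
    (lsTransform T p.1 p.2 (𝒯.interpolate k x))

/-! ### Risks -/

section Risk

variable {Ω : Type*} [MeasurableSpace Ω] {T : ℝ}

/-- Error probability of the decision rule `g`, for equal priors. -/
noncomputable def risk (P : Measure Ω) (G : Fin 2 → Ω → SamplePath T) (g : SamplePath T → Fin 2) : ℝ :=
  (1 / 2) * ∑ c : Fin 2, P.real {ω | g (G c ω) ≠ c}

/-- The Bayes risk for classifying the processes `G 0` and `G 1` with equal priors. -/
noncomputable def bayesRisk (P : Measure Ω) (G : Fin 2 → Ω → SamplePath T) : ℝ :=
  ⨅ g : {g : SamplePath T → Fin 2 // Measurable g}, risk P G g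

end Risk

/-! ### Selection of the dimensions -/

/-- `V` splittings of the first `k` indices into training and validation indices (as in `V`-fold
cross-validation, `V ≥ 2`, or a single hold-out split, `V = 1`). The training
and the validation sets each contain at least a fixed proportion of the indices. -/
structure FoldScheme (V : ℕ) where
  train : ℕ → Fin V → Finset ℕ
  valid : ℕ → Fin V → Finset ℕ
  train_subset : ∀ k v, train k v ⊆ Finset.range k
  valid_subset : ∀ k v, valid k v ⊆ Finset.range k
  disjoint : ∀ k v, Disjoint (train k v) (valid k v)
  proportion : ∃ δ : ℝ, 0 < δ ∧ ∀ᶠ k : ℕ in atTop, ∀ v,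
    δ * k ≤ (train k v).card ∧ δ * k ≤ (valid k v).card

open Classical in
/-- The cross-validated error rate at stage `k` for `p = (L, S)`: over all folds, the average
proportion of misclassified validation paths, when the rule is fitted to the training paths. -/
noncomputable def cvError {T : ℝ} (𝒯 : SamplingScheme T) (D : LearningMethod) {V : ℕ}
    (𝓕 : FoldScheme V) (v : Fin 2 → ℕ → SamplePath T) (k : ℕ) (p : ℕ × ℕ) : ℝ :=
  (V : ℝ)⁻¹ * ∑ u : Fin V, (2 * ((𝓕.valid k u).card : ℝ))⁻¹ *
    ∑ c : Fin 2, ∑ i ∈ 𝓕.valid k u,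
      if lsRule 𝒯 D v k (𝓕.train k u) p (v c i) ≠ c then (1 : ℝ) else 0

section Optimality

variable {Ω Ω' : Type*} [MeasurableSpace Ω] [MeasurableSpace Ω'] {T : ℝ}

/-- Full samples, optimal selection: whenever `(L_k, S_k)` is selected from `𝒞 k` so that
the error probability of the rule fitted to all `k + k` paths is asymptotically minimal over `𝒞 k`,
this error probability almost surely tends to the Bayes risk. -/
def OptimalUnderOptimalSelection (P : Measure Ω) (P' : Measure Ω') (G : Fin 2 → Ω → SamplePath T)
    (v : Fin 2 → ℕ → Ω' → SamplePath T) (𝒯 : SamplingScheme T) (𝒞 : ℕ → Set (ℕ × ℕ))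
    (D : LearningMethod) : Prop :=
  ∀ sel : ℕ → Ω' → ℕ × ℕ, (∀ k ω, sel k ω ∈ 𝒞 k) →
    (∀ᵐ ω ∂P', Tendsto (fun k =>
      risk P G (lsRule 𝒯 D (fun c i => v c i ω) k (Finset.range k) (sel k ω)) -
        ⨅ p : 𝒞 k, risk P G (lsRule 𝒯 D (fun c i => v c i ω) k (Finset.range k) p))
      atTop (𝓝 0)) →
    ∀ᵐ ω ∂P', Tendsto (fun k =>
      risk P G (lsRule 𝒯 D (fun c i => v c i ω) k (Finset.range k) (sel k ω)))
      atTop (𝓝 (bayesRisk P G))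

/-- Cross-validation: whenever `(L_k, S_k)` minimizes the cross-validated error rate over `𝒞 k`,
the error probability of the rule fitted to any one of the training sets of the cross-validation
almost surely tends to the Bayes risk. -/
def OptimalUnderCrossValidation (P : Measure Ω) (P' : Measure Ω') (G : Fin 2 → Ω → SamplePath T)
    (v : Fin 2 → ℕ → Ω' → SamplePath T) (𝒯 : SamplingScheme T) (𝒞 : ℕ → Set (ℕ × ℕ))
    (D : LearningMethod) : Prop :=
  ∀ (V : ℕ) (𝓕 : FoldScheme V) (sel : ℕ → Ω' → ℕ × ℕ), (∀ k ω, sel k ω ∈ 𝒞 k) →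
    (∀ k ω, ∀ p ∈ 𝒞 k, cvError 𝒯 D 𝓕 (fun c i => v c i ω) k (sel k ω) ≤
      cvError 𝒯 D 𝓕 (fun c i => v c i ω) k p) →
    ∀ᵐ ω ∂P', ∀ u : Fin V, Tendsto (fun k =>
      risk P G (lsRule 𝒯 D (fun c i => v c i ω) k (𝓕.train k u) (sel k ω)))
      atTop (𝓝 (bayesRisk P G))

/-- Cross-validation with refitting: let `d_k → ∞` with `d_k ≤ k ^ α` eventually, for some
`α < 1 / 2`. Whenever `(L_k, S_k)` minimizes the cross-validated error rate over the members of
`𝒞 k` with `L + S ≤ d_k`, the error probability of the rule fitted to all `k + k` paths almost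
surely tends to the Bayes risk. -/
def OptimalUnderCrossValidationRefitted (P : Measure Ω) (P' : Measure Ω') (G : Fin 2 → Ω → SamplePath T)
    (v : Fin 2 → ℕ → Ω' → SamplePath T) (𝒯 : SamplingScheme T) (𝒞 : ℕ → Set (ℕ × ℕ))
    (D : LearningMethod) : Prop :=
  ∀ (V : ℕ) (𝓕 : FoldScheme V) (dmax : ℕ → ℕ) (sel : ℕ → Ω' → ℕ × ℕ), 1 ≤ V →
    Tendsto dmax atTop atTop →
    (∃ α : ℝ, α < 1 / 2 ∧ ∀ᶠ k : ℕ in atTop, (dmax k : ℝ) ≤ (k : ℝ) ^ α) →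
    (∀ᶠ k in atTop, ∀ ω, sel k ω ∈ 𝒞 k ∧ (sel k ω).1 + (sel k ω).2 ≤ dmax k ∧
      ∀ p ∈ 𝒞 k, p.1 + p.2 ≤ dmax k → cvError 𝒯 D 𝓕 (fun c i => v c i ω) k (sel k ω) ≤
        cvError 𝒯 D 𝓕 (fun c i => v c i ω) k p) →
    ∀ᵐ ω ∂P', Tendsto (fun k =>
      risk P G (lsRule 𝒯 D (fun c i => v c i ω) k (Finset.range k) (sel k ω)))
      atTop (𝓝 (bayesRisk P G))

/-- Almost sure Bayes optimality of the method `D` on `LS`-transformed data with respect to the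
processes, for each of the ways to select `(L_k, S_k)` from `𝒞 k`. -/
def IsBayesOptimal (P : Measure Ω) (P' : Measure Ω') (G : Fin 2 → Ω → SamplePath T)
    (v : Fin 2 → ℕ → Ω' → SamplePath T) (𝒯 : SamplingScheme T) (𝒞 : ℕ → Set (ℕ × ℕ))
    (D : LearningMethod) : Prop :=
  OptimalUnderOptimalSelection P P' G v 𝒯 𝒞 D ∧
  OptimalUnderCrossValidation P P' G v 𝒯 𝒞 D ∧
  OptimalUnderCrossValidationRefitted P P' G v 𝒯 𝒞 D

end Optimality

/-! No assigned dimension is shown to be good by itself. Instead every selection is compared with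
one fixed transform `(L, 0)`, which eventually belongs to the admissible set, while the Bayes risk
bounds all risks from below (`bayesRisk_le_risk`). It remains to prove that for each `ε` some fixed
`L` gives risk at most Bayes risk plus `ε` at all late stages, and that the selections cannot do
noticeably worse.

Approximation. A measurable set of paths is close to a cylinder set, its indicator to a continuous
function of finitely many path values, these values to local averages of continuous paths, and the
averages to the transforms of the interpolated paths. Hence some randomized rule based on a fixed
location transform is nearly optimal at all late stages (`exists_location_softRisk_le`).

Estimation. QDA and LDA are both plug-in rules: each is the Bayes rule for two normal distributions
with estimated parameters. Normal distributions are compared in coordinates that whiten the true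
one, so no bound on eigenvalues is needed. There the relative entropy is controlled by the squared
deviation of the parameters, and a Pinsker-type inequality turns this into closeness of all
integrals of functions with values in `[0, 1]` (`gaussian_approximation`). Consequently a plug-in
rule with good estimates almost matches every randomized rule based on the same transform
(`plugIn_risk_le`). Chernoff bounds make every whitened empirical moment accurate to order `ε / d`,
with exceptional probability about `exp (-c k / d ^ 2)`. This remains summable after union bounds if
`d ≤ k ^ α`, `α < 1 / 2`, which gives `ae_risk_le_softRisk` by Borel–Cantelli. For fixed `L` the
covariance matrices of the sampled location vectors are nonsingular at late stages, because those of
the limiting vectors are (`lsCov_det_ne_zero_eventually`). Whenever a covariance matrix is singular,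
the rule is constant.

Validation. Given the training paths, Hoeffding's inequality applies to the validation errors. A
union bound over the dimensions with `L + S ≤ 2 k` suffices: in higher dimensions the estimated
covariance matrices are singular, and the constant rule has an error rate equal to its risk
(`ae_errorRate_sub_risk`). So a minimizer of the cross-validated error is nearly as good in each
fold as `(L, 0)`. After refitting in dimension at most `k ^ α`, the rule is almost as good as any
rule based on the same transform, in particular as the rule fitted in a fold (`ae_risk_le_risk`). -/

/-! ### Gaussian densities -/

section GaussianDensity

variable {d : Type*} [Fintype d] [DecidableEq d]

/-- The density of the normal distribution with mean `m` and covariance matrix `C`. -/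
noncomputable def gaussDens (m : d → ℝ) (C : Matrix d d ℝ) (z : d → ℝ) : ℝ :=
  (√(2 * Real.pi))⁻¹ ^ Fintype.card d *
    Real.exp (-(1 / 2) * (sqMahalanobis m C z + Real.log C.det))

/-- The standard normal distribution on `ℝ^d`. -/
noncomputable abbrev stdNormal (d : Type*) [Fintype d] : Measure (d → ℝ) :=
  Measure.pi fun _ : d => gaussianReal 0 1

/-- The normal distribution with mean `m` and covariance matrix `A * Aᵀ`. -/
noncomputable def gaussLaw (m : d → ℝ) (A : Matrix d d ℝ) : Measure (d → ℝ) :=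
  (stdNormal d).map fun y => m + A.mulVec y

omit [DecidableEq d] in
theorem measurable_affine (m : d → ℝ) (A : Matrix d d ℝ) :
    Measurable fun y : d → ℝ => m + A.mulVec y := by
  have : Continuous fun y : d → ℝ => m + A.mulVec y := by fun_prop
  exact this.measurable

instance (m : d → ℝ) (A : Matrix d d ℝ) : IsProbabilityMeasure (gaussLaw m A) :=
  Measure.isProbabilityMeasure_map (measurable_affine m A).aemeasurable

theorem gaussDens_pos (m : d → ℝ) (C : Matrix d d ℝ) (z : d → ℝ) : 0 < gaussDens m C z := by
  unfold gaussDens; positivity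

theorem continuous_gaussDens (m : d → ℝ) (C : Matrix d d ℝ) : Continuous (gaussDens m C) := by
  unfold gaussDens sqMahalanobis; fun_prop

omit [DecidableEq d] in
theorem stdNormal_eq_withDensity : stdNormal d =
    volume.withDensity fun y => ENNReal.ofReal (∏ i, gaussianPDFReal 0 1 (y i)) := by
  refine (Measure.pi_eq fun s hs => ?_)
  have hint : Integrable (fun y : d → ℝ => ∏ i, gaussianPDFReal 0 1 (y i)) :=
    Integrable.fintype_prod (f := fun _ : d => gaussianPDFReal 0 1)
      (fun _ => integrable_gaussianPDFReal 0 1)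
  have hnn : ∀ y : d → ℝ, 0 ≤ ∏ i, gaussianPDFReal 0 1 (y i) := fun y =>
    Finset.prod_nonneg fun i _ => gaussianPDFReal_nonneg 0 1 _
  have hms : MeasurableSet (Set.univ.pi s) := MeasurableSet.univ_pi hs
  rw [withDensity_apply _ hms, ← ofReal_integral_eq_lintegral_ofReal hint.integrableOn
    (ae_of_all _ hnn), ← integral_indicator hms]
  -- On a box the truncated density is still a product of functions of one variable, so its integral
  -- factorizes.
  have h1 : (Set.univ.pi s).indicator (fun y : d → ℝ => ∏ i, gaussianPDFReal 0 1 (y i)) =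
      fun y => ∏ i, (s i).indicator (gaussianPDFReal 0 1) (y i) := by
    ext y
    by_cases hy : y ∈ Set.univ.pi s
    · rw [Set.indicator_of_mem hy]
      exact Finset.prod_congr rfl fun i _ => (Set.indicator_of_mem (hy i trivial) _).symm
    · rw [Set.indicator_of_notMem hy]
      obtain ⟨i, hi⟩ : ∃ i, y i ∉ s i := by
        by_contra! h
        exact hy fun i _ => h i
      exact (Finset.prod_eq_zero (Finset.mem_univ i) (Set.indicator_of_notMem hi _)).symm
  rw [h1, integral_fintype_prod_volume_eq_prod (fun i => (s i).indicator (gaussianPDFReal 0 1)),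
    ENNReal.ofReal_prod_of_nonneg]
  · refine Finset.prod_congr rfl fun i _ => ?_
    rw [integral_indicator (hs i), gaussianReal_apply_eq_integral 0 one_ne_zero]
  · exact fun i _ => integral_nonneg fun x =>
      Set.indicator_nonneg (fun y _ => gaussianPDFReal_nonneg 0 1 y) x

theorem sqMahalanobis_affine (m : d → ℝ) (A : Matrix d d ℝ) (z : d → ℝ) :
    sqMahalanobis m (A * A.transpose) z = (A⁻¹.mulVec (z - m)) ⬝ᵥ (A⁻¹.mulVec (z - m)) := by
  unfold sqMahalanobis
  rw [Matrix.mul_inv_rev, ← Matrix.mulVec_mulVec, Matrix.dotProduct_mulVec,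
    ← Matrix.transpose_nonsing_inv, Matrix.vecMul_transpose]

theorem sqMahalanobis_add_mulVec (m : d → ℝ) (A : Matrix d d ℝ) (hA : A.det ≠ 0) (y : d → ℝ) :
    sqMahalanobis m (A * A.transpose) (m + A.mulVec y) = y ⬝ᵥ y := by
  rw [sqMahalanobis_affine, add_sub_cancel_left, Matrix.mulVec_mulVec,
    Matrix.nonsing_inv_mul _ hA.isUnit, Matrix.one_mulVec]

/-- Change of variables at the level of densities: the Jacobian `|A.det|` cancels the factor that
comes from `Real.log C.det`, since `C = A * A.transpose` has determinant `A.det ^ 2`. -/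
theorem gaussDens_affine (m : d → ℝ) (A : Matrix d d ℝ) (hA : A.det ≠ 0) (y : d → ℝ) :
    |A.det| * gaussDens m (A * A.transpose) (m + A.mulVec y) = ∏ i, gaussianPDFReal 0 1 (y i) := by
  unfold gaussDens
  rw [sqMahalanobis_add_mulVec m A hA, Matrix.det_mul, Matrix.det_transpose]
  have h1 : Real.exp (-(1 / 2) * (y ⬝ᵥ y + Real.log (A.det * A.det))) =
      Real.exp (∑ i, -(y i) ^ 2 / 2) * |A.det|⁻¹ := by
    rw [Real.log_mul hA hA, ← Real.log_abs, mul_add, Real.exp_add]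
    congr 1
    · rw [dotProduct, Finset.mul_sum]
      congr 1
      exact Finset.sum_congr rfl fun i _ => by ring
    · rw [show -(1 / 2) * (Real.log |A.det| + Real.log |A.det|) = -Real.log |A.det| by ring,
        Real.exp_neg, Real.exp_log (abs_pos.2 hA)]
  rw [h1, Real.exp_sum]
  have h2 : |A.det| ≠ 0 := abs_ne_zero.2 hA
  have h3 : ∀ i, gaussianPDFReal 0 1 (y i) = (√(2 * Real.pi))⁻¹ * Real.exp (-(y i) ^ 2 / 2) := by
    intro i; simp [gaussianPDFReal]
  simp_rw [h3]
  rw [Finset.prod_mul_distrib, Finset.prod_const, Finset.card_univ]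
  field_simp

theorem gaussLaw_eq_withDensity (m : d → ℝ) (A : Matrix d d ℝ) (hA : A.det ≠ 0) :
    gaussLaw m A = volume.withDensity fun z => ENNReal.ofReal (gaussDens m (A * A.transpose) z) := by
  have hdens : Measurable fun z => ENNReal.ofReal (gaussDens m (A * A.transpose) z) :=
    (continuous_gaussDens _ _).measurable.ennreal_ofReal
  have hlin : Measurable (Matrix.toLin' A) := by
    have : Continuous (Matrix.toLin' A) := LinearMap.continuous_on_pi _
    exact this.measurable
  have hcov : ∀ h : (d → ℝ) → ENNReal, Measurable h →
      ∫⁻ z, h z = ENNReal.ofReal |A.det| * ∫⁻ y, h (m + A.mulVec y) := by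
    intro h hh
    have h1 := Real.map_matrix_volume_pi_eq_smul_volume_pi hA
    have h2 : ∫⁻ y, h (m + A.mulVec y) = ENNReal.ofReal |A.det⁻¹| * ∫⁻ z, h z := by
      rw [← lintegral_add_left_eq_self h m, ← smul_eq_mul, ← lintegral_smul_measure, ← h1,
        lintegral_map _ hlin]
      · simp
      · exact hh.comp (measurable_const_add m)
    rw [h2, ← mul_assoc, ← ENNReal.ofReal_mul (abs_nonneg _), ← abs_mul, mul_inv_cancel₀ hA]
    simp
  refine Measure.ext fun s hs => ?_
  have haff := measurable_affine m A
  rw [gaussLaw, Measure.map_apply haff hs, stdNormal_eq_withDensity, withDensity_apply _ (haff hs),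
    withDensity_apply _ hs, ← lintegral_indicator hs, hcov _ (hdens.indicator hs),
    ← lintegral_indicator (haff hs),
    ← lintegral_const_mul (f := fun y => s.indicator _ (m + A.mulVec y)) _
      ((hdens.indicator hs).comp haff)]
  refine lintegral_congr fun y => ?_
  by_cases hy : m + A.mulVec y ∈ s
  · rw [Set.indicator_of_mem hy, Set.indicator_of_mem (by exact hy),
      ← ENNReal.ofReal_mul (abs_nonneg _), gaussDens_affine m A hA]
  · rw [Set.indicator_of_notMem hy, Set.indicator_of_notMem (by exact hy), mul_zero]

theorem integral_gaussLaw (m : d → ℝ) (A : Matrix d d ℝ) (hA : A.det ≠ 0) (φ : (d → ℝ) → ℝ) :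
    ∫ z, φ z ∂gaussLaw m A = ∫ z, φ z * gaussDens m (A * A.transpose) z := by
  rw [gaussLaw_eq_withDensity m A hA, integral_withDensity_eq_integral_toReal_smul
    (continuous_gaussDens _ _).measurable.ennreal_ofReal (ae_of_all _ fun _ => ENNReal.ofReal_lt_top)]
  refine integral_congr_ae (ae_of_all _ fun z => ?_)
  simp only [ENNReal.toReal_ofReal (gaussDens_pos m _ z).le, smul_eq_mul, mul_comm]

theorem integrable_gaussLaw_iff (m : d → ℝ) (A : Matrix d d ℝ) (hA : A.det ≠ 0) (φ : (d → ℝ) → ℝ) :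
    Integrable φ (gaussLaw m A) ↔
      Integrable (fun z => φ z * gaussDens m (A * A.transpose) z) volume := by
  rw [gaussLaw_eq_withDensity m A hA, integrable_withDensity_iff
    (continuous_gaussDens _ _).measurable.ennreal_ofReal (ae_of_all _ fun _ => ENNReal.ofReal_lt_top)]
  simp only [ENNReal.toReal_ofReal (gaussDens_pos m _ _).le]

theorem integrable_gaussDens (m : d → ℝ) (A : Matrix d d ℝ) (hA : A.det ≠ 0) :
    Integrable (gaussDens m (A * A.transpose)) volume := by
  simpa using (integrable_gaussLaw_iff m A hA fun _ => 1).1 (integrable_const 1)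

theorem integral_gaussDens (m : d → ℝ) (A : Matrix d d ℝ) (hA : A.det ≠ 0) :
    ∫ z, gaussDens m (A * A.transpose) z = 1 := by
  simpa using (integral_gaussLaw m A hA fun _ => 1).symm

end GaussianDensity

/-! ### Total variation and relative entropy -/

/-- A pointwise form of Pinsker's inequality. The summand `f - g` integrates to zero for probability
densities, but makes the bracket nonnegative at each point. If `g ≤ f`, the left side is
nonpositive; otherwise the bound is the inequality of arithmetic and geometric means. -/
theorem sub_le_of_relative_entropy {f g φ ε : ℝ} (hf : 0 < f) (hg : 0 < g) (hφ : 0 ≤ φ)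
    (hφ' : φ ≤ 1) (hε : 0 < ε) :
    φ * g - φ * f ≤ ε * g + (f - g + g * (Real.log g - Real.log f)) / ε := by
  have key : g * (Real.log g - Real.log f) ≥ g - f := by
    have := Real.log_le_sub_one_of_pos (div_pos hf hg)
    rw [Real.log_div hf.ne' hg.ne'] at this
    have h2 : g * (f / g - 1) = f - g := by field_simp
    nlinarith
  rcases le_total g f with h | h
  · have h1 : 0 ≤ (f - g + g * (Real.log g - Real.log f)) / ε :=
      div_nonneg (by linarith) (by linarith)
    nlinarith
  · -- write `u = log g - log f ≥ 0`
    set u := Real.log g - Real.log f with hu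
    have hfu : f = g * Real.exp (-u) := by
      rw [hu, neg_sub, Real.exp_sub, Real.exp_log hf, Real.exp_log hg]; field_simp
    have hu0 : 0 ≤ u := sub_nonneg.2 (Real.log_le_log hf h)
    -- With `r = exp (-u / 2)`, factor `1 - r ^ 2 = (1 - r) * (1 + r)`. Here `(1 + r) ^ 2 ≤ 4`, and
    -- `r ≥ 1 - u / 2` bounds `(1 - r) ^ 2`.
    have hq : (1 - Real.exp (-u)) ^ 2 ≤ 4 * (Real.exp (-u) - 1 + u) := by
      have h3 : -(u / 2) + 1 ≤ Real.exp (-(u / 2)) := Real.add_one_le_exp _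
      have h4 : Real.exp (-u) = Real.exp (-(u / 2)) ^ 2 := by
        rw [← Real.exp_nat_mul]; congr 1; push_cast; ring
      have h5 := Real.exp_pos (-(u / 2))
      have h6 : Real.exp (-(u / 2)) ≤ 1 := Real.exp_le_one_iff.2 (by linarith)
      rw [h4]
      set r := Real.exp (-(u / 2))
      have h7 : (1 - r) ^ 2 ≤ r ^ 2 - 1 + u := by nlinarith
      have h8 : (1 + r) ^ 2 ≤ 4 := by nlinarith
      calc (1 - r ^ 2) ^ 2 = (1 - r) ^ 2 * (1 + r) ^ 2 := by ring
        _ ≤ (1 - r) ^ 2 * 4 := by gcongr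
        _ ≤ _ := by linarith
    have hfe : f - g + g * u = g * (Real.exp (-u) - 1 + u) := by rw [hfu]; ring
    rw [hfe]
    have h1 : φ * g - φ * f ≤ g * (1 - Real.exp (-u)) := by
      have : g - f = g * (1 - Real.exp (-u)) := by rw [hfu]; ring
      nlinarith
    have h2 : 1 - Real.exp (-u) ≤ ε + (Real.exp (-u) - 1 + u) / ε := by
      rw [← sub_le_iff_le_add', le_div_iff₀ hε]
      nlinarith [sq_nonneg (1 - Real.exp (-u) - 2 * ε)]
    calc φ * g - φ * f ≤ g * (1 - Real.exp (-u)) := h1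
      _ ≤ g * (ε + (Real.exp (-u) - 1 + u) / ε) := by gcongr
      _ = _ := by ring

/-- The pointwise inequality bounds the difference in one direction only. Applied to `1 - φ` it
yields the other, as both densities have integral one. -/
theorem abs_integral_sub_le_of_relative_entropy {α : Type*} [MeasurableSpace α] {μ : Measure α}
    {f g φ : α → ℝ} (hf : ∀ x, 0 < f x) (hg : ∀ x, 0 < g x) (hfi : Integrable f μ)
    (hgi : Integrable g μ) (hf1 : ∫ x, f x ∂μ = 1) (hg1 : ∫ x, g x ∂μ = 1)
    (hl : Integrable (fun x => g x * (Real.log (g x) - Real.log (f x))) μ)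
    (hφm : Measurable φ) (hφ : ∀ x, 0 ≤ φ x) (hφ' : ∀ x, φ x ≤ 1) {ε : ℝ} (hε : 0 < ε) :
    |∫ x, φ x * f x ∂μ - ∫ x, φ x * g x ∂μ| ≤
      ε + (∫ x, g x * (Real.log (g x) - Real.log (f x)) ∂μ) / ε := by
  have hmul : ∀ {ψ : α → ℝ} {h : α → ℝ}, Measurable ψ → (∀ x, 0 ≤ ψ x) → (∀ x, ψ x ≤ 1) →
      Integrable h μ → Integrable (fun x => ψ x * h x) μ := fun {ψ h} hm h0 h1 hh =>
    hh.bdd_mul (c := 1) hm.aestronglyMeasurable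
      (ae_of_all _ fun x => by rw [Real.norm_eq_abs, abs_of_nonneg (h0 x)]; exact h1 x)
  have main : ∀ ψ : α → ℝ, Measurable ψ → (∀ x, 0 ≤ ψ x) → (∀ x, ψ x ≤ 1) →
      ∫ x, ψ x * g x ∂μ - ∫ x, ψ x * f x ∂μ ≤
        ε + (∫ x, g x * (Real.log (g x) - Real.log (f x)) ∂μ) / ε := by
    intro ψ hm h0 h1
    rw [← integral_sub (hmul hm h0 h1 hgi) (hmul hm h0 h1 hfi)]
    refine (integral_mono ((hmul hm h0 h1 hgi).sub (hmul hm h0 h1 hfi)) ?_ fun x =>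
      sub_le_of_relative_entropy (hf x) (hg x) (h0 x) (h1 x) hε).trans_eq ?_
    · exact (hgi.const_mul ε).add (((hfi.sub hgi).add hl).div_const _)
    · have i1 : Integrable (fun x => ε * g x) μ := hgi.const_mul ε
      have i2 : Integrable (fun x => f x - g x) μ := hfi.sub hgi
      have i3 : Integrable (fun x => (f x - g x + g x * (Real.log (g x) - Real.log (f x))) / ε) μ :=
        (i2.add hl).div_const _
      rw [integral_add i1 i3, integral_const_mul, hg1, integral_div, integral_add i2 hl,
        integral_sub hfi hgi, hf1, hg1]
      simp
  rw [abs_le]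
  constructor
  · have := main φ hφm hφ hφ'
    linarith
  · have h := main (fun x => 1 - φ x) (measurable_const.sub hφm) (fun x => by linarith [hφ' x])
      (fun x => by linarith [hφ x])
    have e : ∀ {k : α → ℝ}, Integrable k μ →
        ∫ x, (1 - φ x) * k x ∂μ = ∫ x, k x ∂μ - ∫ x, φ x * k x ∂μ := by
      intro k hk
      rw [← integral_sub hk (hmul hφm hφ hφ' hk)]
      exact integral_congr_ae (ae_of_all _ fun x => by simp only; ring)
    rw [e hgi, e hfi, hf1, hg1] at h
    linarith

/-! ### Relative entropy of normal distributions -/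

section RelativeEntropy

variable {d : Type*} [Fintype d]

theorem integrable_eval_stdNormal (i : d) : Integrable (fun y : d → ℝ => y i) (stdNormal d) :=
  integrable_eval (μ := fun _ : d => gaussianReal 0 1) (i := i) IsGaussian.integrable_id

theorem memLp_eval_stdNormal (i : d) : MemLp (fun y : d → ℝ => y i) 2 (stdNormal d) :=
  (memLp_id_gaussianReal (μ := 0) (v := 1) 2).comp_measurePreserving
    (measurePreserving_eval (fun _ : d => gaussianReal 0 1) i)

theorem memLp_affine_stdNormal (c : ℝ) (b : d → ℝ) :
    MemLp (fun y : d → ℝ => c + b ⬝ᵥ y) 2 (stdNormal d) :=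
  (memLp_const c).add (memLp_finsetSum _ fun i _ => (memLp_eval_stdNormal i).const_mul (b i))

theorem integral_sq_affine_stdNormal (c : ℝ) (b : d → ℝ) :
    ∫ y, (c + b ⬝ᵥ y) ^ 2 ∂stdNormal d = c ^ 2 + b ⬝ᵥ b := by
  have hmean : ∫ y, (c + b ⬝ᵥ y) ∂stdNormal d = c := by
    simp only [dotProduct]
    rw [integral_add (integrable_const _)
      (integrable_finsetSum _ fun i _ => (integrable_eval_stdNormal i).const_mul (b i))]
    rw [integral_finsetSum _ fun i _ => (integrable_eval_stdNormal i).const_mul (b i)]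
    have : ∀ i : d, ∫ y : d → ℝ, b i * y i ∂stdNormal d = 0 := fun i => by
      rw [integral_const_mul, integral_eval]
      simp
    simp [this]
  have hvar : Var[fun y => c + b ⬝ᵥ y; stdNormal d] = b ⬝ᵥ b := by
    rw [variance_const_add (by
      exact (memLp_finsetSum _ fun i _ => (memLp_eval_stdNormal i).const_mul (b i)).1)]
    have h := variance_sum_pi (μ := fun _ : d => gaussianReal 0 1) (X := fun i y => b i * y)
      (fun i => (memLp_id_gaussianReal 2).const_mul (b i))
    have e : (∑ i, fun y : d → ℝ => b i * y i) = fun y => b ⬝ᵥ y := by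
      ext y; simp [dotProduct]
    rw [e] at h
    rw [h]
    refine Finset.sum_congr rfl fun i _ => ?_
    rw [variance_const_mul, variance_fun_id_gaussianReal]
    simp; ring
  have h := variance_eq_sub (memLp_affine_stdNormal c b)
  rw [hmean, hvar] at h
  simp only [Pi.pow_apply] at h
  linarith

theorem integrable_sq_affine_stdNormal (c : ℝ) (b : d → ℝ) :
    Integrable (fun y => (c + b ⬝ᵥ y) ^ 2) (stdNormal d) :=
  (memLp_affine_stdNormal c b).integrable_sq

variable [DecidableEq d]

theorem log_gaussDens (m : d → ℝ) (C : Matrix d d ℝ) (z : d → ℝ) :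
    Real.log (gaussDens m C z) = Real.log ((√(2 * Real.pi))⁻¹ ^ Fintype.card d) -
      (sqMahalanobis m C z + Real.log C.det) / 2 := by
  unfold gaussDens
  rw [Real.log_mul (by positivity) (Real.exp_pos _).ne', Real.log_exp]
  ring

/-- The relative entropy of `N(m', (A S)(A S)ᵀ)` with respect to `N(m, A Aᵀ)`. -/
theorem relative_entropy_gaussDens (m m' : d → ℝ) (A S : Matrix d d ℝ) (hA : A.det ≠ 0)
    (hS : S.det ≠ 0) :
    Integrable (fun z => gaussDens m' (A * S * (A * S).transpose) z *
      (Real.log (gaussDens m' (A * S * (A * S).transpose) z) -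
        Real.log (gaussDens m (A * A.transpose) z))) volume ∧
    ∫ z, gaussDens m' (A * S * (A * S).transpose) z *
      (Real.log (gaussDens m' (A * S * (A * S).transpose) z) -
        Real.log (gaussDens m (A * A.transpose) z)) =
    ((S * S.transpose).trace - Fintype.card d - Real.log (S * S.transpose).det +
      A⁻¹.mulVec (m' - m) ⬝ᵥ A⁻¹.mulVec (m' - m)) / 2 := by
  have hAS : (A * S).det ≠ 0 := by rw [Matrix.det_mul]; exact mul_ne_zero hA hS
  set ν := A⁻¹.mulVec (m' - m) with hν
  set F : (d → ℝ) → ℝ := fun z => Real.log (gaussDens m' (A * S * (A * S).transpose) z) -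
        Real.log (gaussDens m (A * A.transpose) z) with hF
  -- In standard normal coordinates the log-likelihood ratio is a quadratic polynomial. The
  -- coordinate `y i` is written as the affine form with coefficients `Pi.single i 1`, so that one
  -- second-moment formula covers all terms.
  have hval : ∀ y, F (m' + (A * S).mulVec y) =
      (∑ i, ((ν i + S i ⬝ᵥ y) ^ 2 - (0 + (Pi.single i 1 : d → ℝ) ⬝ᵥ y) ^ 2) -
        Real.log (S * S.transpose).det) / 2 := by
    intro y
    simp only [hF, log_gaussDens]
    rw [sqMahalanobis_add_mulVec _ _ hAS, sqMahalanobis_affine]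
    have h1 : A⁻¹.mulVec (m' + (A * S).mulVec y - m) = ν + S.mulVec y := by
      rw [hν, add_sub_right_comm, Matrix.mulVec_add, Matrix.mulVec_mulVec, ← Matrix.mul_assoc,
        Matrix.nonsing_inv_mul _ hA.isUnit, Matrix.one_mul]
    have h2 : Real.log (A * S * (A * S).transpose).det =
        Real.log (A * A.transpose).det + Real.log (S * S.transpose).det := by
      rw [← Real.log_mul]
      · congr 1; simp only [Matrix.det_mul, Matrix.det_transpose]; ring
      · simp [hA]
      · simp [hS]
    rw [h1, h2, Finset.sum_sub_distrib]
    have h3 : (ν + S.mulVec y) ⬝ᵥ (ν + S.mulVec y) = ∑ i, (ν i + S i ⬝ᵥ y) ^ 2 :=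
      Finset.sum_congr rfl fun i _ => by simp [Matrix.mulVec, sq]
    have h4 : y ⬝ᵥ y = ∑ i, (0 + (Pi.single i 1 : d → ℝ) ⬝ᵥ y) ^ 2 :=
      Finset.sum_congr rfl fun i _ => by simp [sq]
    rw [h3, h4]; ring
  have hFm : Measurable F :=
    ((continuous_gaussDens _ _).measurable.log).sub ((continuous_gaussDens _ _).measurable.log)
  have haff := measurable_affine m' (A * S)
  have hi : ∀ i, Integrable (fun y => (ν i + S i ⬝ᵥ y) ^ 2 -
      (0 + (Pi.single i 1 : d → ℝ) ⬝ᵥ y) ^ 2) (stdNormal d) := fun i =>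
    (integrable_sq_affine_stdNormal _ _).sub (integrable_sq_affine_stdNormal _ _)
  have hint : Integrable F (gaussLaw m' (A * S)) := by
    rw [gaussLaw, integrable_map_measure hFm.aestronglyMeasurable haff.aemeasurable]
    simp only [Function.comp_def, hval]
    exact ((integrable_finsetSum _ fun i _ => hi i).sub (integrable_const _)).div_const 2
  constructor
  · simpa only [mul_comm] using (integrable_gaussLaw_iff m' _ hAS F).1 hint
  · have := integral_gaussLaw m' _ hAS F
    simp only [mul_comm (F _)] at this
    rw [← this, gaussLaw, integral_map haff.aemeasurable hFm.aestronglyMeasurable]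
    simp only [hval]
    rw [integral_div, integral_sub (integrable_finsetSum _ fun i _ => hi i) (integrable_const _),
      integral_finsetSum _ fun i _ => hi i]
    simp_rw [fun i => integral_sub (integrable_sq_affine_stdNormal (ν i) (S i))
      (integrable_sq_affine_stdNormal 0 (Pi.single i 1 : d → ℝ)), integral_sq_affine_stdNormal]
    have e1 : (S * S.transpose).trace = ∑ i, S i ⬝ᵥ S i := by
      simp only [Matrix.trace, Matrix.diag, Matrix.mul_apply, dotProduct, Matrix.transpose_apply]
    have e2 : ν ⬝ᵥ ν = ∑ i, ν i ^ 2 := Finset.sum_congr rfl fun i _ => by ring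
    rw [e1, e2]
    simp [Finset.sum_add_distrib, Finset.sum_sub_distrib]
    ring

/-- A symmetric matrix close to the identity has a nonsingular square root, and the leading terms
of its Stein loss cancel. -/
theorem exists_sqrt_of_close_to_one (M : Matrix d d ℝ) (hM : M.IsSymm)
    (hclose : ∑ i, ∑ j, ((M - 1) i j) ^ 2 ≤ 1 / 4) :
    ∃ S : Matrix d d ℝ, S.det ≠ 0 ∧ M = S * S.transpose ∧
      M.trace - Fintype.card d - Real.log M.det ≤ 2 * ∑ i, ∑ j, ((M - 1) i j) ^ 2 := by
  have hH : M.IsHermitian := by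
    rw [Matrix.IsHermitian, Matrix.conjTranspose_eq_transpose_of_trivial]; exact hM
  set lam := hH.eigenvalues with hlam
  set U : Matrix d d ℝ := (hH.eigenvectorUnitary : Matrix d d ℝ) with hU
  have hUU : U * U.transpose = 1 := by
    have := Unitary.coe_mul_star_self hH.eigenvectorUnitary
    simpa [Matrix.star_eq_conjTranspose] using this
  have hUU' : U.transpose * U = 1 := by
    have := Unitary.coe_star_mul_self hH.eigenvectorUnitary
    simpa [Matrix.star_eq_conjTranspose] using this
  have hspec : M = U * Matrix.diagonal lam * U.transpose := by
    have := hH.spectral_theorem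
    rw [Unitary.conjStarAlgAut_apply] at this
    simpa [Matrix.star_eq_conjTranspose, Function.comp_def] using this
  -- The Frobenius norm is invariant under the orthogonal matrix that diagonalizes `M`.
  have hsq : ∑ i, ∑ j, ((M - 1) i j) ^ 2 = ∑ i, (lam i - 1) ^ 2 := by
    have h1 : M - 1 = U * Matrix.diagonal (fun i => lam i - 1) * U.transpose := by
      have : Matrix.diagonal (fun i => lam i - 1) = Matrix.diagonal lam - 1 := by
        rw [← Matrix.diagonal_one, Matrix.diagonal_sub]
      rw [this, Matrix.mul_sub, Matrix.sub_mul, ← hspec, Matrix.mul_one, hUU]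
    have hs : (M - 1).transpose = M - 1 := by rw [Matrix.transpose_sub, hM, Matrix.transpose_one]
    have h2 : ∑ i, ∑ j, ((M - 1) i j) ^ 2 = ((M - 1) * (M - 1).transpose).trace := by
      simp only [Matrix.trace, Matrix.diag, Matrix.mul_apply, Matrix.transpose_apply, sq]
    rw [h2, hs, h1]
    rw [show U * Matrix.diagonal (fun i => lam i - 1) * U.transpose *
        (U * Matrix.diagonal (fun i => lam i - 1) * U.transpose) =
        U * (Matrix.diagonal (fun i => lam i - 1) * (U.transpose * U) *
          Matrix.diagonal (fun i => lam i - 1) * U.transpose) by simp only [Matrix.mul_assoc],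
      Matrix.trace_mul_comm, hUU', Matrix.mul_one, Matrix.mul_assoc, hUU', Matrix.mul_one,
      Matrix.diagonal_mul_diagonal, Matrix.trace_diagonal]
    exact Finset.sum_congr rfl fun i _ => by ring
  have hpos : ∀ i, 1 / 2 ≤ lam i := by
    intro i
    have : (lam i - 1) ^ 2 ≤ 1 / 4 := by
      rw [hsq] at hclose
      exact (Finset.single_le_sum (f := fun i => (lam i - 1) ^ 2) (fun j _ => sq_nonneg _)
        (Finset.mem_univ i)).trans hclose
    nlinarith
  refine ⟨U * Matrix.diagonal (fun i => √(lam i)), ?_, ?_, ?_⟩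
  · rw [Matrix.det_mul, Matrix.det_diagonal]
    refine mul_ne_zero (fun h => ?_) (Finset.prod_ne_zero_iff.2 fun i _ => ?_)
    · have := congrArg Matrix.det hUU
      rw [Matrix.det_mul, h] at this
      simp at this
    · exact (Real.sqrt_pos.2 (by linarith [hpos i])).ne'
  · rw [Matrix.transpose_mul, Matrix.diagonal_transpose, ← Matrix.mul_assoc,
      Matrix.mul_assoc U, Matrix.diagonal_mul_diagonal]
    rw [hspec]
    congr 3
    ext i
    exact (Real.mul_self_sqrt (by linarith [hpos i])).symm
  · rw [hsq, hH.trace_eq_sum_eigenvalues, hH.det_eq_prod_eigenvalues]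
    simp only [RCLike.ofReal_real_eq_id, id_eq]
    rw [Real.log_prod fun i _ => (lt_of_lt_of_le (by norm_num) (hpos i)).ne']
    rw [Finset.mul_sum, ← hlam]
    have : (Fintype.card d : ℝ) = ∑ _i : d, (1 : ℝ) := by simp
    rw [this, ← Finset.sum_sub_distrib, ← Finset.sum_sub_distrib]
    -- For each eigenvalue, `λ - 1 - log λ ≤ λ - 1 - (1 - 1 / λ) = (λ - 1) ^ 2 / λ`, and `1 / λ ≤
    -- 2`.
    refine Finset.sum_le_sum fun i _ => ?_
    have hp : 0 < lam i := lt_of_lt_of_le (by norm_num) (hpos i)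
    have h1 := Real.one_sub_inv_le_log_of_pos hp
    have h2 : (lam i)⁻¹ ≤ 2 := by
      rw [inv_le_comm₀ hp (by norm_num)]; linarith [hpos i]
    have h3 : lam i * (lam i)⁻¹ = 1 := mul_inv_cancel₀ hp.ne'
    have h4 : lam i - 1 - (1 - (lam i)⁻¹) = (lam i - 1) ^ 2 * (lam i)⁻¹ := by
      field_simp
    nlinarith [sq_nonneg (lam i - 1)]

/-- How far the parameters `(m', C)` are from `(m, A Aᵀ)`, in coordinates in which the latter are
`(0, 1)`. -/
noncomputable def whitenedDeviation (m : d → ℝ) (A : Matrix d d ℝ) (m' : d → ℝ)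
    (C : Matrix d d ℝ) : ℝ :=
  ∑ i, ∑ j, ((A⁻¹ * C * A⁻¹.transpose - 1) i j) ^ 2 +
    A⁻¹.mulVec (m' - m) ⬝ᵥ A⁻¹.mulVec (m' - m)

/-- A square root `S` of the whitened covariance matrix puts `C` into the form `(A * S) * (A *
S).transpose`, for which the relative entropy is explicit and at most `whitenedDeviation`, hence at
most `ε ^ 2`. The Pinsker-type bound is then `ε + ε ^ 2 / ε`. The condition `ε ≤ 1 / 2` keeps the
Frobenius distance within the reach of `exists_sqrt_of_close_to_one`. -/
theorem gaussian_approximation (m m' : d → ℝ) (A C : Matrix d d ℝ) (hA : A.det ≠ 0)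
    (hC : C.IsSymm) {ε : ℝ} (hε : 0 < ε) (hε' : ε ≤ 1 / 2)
    (hdev : whitenedDeviation m A m' C ≤ ε ^ 2) :
    0 < C.det ∧ Integrable (gaussDens m' C) volume ∧
      ∀ φ : (d → ℝ) → ℝ, Measurable φ → (∀ x, 0 ≤ φ x) → (∀ x, φ x ≤ 1) →
        |∫ z, φ z ∂gaussLaw m A - ∫ z, φ z * gaussDens m' C z| ≤ 2 * ε := by
  set M := A⁻¹ * C * A⁻¹.transpose with hMdef
  have hν : 0 ≤ A⁻¹.mulVec (m' - m) ⬝ᵥ A⁻¹.mulVec (m' - m) :=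
    Finset.sum_nonneg fun i _ => mul_self_nonneg _
  have hfro : 0 ≤ ∑ i, ∑ j, ((M - 1) i j) ^ 2 :=
    Finset.sum_nonneg fun i _ => Finset.sum_nonneg fun j _ => sq_nonneg _
  rw [whitenedDeviation, ← hMdef] at hdev
  have hM : M.IsSymm := by
    rw [Matrix.IsSymm, hMdef, Matrix.transpose_mul, Matrix.transpose_mul, hC,
      Matrix.transpose_transpose, Matrix.mul_assoc]
  obtain ⟨S, hS, hMS, hlog⟩ := exists_sqrt_of_close_to_one M hM (by nlinarith)
  have hCA : C = A * S * (A * S).transpose := by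
    rw [Matrix.transpose_mul, Matrix.mul_assoc A, ← Matrix.mul_assoc S, ← hMS, hMdef,
      Matrix.mul_assoc, Matrix.mul_assoc, Matrix.transpose_nonsing_inv,
      Matrix.nonsing_inv_mul _ (by rw [Matrix.det_transpose]; exact hA.isUnit), Matrix.mul_one,
      ← Matrix.mul_assoc, Matrix.mul_nonsing_inv _ hA.isUnit, Matrix.one_mul]
  have hAS : (A * S).det ≠ 0 := by rw [Matrix.det_mul]; exact mul_ne_zero hA hS
  refine ⟨?_, ?_, ?_⟩
  · rw [hCA, Matrix.det_mul, Matrix.det_transpose]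
    exact mul_self_pos.2 hAS
  · rw [hCA]; exact integrable_gaussDens m' _ hAS
  · intro φ hφm h0 h1
    obtain ⟨hi, hv⟩ := relative_entropy_gaussDens m m' A S hA hS
    have := abs_integral_sub_le_of_relative_entropy (gaussDens_pos m (A * A.transpose))
      (gaussDens_pos m' (A * S * (A * S).transpose)) (integrable_gaussDens m A hA)
      (integrable_gaussDens m' _ hAS) (integral_gaussDens m A hA) (integral_gaussDens m' _ hAS) hi
      hφm h0 h1 hε
    rw [integral_gaussLaw m A hA, hCA]
    refine this.trans ?_
    rw [hv, ← hMS]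
    have : (M.trace - Fintype.card d - Real.log M.det +
      A⁻¹.mulVec (m' - m) ⬝ᵥ A⁻¹.mulVec (m' - m)) / 2 / ε ≤ ε := by
      rw [div_le_iff₀ hε]; nlinarith
    linarith

end RelativeEntropy

/-! ### Plug-in rules -/

section PlugIn

variable {d : Type*} [Fintype d] [DecidableEq d]

open Classical in
/-- The rule that is Bayes optimal for the classes `N(m c, C c)`. -/
noncomputable def plugIn (m : Fin 2 → d → ℝ) (C : Fin 2 → Matrix d d ℝ) (z : d → ℝ) : Fin 2 :=
  if (C 0).det ≠ 0 ∧ (C 1).det ≠ 0 ∧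
      sqMahalanobis (m 1) (C 1) z + Real.log (C 1).det
        < sqMahalanobis (m 0) (C 0) z + Real.log (C 0).det
  then 1 else 0

theorem qda_eq_plugIn (I : Finset ℕ) (y : Fin 2 → ℕ → d → ℝ) :
    qda I y = plugIn (fun c => sampleMean I (y c)) (fun c => sampleCov I (y c)) := rfl

theorem lda_eq_plugIn (I : Finset ℕ) (y : Fin 2 → ℕ → d → ℝ) :
    lda I y = plugIn (fun c => sampleMean I (y c)) (fun _ => pooledCov I y) := by
  ext z
  unfold lda plugIn
  simp

/-- The adjugate depends continuously on the matrix, also at singular ones. Only the scalar factor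
is discontinuous, and it is measurable, so this form gives measurability of plug-in rules jointly in
data and parameters. -/
theorem sqMahalanobis_eq_adjugate (m : d → ℝ) (C : Matrix d d ℝ) (z : d → ℝ) :
    sqMahalanobis m C z = (C.det)⁻¹ * ((z - m) ⬝ᵥ C.adjugate.mulVec (z - m)) := by
  rw [sqMahalanobis, Matrix.inv_def, Ring.inverse_eq_inv', Matrix.smul_mulVec, dotProduct_smul,
    smul_eq_mul]

theorem measurable_plugIn {X : Type*} [TopologicalSpace X] [MeasurableSpace X]
    [OpensMeasurableSpace X] {m : X → Fin 2 → d → ℝ} {C : X → Fin 2 → Matrix d d ℝ}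
    {z : X → d → ℝ} (hm : ∀ c, Continuous fun x => m x c) (hC : ∀ c, Continuous fun x => C x c)
    (hz : Continuous z) : Measurable fun x => plugIn (m x) (C x) (z x) := by
  have hdet : ∀ c, Measurable fun x => (C x c).det := fun c => (hC c).matrix_det.measurable
  have hdisc : ∀ c, Measurable fun x =>
      sqMahalanobis (m x c) (C x c) (z x) + Real.log (C x c).det := by
    intro c
    simp only [sqMahalanobis_eq_adjugate]
    refine ((hdet c).inv.mul ?_).add (hdet c).log
    have h1 : Continuous fun x => z x - m x c := hz.sub (hm c)
    have h2 : Continuous fun x => (C x c).adjugate := (hC c).matrix_adjugate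
    exact (h1.dotProduct (h2.matrix_mulVec h1)).measurable
  refine Measurable.ite ?_ measurable_const measurable_const
  have hne : ∀ c, MeasurableSet {x | (C x c).det ≠ 0} := fun c =>
    (hdet c) (measurableSet_singleton 0).compl
  exact (hne 0).inter ((hne 1).inter (measurableSet_lt (hdisc 1) (hdisc 0)))

omit [DecidableEq d] in
theorem fin_two_ne_zero_iff {a : Fin 2} : a ≠ 0 ↔ a = 1 := by omega

/-- A plug-in rule with parameters close to those of two normal distributions performs almost as
well, for these distributions, as any randomized rule. -/
theorem plugIn_risk_le (m m' : Fin 2 → d → ℝ) (A C : Fin 2 → Matrix d d ℝ)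
    (hA : ∀ c, (A c).det ≠ 0) (hC : ∀ c, (C c).IsSymm) {ε : ℝ} (hε : 0 < ε) (hε' : ε ≤ 1 / 2)
    (hdev : ∀ c, whitenedDeviation (m c) (A c) (m' c) (C c) ≤ ε ^ 2)
    (ψ : (d → ℝ) → ℝ) (hψm : Measurable ψ) (hψ : ∀ z, 0 ≤ ψ z) (hψ' : ∀ z, ψ z ≤ 1) :
    (gaussLaw (m 0) (A 0)).real {z | plugIn m' C z ≠ 0} +
        (gaussLaw (m 1) (A 1)).real {z | plugIn m' C z ≠ 1} ≤
      ∫ z, ψ z ∂gaussLaw (m 0) (A 0) + ∫ z, (1 - ψ z) ∂gaussLaw (m 1) (A 1) + 8 * ε := by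
  have hg : Measurable (plugIn m' C) :=
    measurable_plugIn (fun c => continuous_const) (fun c => continuous_const) continuous_id
  have happ := fun c => gaussian_approximation (m c) (m' c) (A c) (C c) (hA c) (hC c) hε hε' (hdev c)
  set S : Set (d → ℝ) := {z | plugIn m' C z = 1} with hSdef
  have hS : MeasurableSet S := hg (measurableSet_singleton 1)
  have e0 : {z | plugIn m' C z ≠ 0} = S := by ext z; simp [hSdef, fin_two_ne_zero_iff]
  have e1 : {z | plugIn m' C z ≠ 1} = Sᶜ := rfl
  set χ : (d → ℝ) → ℝ := S.indicator 1 with hχ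
  have hχm : Measurable χ := measurable_one.indicator hS
  have hχ0 : ∀ z, 0 ≤ χ z := fun z => Set.indicator_nonneg (fun _ _ => zero_le_one) z
  have hχ1 : ∀ z, χ z ≤ 1 := fun z => Set.indicator_le_self' (fun _ _ => zero_le_one) z
  have r0 : (gaussLaw (m 0) (A 0)).real S = ∫ z, χ z ∂gaussLaw (m 0) (A 0) :=
    (integral_indicator_one hS).symm
  have r1 : (gaussLaw (m 1) (A 1)).real Sᶜ = ∫ z, (1 - χ z) ∂gaussLaw (m 1) (A 1) := by
    rw [← integral_indicator_one hS.compl]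
    refine integral_congr_ae (ae_of_all _ fun z => ?_)
    by_cases h : z ∈ S <;> simp [hχ, h]
  rw [e0, e1, r0, r1]
  have a0 := (happ 0).2.2 χ hχm hχ0 hχ1
  have a1 := (happ 1).2.2 (fun z => 1 - χ z) (measurable_const.sub hχm)
    (fun z => by linarith [hχ1 z]) (fun z => by linarith [hχ0 z])
  have b0 := (happ 0).2.2 ψ hψm hψ hψ'
  have b1 := (happ 1).2.2 (fun z => 1 - ψ z) (measurable_const.sub hψm)
    (fun z => by linarith [hψ' z]) (fun z => by linarith [hψ z])
  have hint : ∀ c, ∀ φ : (d → ℝ) → ℝ, Measurable φ → (∀ x, 0 ≤ φ x) → (∀ x, φ x ≤ 1) →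
      Integrable (fun z => φ z * gaussDens (m' c) (C c) z) volume := fun c φ hm h0 h1 =>
    (happ c).2.1.bdd_mul (c := 1) hm.aestronglyMeasurable
      (ae_of_all _ fun x => by rw [Real.norm_eq_abs, abs_of_nonneg (h0 x)]; exact h1 x)
  have i0 := hint 0 χ hχm hχ0 hχ1
  have i1 := hint 1 (fun z => 1 - χ z) (measurable_const.sub hχm)
    (fun z => by linarith [hχ1 z]) (fun z => by linarith [hχ0 z])
  have j0 := hint 0 ψ hψm hψ hψ'
  have j1 := hint 1 (fun z => 1 - ψ z) (measurable_const.sub hψm)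
    (fun z => by linarith [hψ' z]) (fun z => by linarith [hψ z])
  -- The plug-in rule chooses the larger estimated density at each point, so under the estimated
  -- laws it beats any `ψ` already in the integrand.
  have hmain : (∫ z, χ z * gaussDens (m' 0) (C 0) z) + ∫ z, (1 - χ z) * gaussDens (m' 1) (C 1) z ≤
      (∫ z, ψ z * gaussDens (m' 0) (C 0) z) + ∫ z, (1 - ψ z) * gaussDens (m' 1) (C 1) z := by
    rw [← integral_add i0 i1, ← integral_add j0 j1]
    refine integral_mono (i0.add i1) (j0.add j1) fun z => ?_
    have hd : ∀ c c', gaussDens (m' c) (C c) z ≤ gaussDens (m' c') (C c') z ↔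
        sqMahalanobis (m' c') (C c') z + Real.log (C c').det ≤
          sqMahalanobis (m' c) (C c) z + Real.log (C c).det := by
      intro c c'
      unfold gaussDens
      rw [mul_le_mul_iff_right₀ (by positivity), Real.exp_le_exp]
      constructor <;> intro h <;> linarith
    by_cases h : z ∈ S
    · have h' : gaussDens (m' 0) (C 0) z ≤ gaussDens (m' 1) (C 1) z := by
        rw [hd]
        by_contra! hcon
        have : plugIn m' C z = 0 := by
          unfold plugIn
          rw [if_neg]
          rintro ⟨-, -, h3⟩
          exact absurd h3 (not_lt.2 hcon.le)
        rw [hSdef, Set.mem_ofPred_eq, this] at h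
        exact absurd h (by decide)
      have hx : χ z = 1 := Set.indicator_of_mem h _
      simp only [hx]
      nlinarith [hψ' z, hψ z]
    · have h' : gaussDens (m' 1) (C 1) z ≤ gaussDens (m' 0) (C 0) z := by
        rw [hd]
        by_contra! hcon
        exact h (if_pos ⟨(happ 0).1.ne', (happ 1).1.ne', hcon⟩)
      have hx : χ z = 0 := Set.indicator_of_notMem h _
      simp only [hx]
      nlinarith [hψ' z, hψ z]
  -- Four replacements of true by estimated laws, for `χ`, `1 - χ`, `ψ` and `1 - ψ`, cost `2 * ε`
  -- each.
  rw [abs_le] at a0 a1 b0 b1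
  linarith [a0.1, a0.2, a1.1, a1.2, b0.1, b0.2, b1.1, b1.2]

end PlugIn

/-! ### Concentration of sample moments of standard normal vectors -/

section Concentration

variable {Ω : Type*} [MeasurableSpace Ω] {P : Measure Ω} [IsProbabilityMeasure P]

omit [IsProbabilityMeasure P] in
theorem chernoff_sum [IsFiniteMeasure P] {X : ℕ → Ω → ℝ} (hind : iIndepFun X P) (hm : ∀ i, Measurable (X i))
    (I : Finset ℕ) {s κ a : ℝ} (hs : 0 ≤ s)
    (hint : ∀ i, Integrable (fun ω => Real.exp (s * X i ω)) P)
    (hmgf : ∀ i, mgf (X i) P s ≤ Real.exp κ) :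
    P.real {ω | I.card * a ≤ ∑ i ∈ I, X i ω} ≤ Real.exp (I.card * (κ - s * a)) := by
  have h1 := measure_ge_le_exp_mul_mgf (μ := P) (X := ∑ i ∈ I, X i) (I.card * a) hs
    (hind.integrable_exp_mul_sum hm fun i _ => hint i)
  rw [hind.mgf_sum hm] at h1
  have h2 : ∏ i ∈ I, mgf (X i) P s ≤ Real.exp κ ^ I.card :=
    (Finset.prod_le_prod (fun i _ => mgf_nonneg) fun i _ => hmgf i).trans_eq (Finset.prod_const _)
  simp only [Finset.sum_apply] at h1
  refine h1.trans ((mul_le_mul_of_nonneg_left h2 (Real.exp_pos _).le).trans_eq ?_)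
  rw [← Real.exp_nat_mul, ← Real.exp_add]
  congr 1; ring

theorem exp_sq_gaussian {s : ℝ} (hs : s < 1 / 2) :
    Integrable (fun x => Real.exp (s * x ^ 2)) (gaussianReal 0 1) ∧
      ∫ x, Real.exp (s * x ^ 2) ∂gaussianReal 0 1 = (√(1 - 2 * s))⁻¹ := by
  have hb : 0 < 1 / 2 - s := by linarith
  have e : ∀ x : ℝ, gaussianPDFReal 0 1 x * Real.exp (s * x ^ 2) =
      (√(2 * Real.pi))⁻¹ * Real.exp (-(1 / 2 - s) * x ^ 2) := by
    intro x
    simp only [gaussianPDFReal, NNReal.coe_one, mul_one, sub_zero]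
    rw [mul_assoc, ← Real.exp_add]
    congr 2; ring
  constructor
  · rw [gaussianReal_of_var_ne_zero _ one_ne_zero, integrable_withDensity_iff
      (measurable_gaussianPDF _ _) (ae_of_all _ fun _ => ENNReal.ofReal_lt_top)]
    simp only [toReal_gaussianPDF, mul_comm (Real.exp _), e]
    exact (integrable_exp_neg_mul_sq hb).const_mul _
  · rw [integral_gaussianReal_eq_integral_smul one_ne_zero]
    simp only [smul_eq_mul, e]
    rw [integral_const_mul, integral_gaussian, ← Real.sqrt_inv, ← Real.sqrt_inv,
      ← Real.sqrt_mul (by positivity)]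
    congr 1
    have := Real.pi_pos.ne'
    have : 1 - 2 * s ≠ 0 := by linarith
    field_simp

/-- First-order expansion of `-log (1 - 2 s) / 2` with a quadratic remainder. It bounds the moment
generating function of a squared standard normal variable near zero by one of sub-exponential type.
-/
theorem inv_sqrt_le_exp {s : ℝ} (hs : |s| ≤ 1 / 4) :
    (√(1 - 2 * s))⁻¹ ≤ Real.exp (s + 4 * s ^ 2) := by
  have h2 : |2 * s| ≤ 1 / 2 := by rw [abs_mul]; norm_num; linarith
  have h := Real.abs_log_sub_add_sum_range_le (x := 2 * s) (by linarith) 1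
  have hpos : 0 < 1 - 2 * s := by linarith [(abs_le.1 h2).2]
  have h3 : |2 * s| ^ (1 + 1) / (1 - |2 * s|) ≤ 8 * s ^ 2 := by
    rw [div_le_iff₀ (by linarith)]
    have : |2 * s| ^ 2 = 4 * s ^ 2 := by rw [sq_abs]; ring
    rw [show 1 + 1 = 2 from rfl, this]
    nlinarith [sq_nonneg s]
  have h4 : -Real.log (1 - 2 * s) ≤ 2 * s + 8 * s ^ 2 := by
    have h5 := (abs_le.1 (h.trans h3)).1
    simp at h5
    linarith
  have h6 : (√(1 - 2 * s))⁻¹ = Real.exp (-Real.log (1 - 2 * s) / 2) := by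
    rw [neg_div, Real.exp_neg, ← Real.log_sqrt hpos.le, Real.exp_log (Real.sqrt_pos.2 hpos)]
  rw [h6]
  exact Real.exp_le_exp.2 (by linarith)

/-- Chernoff bounds for both tails. For the squares the parameter `s = t / 8` gives the exponent `4
* s ^ 2 - s * t = -t ^ 2 / 16` per observation; for the sums `s = t` gives `-t ^ 2 / 2`, which is
better than needed. -/
theorem gaussian_sample_moments {η : ℕ → Ω → ℝ} (hind : iIndepFun η P) (hm : ∀ i, Measurable (η i))
    (hlaw : ∀ i, P.map (η i) = gaussianReal 0 1) (I : Finset ℕ) {t : ℝ} (ht : 0 < t) (ht1 : t ≤ 1) :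
    P.real {ω | I.card * t < |∑ i ∈ I, η i ω ^ 2 - I.card|} ≤
        2 * Real.exp (-(I.card * t ^ 2 / 16)) ∧
      P.real {ω | I.card * t < |∑ i ∈ I, η i ω|} ≤ 2 * Real.exp (-(I.card * t ^ 2 / 16)) := by
  have split : ∀ (X Y : ℕ → Ω → ℝ) (E : Set Ω) (a b : ℝ),
      E ⊆ {ω | I.card * a ≤ ∑ i ∈ I, X i ω} ∪ {ω | I.card * b ≤ ∑ i ∈ I, Y i ω} →
      P.real {ω | I.card * a ≤ ∑ i ∈ I, X i ω} ≤ Real.exp (-(I.card * t ^ 2 / 16)) →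
      P.real {ω | I.card * b ≤ ∑ i ∈ I, Y i ω} ≤ Real.exp (-(I.card * t ^ 2 / 16)) →
      P.real E ≤ 2 * Real.exp (-(I.card * t ^ 2 / 16)) := by
    intro X Y E a b hE h1 h2
    refine (measureReal_mono hE).trans ((measureReal_union_le _ _).trans ?_)
    linarith
  have hn : (0 : ℝ) ≤ I.card := Nat.cast_nonneg _
  have hsq : ∀ s : ℝ, |s| ≤ 1 / 4 → ∀ i, Integrable (fun ω => Real.exp (s * η i ω ^ 2)) P ∧
      ∫ ω, Real.exp (s * η i ω ^ 2) ∂P ≤ Real.exp (s + 4 * s ^ 2) := by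
    intro s hs i
    obtain ⟨h1, h2⟩ := exp_sq_gaussian (s := s) (by linarith [(abs_le.1 hs).2])
    rw [← hlaw i] at h1 h2
    have hmeas : AEStronglyMeasurable (fun x : ℝ => Real.exp (s * x ^ 2)) (P.map (η i)) := h1.1
    rw [integrable_map_measure hmeas (hm i).aemeasurable] at h1
    rw [integral_map (hm i).aemeasurable hmeas] at h2
    exact ⟨h1, h2.trans_le (inv_sqrt_le_exp hs)⟩
  constructor
  · refine split (fun i ω => η i ω ^ 2) (fun i ω => -(η i ω ^ 2)) _ (1 + t) (-(1 - t)) ?_ ?_ ?_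
    · intro ω hω
      simp only [Set.mem_union, Set.mem_ofPred_eq, Finset.sum_neg_distrib] at hω ⊢
      rcases lt_abs.1 hω with h | h
      · left; linarith
      · right; linarith
    · refine (chernoff_sum (s := t / 8) (κ := t / 8 + 4 * (t / 8) ^ 2)
        (hind.comp (fun _ x => x ^ 2) fun _ => by fun_prop) (fun i => (hm i).pow_const 2) I
        (by linarith) (fun i => (hsq (t / 8) ?_ i).1) fun i => (hsq (t / 8) ?_ i).2).trans ?_
      · rw [abs_of_pos (by linarith)]; linarith
      · rw [abs_of_pos (by linarith)]; linarith
      · refine Real.exp_le_exp.2 ?_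
        nlinarith
    · have hs : |-(t / 8)| ≤ 1 / 4 := by rw [abs_neg, abs_of_pos (by linarith)]; linarith
      refine (chernoff_sum (s := t / 8) (κ := -(t / 8) + 4 * (t / 8) ^ 2)
        (hind.comp (fun _ x => -(x ^ 2)) fun _ => by fun_prop)
        (fun i => ((hm i).pow_const 2).neg) I (by linarith) (fun i => ?_) fun i => ?_).trans ?_
      · simpa using (hsq _ hs i).1
      · simpa [mgf] using (hsq _ hs i).2
      · refine Real.exp_le_exp.2 ?_
        nlinarith
  · have hlin : ∀ i, ∀ s : ℝ, Integrable (fun ω => Real.exp (s * η i ω)) P ∧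
        mgf (η i) P s = Real.exp (s ^ 2 / 2) := by
      intro i s
      have h := mgf_gaussianReal (hlaw i) s
      refine ⟨?_, by rw [h]; simp⟩
      rw [← mgf_pos_iff, h]; positivity
    refine split η (fun i ω => -(η i ω)) _ t t ?_ ?_ ?_
    · intro ω hω
      simp only [Set.mem_union, Set.mem_ofPred_eq, Finset.sum_neg_distrib] at hω ⊢
      rcases lt_abs.1 hω with h | h
      · left; linarith
      · right; linarith
    · refine (chernoff_sum (s := t) (κ := t ^ 2 / 2) hind hm I ht.le (fun i => (hlin i t).1)
        fun i => (hlin i t).2.le).trans (Real.exp_le_exp.2 ?_)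
      nlinarith [mul_nonneg hn (sq_nonneg t)]
    · refine (chernoff_sum (s := t) (κ := t ^ 2 / 2) (hind.comp (fun _ x => -x) fun _ => by fun_prop)
        (fun i => (hm i).neg) I ht.le (fun i => ?_) fun i => ?_).trans (Real.exp_le_exp.2 ?_)
      · simpa using (hlin i (-t)).1
      · have := (hlin i (-t)).2.le
        simpa [mgf] using this
      · nlinarith [mul_nonneg hn (sq_nonneg t)]

end Concentration

/-! ### Sample moments of Gaussian vectors and their whitened deviation -/

section SampleMoments

variable {d : Type*} [Fintype d]

theorem map_dotProduct_stdNormal (u : d → ℝ) (hu : u ⬝ᵥ u = 1) :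
    (stdNormal d).map (fun y => u ⬝ᵥ y) = gaussianReal 0 1 := by
  have hG : HasGaussianLaw (fun y : d → ℝ => fun i => y i) (stdNormal d) := by
    refine iIndepFun.hasGaussianLaw (X := fun i (y : d → ℝ) => y i) (fun i => ⟨?_⟩)
      (iIndepFun_pi (μ := fun _ : d => gaussianReal 0 1) (X := fun _ x => x)
        fun _ => aemeasurable_id)
    rw [(measurePreserving_eval (fun _ : d => gaussianReal 0 1) i).map_eq]
    infer_instance
  have hL : HasGaussianLaw (fun y : d → ℝ => u ⬝ᵥ y) (stdNormal d) :=
    hG.map_fun (∑ i, u i • ContinuousLinearMap.proj (R := ℝ) (φ := fun _ : d => ℝ) i) |>.congr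
      (ae_of_all _ fun y => by simp [dotProduct])
  have hmean : ∫ y, u ⬝ᵥ y ∂stdNormal d = 0 := by
    simp only [dotProduct]
    rw [integral_finsetSum _ fun i _ => (integrable_eval_stdNormal i).const_mul (u i)]
    refine Finset.sum_eq_zero fun i _ => ?_
    rw [integral_const_mul, integral_eval]
    simp
  have hsq : ∫ y, (u ⬝ᵥ y) ^ 2 ∂stdNormal d = 1 := by
    have := integral_sq_affine_stdNormal 0 u
    simpa [hu] using this
  rw [hL.map_eq_gaussianReal, variance_eq_sub hL.memLp_two, hmean]
  simp only [Pi.pow_apply, hsq]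
  simp

variable {Ω : Type*} [MeasurableSpace Ω] {P : Measure Ω} [IsProbabilityMeasure P]

/-- The first two sample moments of standard normal vectors are close to their expectations. -/
theorem stdNormal_sample_moments [DecidableEq d] {ξ : ℕ → Ω → d → ℝ} (hind : iIndepFun ξ P)
    (hm : ∀ i, Measurable (ξ i)) (hlaw : ∀ i, P.map (ξ i) = stdNormal d) {I : Finset ℕ}
    (hI : I.Nonempty) {t : ℝ} (ht : 0 < t) (ht1 : t ≤ 1) :
    P.real {ω | ¬ ∀ a b, |(I.card : ℝ)⁻¹ * ∑ i ∈ I, ξ i ω a| ≤ t ∧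
        |(I.card : ℝ)⁻¹ * ∑ i ∈ I, ξ i ω a * ξ i ω b - (1 : Matrix d d ℝ) a b| ≤ t} ≤
      6 * (Fintype.card d) ^ 2 * Real.exp (-(I.card * t ^ 2 / 16)) := by
  have hn : (0 : ℝ) < I.card := by exact_mod_cast hI.card_pos
  set E := Real.exp (-(I.card * t ^ 2 / 16))
  set B1 : (d → ℝ) → Set Ω := fun u => {ω | I.card * t < |∑ i ∈ I, (u ⬝ᵥ ξ i ω) ^ 2 - I.card|}
  set B2 : (d → ℝ) → Set Ω := fun u => {ω | I.card * t < |∑ i ∈ I, u ⬝ᵥ ξ i ω|}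
  have hB : ∀ u : d → ℝ, u ⬝ᵥ u = 1 → P.real (B1 u) ≤ 2 * E ∧ P.real (B2 u) ≤ 2 * E := by
    intro u hu
    have hum : Measurable fun y : d → ℝ => u ⬝ᵥ y := by
      have : Continuous fun y : d → ℝ => u ⬝ᵥ y := by fun_prop
      exact this.measurable
    refine gaussian_sample_moments (η := fun i ω => u ⬝ᵥ ξ i ω)
      (hind.comp (fun _ y => u ⬝ᵥ y) fun _ => hum) (fun i => hum.comp (hm i)) (fun i => ?_) I ht ht1
    have := Measure.map_map (μ := P) hum (hm i)
    rw [hlaw, map_dotProduct_stdNormal u hu] at this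
    exact this.symm
  set e : d → d → ℝ := fun a => Pi.single a 1
  -- Polarization: for `a ≠ b` the product of two coordinates is half the difference of the squares
  -- of the projections on the unit vectors `up a b` and `um a b`. So only squares of
  -- one-dimensional standard normal variables have to concentrate. Setting both to `e a` on the
  -- diagonal keeps them unit vectors.
  set up : d → d → d → ℝ := fun a b => if a = b then e a else (√2)⁻¹ • (e a + e b)
  set um : d → d → d → ℝ := fun a b => if a = b then e a else (√2)⁻¹ • (e a - e b)
  have h2 : (√2)⁻¹ * (√2)⁻¹ = (1 / 2 : ℝ) := by
    rw [← mul_inv, Real.mul_self_sqrt (by norm_num)]; norm_num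
  have he : ∀ a, e a ⬝ᵥ e a = 1 := fun a => by simp [e]
  have hup : ∀ a b, up a b ⬝ᵥ up a b = 1 := by
    intro a b
    by_cases hab : a = b
    · simp only [up, if_pos hab, he]
    · simp only [up, if_neg hab, smul_dotProduct, dotProduct_smul, smul_eq_mul]
      rw [← mul_assoc, h2]
      simp [e, hab, Ne.symm hab]
      norm_num
  have hum : ∀ a b, um a b ⬝ᵥ um a b = 1 := by
    intro a b
    by_cases hab : a = b
    · simp only [um, if_pos hab, he]
    · simp only [um, if_neg hab, smul_dotProduct, dotProduct_smul, smul_eq_mul]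
      rw [← mul_assoc, h2]
      simp [e, hab, Ne.symm hab]
      norm_num
  have hsub : {ω | ¬ ∀ a b, |(I.card : ℝ)⁻¹ * ∑ i ∈ I, ξ i ω a| ≤ t ∧
        |(I.card : ℝ)⁻¹ * ∑ i ∈ I, ξ i ω a * ξ i ω b - (1 : Matrix d d ℝ) a b| ≤ t} ⊆
      ⋃ q : d × d, (B1 (up q.1 q.2) ∪ B1 (um q.1 q.2)) ∪ B2 (e q.1) := by
    intro ω hω
    by_contra hcon
    refine hω fun a b => ?_
    simp only [Set.mem_iUnion, Set.mem_union, not_exists, not_or, Prod.forall] at hcon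
    obtain ⟨⟨h1, h2'⟩, h3⟩ := hcon a b
    simp only [B1, B2, Set.mem_ofPred_eq, not_lt] at h1 h2' h3
    constructor
    · rw [abs_mul, abs_of_pos (inv_pos.2 hn), inv_mul_le_iff₀ hn]
      simpa [e] using h3
    · by_cases hab : a = b
      · subst hab
        simp only [up, if_true, e, single_dotProduct, one_mul] at h1
        rw [Matrix.one_apply_eq]
        have : (I.card : ℝ)⁻¹ * ∑ i ∈ I, ξ i ω a * ξ i ω a - 1 =
            (I.card : ℝ)⁻¹ * (∑ i ∈ I, ξ i ω a ^ 2 - I.card) := by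
          rw [mul_sub, inv_mul_cancel₀ hn.ne']; simp only [sq]
        rw [this, abs_mul, abs_of_pos (inv_pos.2 hn), inv_mul_le_iff₀ hn]
        exact h1
      · rw [Matrix.one_apply_ne hab, sub_zero, abs_mul, abs_of_pos (inv_pos.2 hn),
          inv_mul_le_iff₀ hn]
        simp only [up, um, if_neg hab, smul_dotProduct, add_dotProduct, sub_dotProduct, e,
          single_dotProduct, one_mul, smul_eq_mul, mul_pow, inv_pow,
          Real.sq_sqrt (show (0 : ℝ) ≤ 2 by norm_num)] at h1 h2'
        have : ∑ i ∈ I, ξ i ω a * ξ i ω b =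
            ((∑ i ∈ I, 2⁻¹ * (ξ i ω a + ξ i ω b) ^ 2 - I.card) -
              (∑ i ∈ I, 2⁻¹ * (ξ i ω a - ξ i ω b) ^ 2 - I.card)) / 2 := by
          rw [sub_sub_sub_cancel_right, ← Finset.sum_sub_distrib, Finset.sum_div]
          exact Finset.sum_congr rfl fun i _ => by ring
        rw [this]
        rw [abs_le] at h1 h2' ⊢
        constructor <;> linarith [h1.1, h1.2, h2'.1, h2'.2]
  refine (measureReal_mono hsub).trans ((measureReal_iUnion_fintype_le _).trans ?_)
  -- Three events of probability at most `2 * E` for each pair of coordinates.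
  have : ∀ q : d × d, P.real ((B1 (up q.1 q.2) ∪ B1 (um q.1 q.2)) ∪ B2 (e q.1)) ≤ 6 * E := by
    intro q
    refine (measureReal_union_le _ _).trans ?_
    have := measureReal_union_le (μ := P) (B1 (up q.1 q.2)) (B1 (um q.1 q.2))
    linarith [(hB _ (hup q.1 q.2)).1, (hB _ (hum q.1 q.2)).1, (hB _ (he q.1)).2]
  refine (Finset.sum_le_sum fun q _ => this q).trans_eq ?_
  simp [Fintype.card_prod]
  ring

omit [Fintype d] in
theorem sampleMean_apply (I : Finset ℕ) (y : ℕ → d → ℝ) (a : d) :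
    sampleMean I y a = (I.card : ℝ)⁻¹ * ∑ i ∈ I, y i a := by
  simp [sampleMean]

omit [Fintype d] in
theorem sampleCov_apply {I : Finset ℕ} (hI : I.Nonempty) (y : ℕ → d → ℝ) (a b : d) :
    sampleCov I y a b = (I.card : ℝ)⁻¹ * ∑ i ∈ I, y i a * y i b -
      sampleMean I y a * sampleMean I y b := by
  have hn : (I.card : ℝ) ≠ 0 := by exact_mod_cast hI.card_pos.ne'
  have h1 : sampleCov I y a b = (I.card : ℝ)⁻¹ *
      ∑ i ∈ I, (y i a - sampleMean I y a) * (y i b - sampleMean I y b) := by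
    simp [sampleCov, Matrix.sum_apply, Matrix.vecMulVec_apply]
  have h2 : ∀ a, ∑ i ∈ I, y i a = I.card * sampleMean I y a := fun a => by
    rw [sampleMean_apply, ← mul_assoc, mul_inv_cancel₀ hn, one_mul]
  have h3 : ∑ i ∈ I, (y i a - sampleMean I y a) * (y i b - sampleMean I y b) =
      ∑ i ∈ I, y i a * y i b - I.card * (sampleMean I y a * sampleMean I y b) := by
    have : ∀ i, (y i a - sampleMean I y a) * (y i b - sampleMean I y b) =
        y i a * y i b - y i a * sampleMean I y b - sampleMean I y a * y i b +
          sampleMean I y a * sampleMean I y b := fun i => by ring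
    simp only [this, Finset.sum_add_distrib, Finset.sum_sub_distrib, ← Finset.sum_mul,
      ← Finset.mul_sum, h2]
    simp
    ring
  rw [h1, h3, mul_sub, ← mul_assoc _ (I.card : ℝ), inv_mul_cancel₀ hn, one_mul]

omit [Fintype d] in
theorem sampleCov_isSymm (I : Finset ℕ) (y : ℕ → d → ℝ) : (sampleCov I y).IsSymm := by
  ext a b
  simp [sampleCov, Matrix.sum_apply, Matrix.vecMulVec_apply, mul_comm]

theorem sampleMean_affine {I : Finset ℕ} (hI : I.Nonempty) (B : Matrix d d ℝ) (m : d → ℝ)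
    (z : ℕ → d → ℝ) :
    sampleMean I (fun i => B.mulVec (z i - m)) = B.mulVec (sampleMean I z - m) := by
  have hn : (I.card : ℝ) ≠ 0 := by exact_mod_cast hI.card_pos.ne'
  unfold sampleMean
  have : (I.card : ℝ)⁻¹ • ∑ i ∈ I, z i - m = (I.card : ℝ)⁻¹ • ∑ i ∈ I, (z i - m) := by
    rw [Finset.sum_sub_distrib, smul_sub, Finset.sum_const, ← Nat.cast_smul_eq_nsmul ℝ, smul_smul,
      inv_mul_cancel₀ hn, one_smul]
  rw [this, Matrix.mulVec_smul, Matrix.mulVec_sum]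

theorem sampleCov_affine {I : Finset ℕ} (hI : I.Nonempty) (B : Matrix d d ℝ) (m : d → ℝ)
    (z : ℕ → d → ℝ) :
    sampleCov I (fun i => B.mulVec (z i - m)) = B * sampleCov I z * B.transpose := by
  unfold sampleCov
  rw [sampleMean_affine hI, Matrix.mul_smul, Matrix.smul_mul, Matrix.mul_sum, Matrix.sum_mul]
  congr 1
  refine Finset.sum_congr rfl fun i _ => ?_
  rw [← Matrix.mulVec_sub, sub_sub_sub_cancel_right, Matrix.mul_vecMulVec, Matrix.vecMulVec_mul,
    Matrix.vecMul_transpose]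

variable [DecidableEq d]

/-- Empirical moments transform like the data under affine maps, so the whitened estimates are the
estimates from whitened data. Centring at the sample mean changes second moments by a product of two
means, which is at most `t ^ 2 ≤ t`. -/
theorem whitened_moments_le {I : Finset ℕ} (hI : I.Nonempty) (m : d → ℝ) (A : Matrix d d ℝ)
    (z : ℕ → d → ℝ) {t : ℝ} (ht1 : t ≤ 1)
    (h : ∀ a b, |(I.card : ℝ)⁻¹ * ∑ i ∈ I, A⁻¹.mulVec (z i - m) a| ≤ t ∧
        |(I.card : ℝ)⁻¹ * ∑ i ∈ I, A⁻¹.mulVec (z i - m) a * A⁻¹.mulVec (z i - m) b -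
          (1 : Matrix d d ℝ) a b| ≤ t) (a b : d) :
    |A⁻¹.mulVec (sampleMean I z - m) a| ≤ t ∧
      |(A⁻¹ * sampleCov I z * A⁻¹.transpose - 1) a b| ≤ 2 * t := by
  have hmean : ∀ a, |A⁻¹.mulVec (sampleMean I z - m) a| ≤ t := fun a => by
    rw [← sampleMean_affine hI, sampleMean_apply]
    exact (h a a).1
  refine ⟨hmean a, ?_⟩
  rw [← sampleCov_affine hI A⁻¹ m, Matrix.sub_apply, sampleCov_apply hI, sampleMean_affine hI]
  have h1 := (h a b).2
  have h2 : |A⁻¹.mulVec (sampleMean I z - m) a * A⁻¹.mulVec (sampleMean I z - m) b| ≤ t := by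
    rw [abs_mul]
    have := mul_le_mul (hmean a) (hmean b) (abs_nonneg _) ((abs_nonneg _).trans (hmean a))
    have := abs_nonneg (A⁻¹.mulVec (sampleMean I z - m) a)
    nlinarith [hmean a]
  rw [abs_le] at h1 h2 ⊢
  constructor <;> linarith [h1.1, h1.2, h2.1, h2.2]

/-- In dimension `n`, the `n ^ 2` matrix entries of size `2 * t` and the `n` mean entries of size
`t` contribute at most `5 * n ^ 2 * t ^ 2`, which is below `(3 * n * t) ^ 2`. An entrywise accuracy
of order `ε / n` is therefore enough. -/
theorem whitenedDeviation_le (m m' : d → ℝ) (A C : Matrix d d ℝ) {t ε : ℝ}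
    (htε : 3 * (Fintype.card d) * t ≤ ε) (ht : 0 ≤ t)
    (h : ∀ a b, |A⁻¹.mulVec (m' - m) a| ≤ t ∧ |(A⁻¹ * C * A⁻¹.transpose - 1) a b| ≤ 2 * t) :
    whitenedDeviation m A m' C ≤ ε ^ 2 := by
  unfold whitenedDeviation
  have h1 : ∑ i, ∑ j, ((A⁻¹ * C * A⁻¹.transpose - 1) i j) ^ 2 ≤ ∑ _i : d, ∑ _j : d, (2 * t) ^ 2 :=
    Finset.sum_le_sum fun i _ => Finset.sum_le_sum fun j _ => sq_le_sq' (abs_le.1 (h i j).2).1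
      (abs_le.1 (h i j).2).2
  have h2 : A⁻¹.mulVec (m' - m) ⬝ᵥ A⁻¹.mulVec (m' - m) ≤ ∑ _i : d, t ^ 2 := by
    refine Finset.sum_le_sum fun i _ => ?_
    rw [← sq]
    exact sq_le_sq' (abs_le.1 (h i i).1).1 (abs_le.1 (h i i).1).2
  simp only [Finset.sum_const, Finset.card_univ, nsmul_eq_mul] at h1 h2
  have h3 : (Fintype.card d : ℝ) ≤ (Fintype.card d : ℝ) ^ 2 := by
    exact_mod_cast Nat.le_self_pow two_ne_zero _
  have h4 : (3 * (Fintype.card d) * t) ^ 2 ≤ ε ^ 2 := by gcongr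
  nlinarith [mul_le_mul_of_nonneg_right h3 (sq_nonneg t), mul_nonneg (sq_nonneg (Fintype.card d : ℝ)) (sq_nonneg t)]

end SampleMoments

/-! ### The location-slope transform of sampled paths -/

section Sampled

variable {T : ℝ}

/-- The location-slope transform, `p = (L, S)`, of the interpolated stage-`k` observations. -/
noncomputable def lsPath (𝒯 : SamplingScheme T) (k : ℕ) (p : ℕ × ℕ) (x : SamplePath T) :
    Fin p.1 ⊕ Fin p.2 → ℝ :=
  lsTransform T p.1 p.2 (𝒯.interpolate k x)

namespace SamplingScheme

/-- The factor of the `j`-th increment in the linear interpolation. -/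
noncomputable def ramp (𝒯 : SamplingScheme T) (k j : ℕ) (s : ℝ) : ℝ :=
  max 0 (min 1 ((s - 𝒯.t k j) / (𝒯.t k (j + 1) - 𝒯.t k j)))

variable (𝒯 : SamplingScheme T) (k : ℕ)

theorem interpolate_eq_ramp (x : SamplePath T) (s : ℝ) : 𝒯.interpolate k x s =
    x (𝒯.t k 1) + ∑ j ∈ Finset.Ico 1 (𝒯.ℓ k), (x (𝒯.t k (j + 1)) - x (𝒯.t k j)) * 𝒯.ramp k j s :=
  rfl

theorem continuous_ramp (j : ℕ) : Continuous (𝒯.ramp k j) := by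
  unfold ramp; fun_prop

theorem gap_pos {j : ℕ} (hj : j < 𝒯.ℓ k) : 0 < (𝒯.t k (j + 1) : ℝ) - 𝒯.t k j :=
  sub_pos.2 (𝒯.increasing k j hj)

theorem monotone_ramp {j : ℕ} (hj : j < 𝒯.ℓ k) : Monotone (𝒯.ramp k j) := by
  intro s s' h
  unfold ramp
  have := 𝒯.gap_pos k hj
  gcongr

theorem ramp_of_le {j : ℕ} (hj : j < 𝒯.ℓ k) {s : ℝ} (hs : s ≤ 𝒯.t k j) : 𝒯.ramp k j s = 0 := by
  unfold ramp
  refine max_eq_left ((min_le_right _ _).trans ?_)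
  exact div_nonpos_of_nonpos_of_nonneg (by linarith) (𝒯.gap_pos k hj).le

theorem ramp_of_ge {j : ℕ} (hj : j < 𝒯.ℓ k) {s : ℝ} (hs : 𝒯.t k (j + 1) ≤ s) :
    𝒯.ramp k j s = 1 := by
  unfold ramp
  rw [min_eq_left, max_eq_right zero_le_one]
  rw [le_div_iff₀ (𝒯.gap_pos k hj)]
  linarith

theorem ramp_nonneg (j : ℕ) (s : ℝ) : 0 ≤ 𝒯.ramp k j s := le_max_left _ _

theorem ramp_le_one (j : ℕ) (s : ℝ) : 𝒯.ramp k j s ≤ 1 := max_le zero_le_one (min_le_left _ _)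

theorem continuous_interpolate (x : SamplePath T) : Continuous (𝒯.interpolate k x) := by
  have : 𝒯.interpolate k x = fun s => x (𝒯.t k 1) + ∑ j ∈ Finset.Ico 1 (𝒯.ℓ k),
      (x (𝒯.t k (j + 1)) - x (𝒯.t k j)) * 𝒯.ramp k j s := rfl
  rw [this]
  exact continuous_const.add (continuous_finsetSum _ fun j _ =>
    continuous_const.mul (𝒯.continuous_ramp k j))

/-- The exceptional null set is where one of the monotone ramps is not differentiable, and thus does
not depend on the path. -/
theorem deriv_interpolate_ae : ∀ᵐ s : ℝ, ∀ x : SamplePath T, deriv (𝒯.interpolate k x) s =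
    ∑ j ∈ Finset.Ico 1 (𝒯.ℓ k), (x (𝒯.t k (j + 1)) - x (𝒯.t k j)) * deriv (𝒯.ramp k j) s := by
  have h : ∀ j ∈ Finset.Ico 1 (𝒯.ℓ k), ∀ᵐ s : ℝ, DifferentiableAt ℝ (𝒯.ramp k j) s :=
    fun j hj => (𝒯.monotone_ramp k (Finset.mem_Ico.1 hj).2).ae_differentiableAt
  filter_upwards [(ae_ball_iff (Finset.Ico 1 (𝒯.ℓ k)).countable_toSet).2 h] with s hs x
  have hsum : HasDerivAt (𝒯.interpolate k x) (0 + ∑ j ∈ Finset.Ico 1 (𝒯.ℓ k),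
      (x (𝒯.t k (j + 1)) - x (𝒯.t k j)) * deriv (𝒯.ramp k j) s) s :=
    (hasDerivAt_const s (x (𝒯.t k 1))).add (HasDerivAt.fun_sum fun j hj =>
      (hs j hj).hasDerivAt.const_mul _)
  rw [hsum.deriv, zero_add]

end SamplingScheme

/-- The transform of the sampled path is a linear function of finitely many values of the path. -/
theorem exists_linearCombination_lsPath (𝒯 : SamplingScheme T) (k : ℕ) (p : ℕ × ℕ)
    (q : Fin p.1 ⊕ Fin p.2) :
    ∃ w : Set.Icc (0 : ℝ) T →₀ ℝ, ∀ x : SamplePath T,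
      lsPath 𝒯 k p x q = Finsupp.linearCombination ℝ x w := by
  suffices h : ∃ (a : ℝ) (b : ℕ → ℝ), ∀ x : SamplePath T, lsPath 𝒯 k p x q =
      a * x (𝒯.t k 1) + ∑ j ∈ Finset.Ico 1 (𝒯.ℓ k), b j * (x (𝒯.t k (j + 1)) - x (𝒯.t k j)) by
    obtain ⟨a, b, hab⟩ := h
    refine ⟨Finsupp.single (𝒯.t k 1) a + ∑ j ∈ Finset.Ico 1 (𝒯.ℓ k),
      (Finsupp.single (𝒯.t k (j + 1)) (b j) - Finsupp.single (𝒯.t k j) (b j)), fun x => ?_⟩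
    rw [hab]
    simp [map_sum, mul_sub]
  rcases q with i | i
  · refine ⟨∫ s in (T * i / p.1)..(T * (i + 1) / p.1), 1,
      fun j => ∫ s in (T * i / p.1)..(T * (i + 1) / p.1), 𝒯.ramp k j s, fun x => ?_⟩
    change ∫ s in (T * i / p.1)..(T * (i + 1) / p.1), 𝒯.interpolate k x s = _
    simp only [SamplingScheme.interpolate_eq_ramp]
    rw [intervalIntegral.integral_add, intervalIntegral.integral_finsetSum]
    · simp only [intervalIntegral.integral_const_mul, intervalIntegral.integral_const,
        smul_eq_mul, mul_one]
      congr 1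
      exact Finset.sum_congr rfl fun j _ => mul_comm _ _
    · exact fun j _ => ((𝒯.continuous_ramp k j).intervalIntegrable _ _).const_mul _
    · exact intervalIntegrable_const
    · exact (continuous_finsetSum _ fun j _ =>
        continuous_const.mul (𝒯.continuous_ramp k j)).intervalIntegrable _ _
  · refine ⟨0, fun j => ∫ s in (T * i / p.2)..(T * (i + 1) / p.2), deriv (𝒯.ramp k j) s,
      fun x => ?_⟩
    change ∫ s in (T * i / p.2)..(T * (i + 1) / p.2), deriv (𝒯.interpolate k x) s = _
    rw [intervalIntegral.integral_congr_ae (g := fun s => ∑ j ∈ Finset.Ico 1 (𝒯.ℓ k),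
      (x (𝒯.t k (j + 1)) - x (𝒯.t k j)) * deriv (𝒯.ramp k j) s)
      ((𝒯.deriv_interpolate_ae k).mono fun s hs _ => hs x), intervalIntegral.integral_finsetSum]
    · simp only [intervalIntegral.integral_const_mul, zero_mul, zero_add]
      exact Finset.sum_congr rfl fun j _ => mul_comm _ _
    · intro j hj
      exact ((𝒯.monotone_ramp k (Finset.mem_Ico.1 hj).2).monotoneOn _).intervalIntegrable_deriv
        |>.const_mul _

theorem measurable_linearCombination (w : Set.Icc (0 : ℝ) T →₀ ℝ) :
    Measurable fun x : SamplePath T => Finsupp.linearCombination ℝ x w := by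
  simp only [Finsupp.linearCombination_apply, Finsupp.sum, smul_eq_mul]
  exact Finset.measurable_sum _ fun s _ => (measurable_pi_apply s).const_mul _

theorem measurable_lsPath (𝒯 : SamplingScheme T) (k : ℕ) (p : ℕ × ℕ) :
    Measurable (lsPath 𝒯 k p) := by
  refine measurable_pi_iff.2 fun q => ?_
  obtain ⟨w, hw⟩ := exists_linearCombination_lsPath 𝒯 k p q
  simp only [hw]
  exact measurable_linearCombination w

theorem hasGaussianLaw_lsPath {Ω : Type*} [MeasurableSpace Ω] {P : Measure Ω}
    {X : Ω → SamplePath T} (hX : IsGaussianProcess (fun t ω => X ω t) P) (𝒯 : SamplingScheme T)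
    (k : ℕ) (p : ℕ × ℕ) : HasGaussianLaw (fun ω => lsPath 𝒯 k p (X ω)) P := by
  have h : IsGaussianProcess (fun q ω => lsPath 𝒯 k p (X ω) q) P := by
    refine hX.of_isGaussianProcess fun q => ?_
    obtain ⟨w, hw⟩ := exists_linearCombination_lsPath 𝒯 k p q
    refine ⟨w.support, ∑ s : w.support,
      w s • ContinuousLinearMap.proj (R := ℝ) (φ := fun _ : w.support => ℝ) s, fun ω => ?_⟩
    rw [hw, Finsupp.linearCombination_apply, Finsupp.sum, ← Finset.sum_coe_sort]
    simp
  have h2 := h.hasGaussianLaw Finset.univ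
  exact h2.map_fun (ContinuousLinearMap.pi fun q =>
    ContinuousLinearMap.proj (R := ℝ)
      (φ := fun _ : {q : Fin p.1 ⊕ Fin p.2 // q ∈ Finset.univ} => ℝ) ⟨q, Finset.mem_univ q⟩)

/-! ### Convergence of the sampled paths -/

namespace SamplingScheme

variable (𝒯 : SamplingScheme T)

theorem ell_pos (hT : 0 < T) (k : ℕ) : 0 < 𝒯.ℓ k := by
  rcases Nat.eq_zero_or_pos (𝒯.ℓ k) with h | h
  · have h1 := 𝒯.first k
    have h2 := 𝒯.last k
    rw [h] at h2
    linarith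
  · exact h

/-- The mesh of the stage-`k` grid. -/
noncomputable def meshSize (k : ℕ) : ℝ := ⨆ j : Fin (𝒯.ℓ k), ((𝒯.t k (j + 1) : ℝ) - 𝒯.t k j)

theorem gap_le_meshSize {k j : ℕ} (hj : j < 𝒯.ℓ k) :
    (𝒯.t k (j + 1) : ℝ) - 𝒯.t k j ≤ 𝒯.meshSize k :=
  le_ciSup (f := fun j : Fin (𝒯.ℓ k) => ((𝒯.t k (j + 1) : ℝ) - 𝒯.t k j))
    (Set.finite_range _).bddAbove ⟨j, hj⟩

theorem t_mono (k : ℕ) {i j : ℕ} (hij : i ≤ j) (hj : j ≤ 𝒯.ℓ k) : 𝒯.t k i ≤ 𝒯.t k j := by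
  induction j, hij using Nat.le_induction with
  | base => exact le_rfl
  | succ n hn ih => exact (ih (by omega)).trans (𝒯.increasing k n (by omega)).le

/-- To the right of `t k n` all earlier ramps have reached one, and the increments telescope. -/
theorem partial_interpolate_of_ge {k n : ℕ} (hn1 : 1 ≤ n) (hn : n ≤ 𝒯.ℓ k) (x : SamplePath T)
    {s : ℝ} (hs : 𝒯.t k n ≤ s) :
    x (𝒯.t k 1) + ∑ j ∈ Finset.Ico 1 n, (x (𝒯.t k (j + 1)) - x (𝒯.t k j)) * 𝒯.ramp k j s =
      x (𝒯.t k n) := by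
  have : ∀ j ∈ Finset.Ico 1 n, (x (𝒯.t k (j + 1)) - x (𝒯.t k j)) * 𝒯.ramp k j s =
      x (𝒯.t k (j + 1)) - x (𝒯.t k j) := by
    intro j hj
    have hj' := Finset.mem_Ico.1 hj
    rw [𝒯.ramp_of_ge k (by omega), mul_one]
    exact (Subtype.coe_le_coe.2 (𝒯.t_mono k (by omega : j + 1 ≤ n) hn)).trans hs
  rw [Finset.sum_congr rfl this, Finset.sum_Ico_sub (fun j => x (𝒯.t k j)) hn1]
  ring

theorem interpolate_eq_partial {k n : ℕ} (hn1 : 1 ≤ n) (hn : n ≤ 𝒯.ℓ k) (x : SamplePath T)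
    {s : ℝ} (hs : s ≤ 𝒯.t k n) : 𝒯.interpolate k x s =
    x (𝒯.t k 1) + ∑ j ∈ Finset.Ico 1 n, (x (𝒯.t k (j + 1)) - x (𝒯.t k j)) * 𝒯.ramp k j s := by
  rw [interpolate_eq_ramp, ← Finset.sum_Ico_consecutive _ hn1 hn]
  congr 1
  rw [add_eq_left]
  refine Finset.sum_eq_zero fun j hj => ?_
  have hj' := Finset.mem_Ico.1 hj
  rw [𝒯.ramp_of_le k hj'.2, mul_zero]
  exact hs.trans (𝒯.t_mono k hj'.1 hj'.2.le)

/-- The interpolated value at `s` lies between two values of `x` at a distance of at most the mesh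
from `s`. -/
theorem interpolate_between (hT : 0 < T) (k : ℕ) (x : SamplePath T) {s : ℝ}
    (hs : s ∈ Set.Icc 0 T) : ∃ (u v : Set.Icc (0 : ℝ) T) (r : ℝ), 0 ≤ r ∧ r ≤ 1 ∧
      |(u : ℝ) - s| ≤ 𝒯.meshSize k ∧ |(v : ℝ) - s| ≤ 𝒯.meshSize k ∧
      𝒯.interpolate k x s = x u + (x v - x u) * r := by
  -- The least such index is written as `n + 1`. Then `s` lies between the grid points `n` and `n +
  -- 1`; for `n = 0` this is the piece on which the interpolation is constant.
  have hex : ∃ n, 1 ≤ n ∧ s ≤ 𝒯.t k n := ⟨𝒯.ℓ k, 𝒯.ell_pos hT k, by rw [𝒯.last]; exact hs.2⟩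
  classical
  obtain ⟨hn1, hsn⟩ := Nat.find_spec hex
  have hnl : Nat.find hex ≤ 𝒯.ℓ k :=
    Nat.find_min' hex ⟨𝒯.ell_pos hT k, by rw [𝒯.last]; exact hs.2⟩
  have hmin : ∀ m, m < Nat.find hex → ¬ (1 ≤ m ∧ s ≤ 𝒯.t k m) := fun m hm => Nat.find_min hex hm
  obtain ⟨n, hn⟩ : ∃ n, Nat.find hex = n + 1 := ⟨Nat.find hex - 1, by omega⟩
  rw [hn] at hn1 hsn hnl hmin
  have hgap := 𝒯.gap_le_meshSize (k := k) (j := n) (by omega)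
  have hlow : (𝒯.t k n : ℝ) ≤ s := by
    rcases Nat.eq_zero_or_pos n with h0 | hpos
    · rw [h0, 𝒯.first]; exact hs.1
    · by_contra! hcon
      exact hmin n (by omega) ⟨hpos, hcon.le⟩
  have hb1 : |(𝒯.t k n : ℝ) - s| ≤ 𝒯.meshSize k := by rw [abs_le]; constructor <;> linarith
  have hb2 : |(𝒯.t k (n + 1) : ℝ) - s| ≤ 𝒯.meshSize k := by rw [abs_le]; constructor <;> linarith
  rcases Nat.eq_zero_or_pos n with h0 | hpos
  · subst h0
    refine ⟨𝒯.t k 1, 𝒯.t k 1, 0, le_rfl, zero_le_one, hb2, hb2, ?_⟩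
    rw [𝒯.interpolate_eq_partial le_rfl hnl x hsn]
    simp
  · refine ⟨𝒯.t k n, 𝒯.t k (n + 1), 𝒯.ramp k n s, 𝒯.ramp_nonneg k n s, 𝒯.ramp_le_one k n s,
      hb1, hb2, ?_⟩
    rw [𝒯.interpolate_eq_partial hn1 hnl x hsn, Finset.sum_Ico_succ_top hpos, ← add_assoc,
      𝒯.partial_interpolate_of_ge hpos (by omega) x hlow]

theorem interpolate_tendstoUniformlyOn (hT : 0 < T) {x : SamplePath T} (hx : Continuous x) {η : ℝ}
    (hη : 0 < η) : ∀ᶠ k in atTop, ∀ s ∈ Set.Icc 0 T,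
      |𝒯.interpolate k x s - Set.IccExtend hT.le x s| ≤ η := by
  have huc : UniformContinuous x := CompactSpace.uniformContinuous_of_continuous hx
  obtain ⟨δ, hδ, hxδ⟩ := Metric.uniformContinuous_iff.1 huc η hη
  have hm : ∀ᶠ k in atTop, 𝒯.meshSize k < δ := 𝒯.mesh.eventually (gt_mem_nhds hδ)
  filter_upwards [hm] with k hk s hs
  obtain ⟨u, v, r, hr0, hr1, hu, hv, h⟩ := 𝒯.interpolate_between hT k x hs
  rw [h, Set.IccExtend_of_mem hT.le x hs]
  have h1 : |x u - x ⟨s, hs⟩| ≤ η := (hxδ (lt_of_le_of_lt hu hk)).le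
  have h2 : |x v - x ⟨s, hs⟩| ≤ η := (hxδ (lt_of_le_of_lt hv hk)).le
  rw [abs_le] at h1 h2 ⊢
  constructor <;> nlinarith [h1.1, h1.2, h2.1, h2.2]

/-- The smallest gap is at most the mesh, which eventually falls below `T / L`. So each fixed number
of intervals becomes admissible. -/
theorem mem_locationNumbers_eventually (hT : 0 < T) {L : ℕ} (hL : 1 ≤ L) :
    ∀ᶠ k in atTop, L ∈ 𝒯.locationNumbers k := by
  have hm : ∀ᶠ k in atTop, 𝒯.meshSize k < T / L :=
    𝒯.mesh.eventually (gt_mem_nhds (div_pos hT (by exact_mod_cast hL)))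
  filter_upwards [hm] with k hk
  refine ⟨hL, ?_⟩
  have : Nonempty (Fin (𝒯.ℓ k)) := ⟨⟨0, 𝒯.ell_pos hT k⟩⟩
  obtain ⟨j, hj⟩ := exists_eq_ciInf_of_finite
    (f := fun j : Fin (𝒯.ℓ k) => ((𝒯.t k (j + 1) : ℝ) - 𝒯.t k j))
  rw [← hj]
  have h1 := 𝒯.gap_pos k j.2
  have h2 := 𝒯.gap_le_meshSize j.2
  have hL' : (0 : ℝ) < L := by exact_mod_cast hL
  have : (L : ℝ) ≤ T / ((𝒯.t k (j + 1) : ℝ) - 𝒯.t k j) := by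
    rw [le_div_iff₀ h1]
    have := (h2.trans_lt hk).le
    rw [le_div_iff₀ hL'] at this
    linarith
  linarith

end SamplingScheme

theorem grid_mem_Icc (hT : 0 ≤ T) {L i : ℕ} (hi : i ≤ L) (hL : 0 < L) :
    T * i / L ∈ Set.Icc 0 T := by
  have hL' : (0 : ℝ) < L := by exact_mod_cast hL
  constructor
  · positivity
  · rw [div_le_iff₀ hL']
    exact mul_le_mul_of_nonneg_left (by exact_mod_cast hi) hT

theorem lsPath_tendsto_pathLocation (hT : 0 < T) (𝒯 : SamplingScheme T) {x : SamplePath T}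
    (hx : Continuous x) (L : ℕ) (i : Fin L) :
    Tendsto (fun k => lsPath 𝒯 k (L, 0) x (Sum.inl i)) atTop
      (𝓝 (pathLocation hT.le L x i)) := by
  rw [Metric.tendsto_nhds]
  intro ε hε
  have h1 : 0 < T + 1 := by linarith
  filter_upwards [𝒯.interpolate_tendstoUniformlyOn hT hx (div_pos hε h1)] with k hk
  change dist (∫ s in (T * i / L)..(T * (i + 1) / L), 𝒯.interpolate k x s)
    (∫ s in (T * i / L)..(T * (i + 1) / L), Set.IccExtend hT.le x s) < ε
  have hL : 0 < L := i.pos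
  have ha := grid_mem_Icc hT.le (T := T) i.2.le hL
  have hb := grid_mem_Icc hT.le (T := T) (i.2 : (i : ℕ) + 1 ≤ L) hL
  push_cast at hb
  rw [dist_eq_norm, ← intervalIntegral.integral_sub
    ((𝒯.continuous_interpolate k x).intervalIntegrable _ _)
    ((hx.Icc_extend' (h := hT.le)).intervalIntegrable _ _)]
  have hsub : Set.uIoc (T * (i : ℝ) / L) (T * ((i : ℝ) + 1) / L) ⊆ Set.Icc 0 T :=
    Set.uIoc_subset_uIcc.trans (Set.OrdConnected.uIcc_subset inferInstance ha hb)
  have := intervalIntegral.norm_integral_le_of_norm_le_const (C := ε / (T + 1))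
    (f := fun s => 𝒯.interpolate k x s - Set.IccExtend hT.le x s)
    fun s hs => hk s (hsub hs)
  refine this.trans_lt ?_
  have hlen : |T * ((i : ℝ) + 1) / L - T * (i : ℝ) / L| ≤ T := by
    rw [abs_le]; constructor <;> linarith [ha.1, ha.2, hb.1, hb.2]
  calc ε / (T + 1) * |T * ((i : ℝ) + 1) / L - T * (i : ℝ) / L| ≤ ε / (T + 1) * T := by gcongr
    _ < ε := by rw [div_mul_eq_mul_div, div_lt_iff₀ h1]; nlinarith

end Sampled

/-! ### Gaussian vectors -/

section GaussianVector

variable {d : Type*} [Fintype d] {Ω : Type*} [MeasurableSpace Ω] {P : Measure Ω}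
  [IsProbabilityMeasure P]

/-- The covariance matrix of a random vector. -/
noncomputable def covMatrix (P : Measure Ω) (Z : Ω → d → ℝ) : Matrix d d ℝ :=
  Matrix.of fun i j => cov[fun ω => Z ω i, fun ω => Z ω j; P]

/-- The mean of a random vector. -/
noncomputable def meanVector (P : Measure Ω) (Z : Ω → d → ℝ) : d → ℝ := fun i => ∫ ω, Z ω i ∂P

theorem covariance_dotProduct {Z : Ω → d → ℝ} (hZ : ∀ i, MemLp (fun ω => Z ω i) 2 P)
    (u w : d → ℝ) :
    cov[fun ω => u ⬝ᵥ Z ω, fun ω => w ⬝ᵥ Z ω; P] = u ⬝ᵥ (covMatrix P Z).mulVec w := by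
  simp only [dotProduct, Matrix.mulVec, covMatrix, Matrix.of_apply]
  rw [covariance_fun_sum_fun_sum (fun i => (hZ i).const_mul (u i))
    (fun j => (hZ j).const_mul (w j))]
  simp only [covariance_const_mul_left, covariance_const_mul_right, Finset.mul_sum]
  refine Finset.sum_congr rfl fun i _ => Finset.sum_congr rfl fun j _ => ?_
  ring

omit [Fintype d] [IsProbabilityMeasure P] in
theorem covMatrix_isSymm (Z : Ω → d → ℝ) : (covMatrix P Z).IsSymm := by
  ext i j
  exact covariance_comm _ _

theorem covMatrix_posSemidef {Z : Ω → d → ℝ} (hZ : ∀ i, MemLp (fun ω => Z ω i) 2 P) :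
    (covMatrix P Z).PosSemidef := by
  refine Matrix.PosSemidef.of_dotProduct_mulVec_nonneg ?_ fun u => ?_
  · rw [Matrix.IsHermitian, Matrix.conjTranspose_eq_transpose_of_trivial]
    exact covMatrix_isSymm Z
  · rw [star_trivial, ← covariance_dotProduct hZ, covariance_self]
    · exact variance_nonneg _ _
    · exact (memLp_finsetSum _ fun i _ => (hZ i).const_mul (u i)).1.aemeasurable

/-- A direction in the kernel of the covariance matrix is one in which the vector is constant. -/
theorem ae_eq_of_covMatrix_mulVec_eq_zero {Z : Ω → d → ℝ} (hZ : ∀ i, MemLp (fun ω => Z ω i) 2 P)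
    {u : d → ℝ} (hu : (covMatrix P Z).mulVec u = 0) :
    ∀ᵐ ω ∂P, u ⬝ᵥ Z ω = ∫ ω, u ⬝ᵥ Z ω ∂P := by
  have hL : MemLp (fun ω => u ⬝ᵥ Z ω) 2 P :=
    memLp_finsetSum _ fun i _ => (hZ i).const_mul (u i)
  have h0 : Var[fun ω => u ⬝ᵥ Z ω; P] = 0 := by
    rw [← covariance_self hL.1.aemeasurable, covariance_dotProduct hZ, hu, dotProduct_zero]
  have h1 : evariance (fun ω => u ⬝ᵥ Z ω) P = 0 := by
    rw [← hL.ofReal_variance_eq, h0, ENNReal.ofReal_zero]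
  exact (evariance_eq_zero_iff hL.1.aemeasurable).1 h1

omit [Fintype d] [IsProbabilityMeasure P] in
theorem memLp_coord {Z : Ω → d → ℝ} (hZ : HasGaussianLaw Z P) (i : d) :
    MemLp (fun ω => Z ω i) 2 P := (hZ.eval i).memLp_two

open scoped MatrixOrder in
theorem exists_mul_transpose_eq [DecidableEq d] {M : Matrix d d ℝ} (hM : M.PosSemidef) (hdet : M.det ≠ 0) :
    ∃ A : Matrix d d ℝ, A.det ≠ 0 ∧ A * A.transpose = M := by
  have h1 : CFC.sqrt M * CFC.sqrt M = M := CFC.sqrt_mul_sqrt_self M hM.nonneg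
  have h2 : (CFC.sqrt M).transpose = CFC.sqrt M := by
    have := (Matrix.nonneg_iff_posSemidef.1 (CFC.sqrt_nonneg M)).isHermitian
    rwa [Matrix.IsHermitian, Matrix.conjTranspose_eq_transpose_of_trivial] at this
  refine ⟨CFC.sqrt M, fun h => hdet ?_, by rw [h2, h1]⟩
  rw [← h1, Matrix.det_mul, h, mul_zero]

/-- A nonsingular Gaussian vector becomes standard normal in suitable coordinates. -/
theorem map_whiten_eq_stdNormal [DecidableEq d] {Z : Ω → d → ℝ} (hZ : HasGaussianLaw Z P)
    (A : Matrix d d ℝ) (hA : A.det ≠ 0) (hAZ : A * A.transpose = covMatrix P Z) :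
    P.map (fun ω => A⁻¹.mulVec (Z ω - meanVector P Z)) = stdNormal d := by
  set W : Ω → d → ℝ := fun ω => A⁻¹.mulVec (Z ω) with hW
  have hWG : HasGaussianLaw W P :=
    hZ.map_fun (LinearMap.toContinuousLinearMap (Matrix.mulVecLin A⁻¹))
  have hcov : ∀ a b, cov[fun ω => W ω a, fun ω => W ω b; P] = (1 : Matrix d d ℝ) a b := by
    intro a b
    have h := covariance_dotProduct (memLp_coord hZ) (A⁻¹ a) (A⁻¹ b)
    have e : A⁻¹ a ⬝ᵥ (covMatrix P Z).mulVec (A⁻¹ b) =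
        (A⁻¹ * covMatrix P Z * A⁻¹.transpose) a b := by
      rw [Matrix.mul_assoc, Matrix.mul_apply]
      rfl
    have e2 : A⁻¹ * covMatrix P Z * A⁻¹.transpose = 1 := by
      rw [← hAZ, ← Matrix.mul_assoc, Matrix.nonsing_inv_mul _ hA.isUnit, Matrix.one_mul,
        Matrix.transpose_nonsing_inv,
        Matrix.mul_nonsing_inv _ (by rw [Matrix.det_transpose]; exact hA.isUnit)]
    rw [e, e2] at h
    exact h
  -- Uncorrelated components of a jointly Gaussian vector are independent.
  have hind : iIndepFun (fun a ω => W ω a) P :=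
    HasGaussianLaw.iIndepFun_of_covariance_eq_zero (X := fun a ω => W ω a) hWG fun a b hab => by
      rw [hcov, Matrix.one_apply_ne hab]
  have hWm : ∀ a, ∫ ω, W ω a ∂P = A⁻¹.mulVec (meanVector P Z) a := by
    intro a
    simp only [hW, Matrix.mulVec, dotProduct, meanVector]
    rw [integral_finsetSum _ fun i _ => ((hZ.eval i).integrable).const_mul _]
    simp only [integral_const_mul]
  have hY : (fun ω => A⁻¹.mulVec (Z ω - meanVector P Z)) =
      fun ω a => W ω a - ∫ ω, W ω a ∂P := by
    ext ω a
    rw [hWm, Matrix.mulVec_sub, Pi.sub_apply]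
  have hmarg : ∀ a, P.map (fun ω => W ω a - ∫ ω, W ω a ∂P) = gaussianReal 0 1 := by
    intro a
    have h1 := (hWG.eval a).map_eq_gaussianReal
    have h2 : Var[fun ω => W ω a; P] = 1 := by
      rw [← covariance_self (hWG.eval a).aemeasurable, hcov, Matrix.one_apply_eq]
    have hm : Measurable fun x : ℝ => x - ∫ ω, W ω a ∂P := by fun_prop
    have h3 := AEMeasurable.map_map_of_aemeasurable (μ := P) hm.aemeasurable (hWG.eval a).aemeasurable
    rw [h1, gaussianReal_map_sub_const, h2] at h3
    rw [show (fun ω => W ω a - ∫ ω, W ω a ∂P) = (fun x : ℝ => x - ∫ ω, W ω a ∂P) ∘ fun ω => W ω a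
      from rfl, ← h3]
    simp [hW]
  have hind2 : iIndepFun (fun a ω => W ω a - ∫ ω, W ω a ∂P) P :=
    hind.comp (fun a x => x - ∫ ω, W ω a ∂P) fun _ => by fun_prop
  rw [hY, hind2.map_fun_eq_pi_map fun a => (hWG.eval a).aemeasurable.sub_const _]
  congr 1
  ext1 a
  exact hmarg a

theorem map_eq_gaussLaw [DecidableEq d] {Z : Ω → d → ℝ} (hZ : HasGaussianLaw Z P)
    (A : Matrix d d ℝ) (hA : A.det ≠ 0) (hAZ : A * A.transpose = covMatrix P Z) :
    P.map Z = gaussLaw (meanVector P Z) A := by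
  have h := map_whiten_eq_stdNormal hZ A hA hAZ
  have hm : Continuous fun z : d → ℝ => A⁻¹.mulVec (z - meanVector P Z) := by fun_prop
  rw [gaussLaw, ← h, AEMeasurable.map_map_of_aemeasurable
    (f := fun ω => A⁻¹.mulVec (Z ω - meanVector P Z)) (measurable_affine _ _).aemeasurable
    (hm.measurable.comp_aemeasurable hZ.aemeasurable)]
  congr 1
  ext1 ω
  simp only [Function.comp_apply]
  rw [Matrix.mulVec_mulVec, Matrix.mul_nonsing_inv _ hA.isUnit, Matrix.one_mulVec,
    add_sub_cancel]

end GaussianVector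

/-! ### Discriminant analysis with mixed empirical covariance matrices -/

section MixedCovariance

variable {d : Type*}

/-- Row `c` of `a` holds the weights of the two empirical covariance matrices in the estimate for
class `c`. -/
noncomputable def mixedCov (a : Fin 2 → Fin 2 → ℝ) (I : Finset ℕ) (y : Fin 2 → ℕ → d → ℝ)
    (c : Fin 2) : Matrix d d ℝ :=
  ∑ c', a c c' • sampleCov I (y c')

/-- The plug-in rule with mixed empirical covariance matrices. -/
noncomputable def plugInMethod (a : Fin 2 → Fin 2 → ℝ) : LearningMethod := fun _ _ I y z =>
  plugIn (fun c => sampleMean I (y c)) (mixedCov a I y) z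

theorem QDA_eq_plugInMethod : QDA = plugInMethod fun c c' => if c = c' then 1 else 0 := by
  ext L S I y z : 5
  unfold QDA plugInMethod
  rw [qda_eq_plugIn]
  congr 1
  ext1 c
  fin_cases c <;> simp [mixedCov]

theorem LDA_eq_plugInMethod : LDA = plugInMethod fun _ _ => 2⁻¹ := by
  ext L S I y z : 5
  unfold LDA plugInMethod
  rw [lda_eq_plugIn]
  congr 1
  ext1 c
  simp [mixedCov, pooledCov]

theorem mixedCov_isSymm (a : Fin 2 → Fin 2 → ℝ) (I : Finset ℕ) (y : Fin 2 → ℕ → d → ℝ)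
    (c : Fin 2) : (mixedCov a I y c).IsSymm := by
  simp only [mixedCov, Matrix.IsSymm, Matrix.transpose_sum, Matrix.transpose_smul,
    (sampleCov_isSymm I (y _)).eq]

variable [Fintype d] [DecidableEq d]

omit [DecidableEq d] in
theorem sampleCov_mulVec_eq_zero {I : Finset ℕ} {y : ℕ → d → ℝ} {u : d → ℝ}
    (h : ∀ i ∈ I, (y i - sampleMean I y) ⬝ᵥ u = 0) : (sampleCov I y).mulVec u = 0 := by
  rw [sampleCov, Matrix.smul_mulVec, Matrix.sum_mulVec, Finset.sum_eq_zero, smul_zero]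
  intro i hi
  rw [Matrix.vecMulVec_mulVec, h i hi]
  simp

/-- A direction orthogonal to the centred data of each class with nonzero weight lies in the kernel
of each contributing summand. -/
theorem mixedCov_det_eq_zero {a : Fin 2 → Fin 2 → ℝ} {I : Finset ℕ} {y : Fin 2 → ℕ → d → ℝ}
    {c : Fin 2} {u : d → ℝ} (hu : u ≠ 0)
    (h : ∀ c', a c c' ≠ 0 → ∀ i ∈ I, (y c' i - sampleMean I (y c')) ⬝ᵥ u = 0) :
    (mixedCov a I y c).det = 0 := by
  refine Matrix.exists_mulVec_eq_zero_iff.1 ⟨u, hu, ?_⟩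
  rw [mixedCov, Matrix.sum_mulVec]
  refine Finset.sum_eq_zero fun c' _ => ?_
  rw [Matrix.smul_mulVec]
  by_cases hc : a c c' = 0
  · rw [hc, zero_smul]
  · rw [sampleCov_mulVec_eq_zero (h c' hc), smul_zero]

omit [DecidableEq d] in
theorem sub_sampleMean_dotProduct {I : Finset ℕ} {y : ℕ → d → ℝ} {u : d → ℝ} {r : ℝ}
    (h : ∀ i ∈ I, u ⬝ᵥ y i = r) : ∀ i ∈ I, (y i - sampleMean I y) ⬝ᵥ u = 0 := by
  intro i hi
  have hn : (I.card : ℝ) ≠ 0 := by exact_mod_cast (Finset.card_pos.2 ⟨i, hi⟩).ne'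
  rw [dotProduct_comm, dotProduct_sub, sampleMean, dotProduct_smul, dotProduct_sum,
    Finset.sum_congr rfl h, h i hi, Finset.sum_const, nsmul_eq_mul, smul_eq_mul, ← mul_assoc,
    inv_mul_cancel₀ hn, one_mul, sub_self]

theorem plugIn_eq_zero_of_det {m : Fin 2 → d → ℝ} {C : Fin 2 → Matrix d d ℝ} {c : Fin 2}
    (h : (C c).det = 0) (z : d → ℝ) : plugIn m C z = 0 := by
  unfold plugIn
  rw [if_neg]
  rintro ⟨h0, h1, -⟩
  fin_cases c
  · exact h0 h
  · exact h1 h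

/-- With too few observations the estimated covariance matrices are singular. -/
theorem mixedCov_det_eq_zero_of_card (a : Fin 2 → Fin 2 → ℝ) {I : Finset ℕ}
    (y : Fin 2 → ℕ → d → ℝ) (c : Fin 2) (hcard : 2 * I.card < Fintype.card d) :
    (mixedCov a I y c).det = 0 := by
  -- Inner products with all `2 * I.card` centred vectors; in higher dimension this map has a
  -- nontrivial kernel.
  let f : (d → ℝ) →ₗ[ℝ] (Fin 2 × I → ℝ) :=
    LinearMap.pi fun q => dotProductBilin ℝ ℝ (y q.1 q.2 - sampleMean I (y q.1))
  have hf : LinearMap.ker f ≠ ⊥ := by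
    apply LinearMap.ker_ne_bot_of_finrank_lt
    simpa using hcard
  obtain ⟨u, huf, hu⟩ := (Submodule.ne_bot_iff _).1 hf
  refine mixedCov_det_eq_zero hu fun c' _ i hi => ?_
  exact congrFun (LinearMap.mem_ker.1 huf) (c', ⟨i, hi⟩)

end MixedCovariance

/-! ### Summable tail bounds -/

theorem summable_sq_mul_exp_neg_rpow {b β : ℝ} (hb : 0 < b) (hβ : 0 < β) :
    Summable fun k : ℕ => (k : ℝ) ^ 2 * Real.exp (-b * (k : ℝ) ^ β) := by
  -- The exponent `4 / β` turns `k ^ β` into `k ^ 4`, so the terms are eventually dominated by `1 /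
  -- k ^ 2`.
  have h1 := tendsto_rpow_mul_exp_neg_mul_atTop_nhds_zero (4 / β) b hb
  have h2 : Tendsto (fun k : ℕ => (k : ℝ) ^ β) atTop atTop :=
    (tendsto_rpow_atTop hβ).comp tendsto_natCast_atTop_atTop
  have h3 := (h1.comp h2).eventually (gt_mem_nhds zero_lt_one)
  have hs : Summable fun k : ℕ => 1 / (k : ℝ) ^ 2 := Real.summable_one_div_nat_pow.2 one_lt_two
  refine Summable.of_norm_bounded_eventually_nat hs ?_
  filter_upwards [h3, eventually_gt_atTop 0] with k hk hk0
  have hk' : (0 : ℝ) < k := by exact_mod_cast hk0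
  have h4 : ((k : ℝ) ^ β) ^ (4 / β) = (k : ℝ) ^ 4 := by
    rw [← Real.rpow_mul hk'.le, mul_div_cancel₀ _ hβ.ne']
    exact_mod_cast Real.rpow_natCast (k : ℝ) 4
  simp only [Function.comp_apply, h4] at hk
  rw [Real.norm_of_nonneg (by positivity), le_div_iff₀ (by positivity)]
  nlinarith

/-- Borel–Cantelli, applied to a shifted sequence because the bound only holds eventually. -/
theorem ae_eventually_notMem_of_summable {Ω : Type*} [MeasurableSpace Ω] {P : Measure Ω}
    [IsFiniteMeasure P] {s : ℕ → Set Ω} {b : ℕ → ℝ} (hb : Summable b)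
    (h : ∀ᶠ k in atTop, P.real (s k) ≤ b k) : ∀ᵐ ω ∂P, ∀ᶠ k in atTop, ω ∉ s k := by
  obtain ⟨N, hN⟩ := eventually_atTop.1 h
  have hsum : ∑' k, P (s (k + N)) ≠ ⊤ := by
    have hb' : Summable fun k => b (k + N) := (summable_nat_add_iff N).2 hb
    refine ne_top_of_le_ne_top hb'.tsum_ofReal_ne_top (ENNReal.tsum_le_tsum fun k => ?_)
    rw [← ofReal_measureReal]
    exact ENNReal.ofReal_le_ofReal (hN _ (Nat.le_add_left N k))
  filter_upwards [ae_eventually_notMem hsum] with ω hω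
  obtain ⟨M, hM⟩ := eventually_atTop.1 hω
  refine eventually_atTop.2 ⟨M + N, fun k hk => ?_⟩
  have := hM (k - N) (by omega)
  rwa [Nat.sub_add_cancel (by omega)] at this

/-- The source of the condition `α < 1 / 2`: at accuracy of order `ε / D k` the exponent is of order
`k / D k ^ 2`, hence at least a multiple of a positive power of `k`. The polynomial factor collects
two classes, the pairs of dimensions and the moments of each transformed vector. -/
theorem summable_bound_of_dimension {D : ℕ → ℕ} {n : ℕ → ℕ} {δ α ε : ℝ} (hδ : 0 < δ) (hε : 0 < ε)
    (hα : α < 1 / 2) (hD : ∀ᶠ k : ℕ in atTop, (D k : ℝ) ≤ (k : ℝ) ^ α)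
    (hn : ∀ᶠ k : ℕ in atTop, δ * k ≤ n k) :
    ∃ b : ℕ → ℝ, Summable b ∧ ∀ᶠ k in atTop,
      12 * ((D k : ℝ) + 1) ^ 4 * Real.exp (-(n k * (ε / (3 * ((D k : ℝ) + 1))) ^ 2 / 16)) ≤ b k := by
  -- Raising the exponent ensures `k ^ α' ≥ 1`, which absorbs the summand one in `D k + 1`.
  set α' := max α (1 / 4) with hα'
  have hα'2 : α' < 1 / 2 := max_lt hα (by norm_num)
  have hα'0 : 1 / 4 ≤ α' := le_max_right _ _
  refine ⟨fun k => 192 * ((k : ℝ) ^ 2 * Real.exp (-(δ * ε ^ 2 / 576) * (k : ℝ) ^ (1 - 2 * α'))),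
    (summable_sq_mul_exp_neg_rpow (by positivity) (by linarith)).mul_left _, ?_⟩
  filter_upwards [hD, hn, eventually_ge_atTop 1] with k hDk hnk hk1
  have hk : (1 : ℝ) ≤ k := by exact_mod_cast hk1
  have hk0 : (0 : ℝ) < k := by linarith
  set r := (k : ℝ) ^ α' with hr
  have hr1 : 1 ≤ r := Real.one_le_rpow hk (by linarith)
  have hDr : (D k : ℝ) + 1 ≤ 2 * r := by
    have : (k : ℝ) ^ α ≤ r := Real.rpow_le_rpow_of_exponent_le hk (le_max_left _ _)
    linarith
  have hr2 : r ^ 2 = (k : ℝ) ^ (2 * α') := by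
    rw [hr, mul_comm, Real.rpow_mul hk0.le]; norm_cast
  have hr4 : r ^ 4 ≤ (k : ℝ) ^ 2 := by
    have : r ^ 2 ≤ k := by
      rw [hr2]
      exact (Real.rpow_le_rpow_of_exponent_le hk (by linarith)).trans_eq (Real.rpow_one _)
    calc r ^ 4 = (r ^ 2) ^ 2 := by ring
      _ ≤ (k : ℝ) ^ 2 := by gcongr
  have hkβ : (k : ℝ) ^ (1 - 2 * α') * r ^ 2 = k := by
    rw [hr2, ← Real.rpow_add hk0]; simp
  have hpoly : 12 * ((D k : ℝ) + 1) ^ 4 ≤ 192 * (k : ℝ) ^ 2 := by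
    calc 12 * ((D k : ℝ) + 1) ^ 4 ≤ 12 * (2 * r) ^ 4 := by gcongr
      _ = 192 * r ^ 4 := by ring
      _ ≤ _ := by gcongr
  have hexp : δ * ε ^ 2 / 576 * (k : ℝ) ^ (1 - 2 * α') ≤
      n k * (ε / (3 * ((D k : ℝ) + 1))) ^ 2 / 16 := by
    have hD0 : 0 < (D k : ℝ) + 1 := by positivity
    have e : (n k : ℝ) * (ε / (3 * ((D k : ℝ) + 1))) ^ 2 / 16 =
        n k * ε ^ 2 / (144 * ((D k : ℝ) + 1) ^ 2) := by field_simp; ring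
    rw [e, le_div_iff₀ (by positivity)]
    have h1 : ((D k : ℝ) + 1) ^ 2 ≤ 4 * r ^ 2 := by nlinarith
    calc δ * ε ^ 2 / 576 * (k : ℝ) ^ (1 - 2 * α') * (144 * ((D k : ℝ) + 1) ^ 2)
        ≤ δ * ε ^ 2 / 576 * (k : ℝ) ^ (1 - 2 * α') * (144 * (4 * r ^ 2)) := by gcongr
      _ = δ * ε ^ 2 * ((k : ℝ) ^ (1 - 2 * α') * r ^ 2) := by ring
      _ = (δ * k) * ε ^ 2 := by rw [hkβ]; ring
      _ ≤ n k * ε ^ 2 := by gcongr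
  calc _ ≤ 192 * (k : ℝ) ^ 2 * Real.exp (-(δ * ε ^ 2 / 576) * (k : ℝ) ^ (1 - 2 * α')) := by
        refine mul_le_mul hpoly (Real.exp_le_exp.2 ?_) (Real.exp_pos _).le (by positivity)
        linarith
    _ = _ := by ring

/-! ### The fitted rules along the sequence of samples -/

section Fitted

variable {Ω Ω' : Type*} [MeasurableSpace Ω] [MeasurableSpace Ω'] {T : ℝ}

/-- Independent samples `v c 0, v c 1, …` of paths of the Gaussian processes `G c`. -/
structure IsGaussianSample (P : Measure Ω) (P' : Measure Ω') (G : Fin 2 → Ω → SamplePath T)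
    (v : Fin 2 → ℕ → Ω' → SamplePath T) : Prop where
  measurable : ∀ c, Measurable (G c)
  gaussian : ∀ c, IsGaussianProcess (fun t ω => G c ω t) P
  measurable_sample : ∀ c i, Measurable (v c i)
  law : ∀ c i, P'.map (v c i) = P.map (G c)
  indep : iIndepFun (fun q : Fin 2 × ℕ => v q.1 q.2) P'

/-- The covariance matrix of the transformed stage-`k` observations of the process `G c`. -/
noncomputable def lsCov (P : Measure Ω) (G : Fin 2 → Ω → SamplePath T) (𝒯 : SamplingScheme T)
    (k : ℕ) (p : ℕ × ℕ) (c : Fin 2) : Matrix (Fin p.1 ⊕ Fin p.2) (Fin p.1 ⊕ Fin p.2) ℝ :=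
  covMatrix P fun ω => lsPath 𝒯 k p (G c ω)

/-- The mean of the transformed stage-`k` observations of the process `G c`. -/
noncomputable def lsMean (P : Measure Ω) (G : Fin 2 → Ω → SamplePath T) (𝒯 : SamplingScheme T)
    (k : ℕ) (p : ℕ × ℕ) (c : Fin 2) : Fin p.1 ⊕ Fin p.2 → ℝ :=
  meanVector P fun ω => lsPath 𝒯 k p (G c ω)

/-- The risk of the randomized rule that assigns the path `x` to class `1` with probability
`φ x`. -/
noncomputable def softRisk (P : Measure Ω) (G : Fin 2 → Ω → SamplePath T)
    (φ : SamplePath T → ℝ) : ℝ :=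
  (1 / 2) * (∫ ω, φ (G 0 ω) ∂P + ∫ ω, (1 - φ (G 1 ω)) ∂P)

variable {P : Measure Ω} [IsProbabilityMeasure P] {P' : Measure Ω'} [IsProbabilityMeasure P']
  {G : Fin 2 → Ω → SamplePath T} {v : Fin 2 → ℕ → Ω' → SamplePath T}

theorem lsRule_plugInMethod (𝒯 : SamplingScheme T) (a : Fin 2 → Fin 2 → ℝ)
    (w : Fin 2 → ℕ → SamplePath T) (k : ℕ) (I : Finset ℕ) (p : ℕ × ℕ) (x : SamplePath T) :
    lsRule 𝒯 (plugInMethod a) w k I p x =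
      plugIn (fun c => sampleMean I fun i => lsPath 𝒯 k p (w c i))
        (mixedCov a I fun c i => lsPath 𝒯 k p (w c i)) (lsPath 𝒯 k p x) := rfl

omit [IsProbabilityMeasure P] [IsProbabilityMeasure P'] in
theorem IsGaussianSample.map_comp (h : IsGaussianSample P P' G v) {E : Type*} [MeasurableSpace E]
    {f : SamplePath T → E} (hf : Measurable f) (c : Fin 2) (i : ℕ) :
    P'.map (fun ω => f (v c i ω)) = P.map fun ω => f (G c ω) := by
  have h1 := Measure.map_map (μ := P') hf (h.measurable_sample c i)
  rw [h.law, Measure.map_map hf (h.measurable c)] at h1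
  exact h1.symm

omit [IsProbabilityMeasure P] [IsProbabilityMeasure P'] in
theorem IsGaussianSample.ae_sample (h : IsGaussianSample P P' G v) {s : Set (SamplePath T)}
    (hs : MeasurableSet s) {c : Fin 2} (hc : ∀ᵐ ω ∂P, G c ω ∈ s) (i : ℕ) :
    ∀ᵐ ω ∂P', v c i ω ∈ s := by
  have h1 := ae_map_iff (μ := P) (p := fun x => x ∈ s) (h.measurable c).aemeasurable hs
  have h2 := ae_map_iff (μ := P') (p := fun x => x ∈ s) (h.measurable_sample c i).aemeasurable hs
  exact h2.1 (h.law c i ▸ h1.2 hc)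

omit [IsProbabilityMeasure P] [IsProbabilityMeasure P'] in
theorem IsGaussianSample.indep_class (h : IsGaussianSample P P' G v) (c : Fin 2) :
    iIndepFun (v c) P' :=
  h.indep.precomp (g := fun i : ℕ => (c, i)) fun _ _ hij => (Prod.mk.inj hij).2

omit [IsProbabilityMeasure P'] in
/-- A singular covariance matrix makes the fitted rule constant. -/
theorem ae_lsRule_eq_zero_of_singular (h : IsGaussianSample P P' G v) (𝒯 : SamplingScheme T)
    {a : Fin 2 → Fin 2 → ℝ}
    (hcov : ∀ c c', a c c' ≠ 0 → ∀ k p, lsCov P G 𝒯 k p c' = lsCov P G 𝒯 k p c) :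
    ∀ᵐ ω ∂P', ∀ k p I x, (∃ c, (lsCov P G 𝒯 k p c).det = 0) →
      lsRule 𝒯 (plugInMethod a) (fun c i => v c i ω) k I p x = 0 := by
  rw [ae_all_iff]; intro k
  rw [ae_all_iff]; intro p
  by_cases hex : ∃ c, (lsCov P G 𝒯 k p c).det = 0
  swap
  · exact ae_of_all _ fun ω I x hc => absurd hc hex
  obtain ⟨c, hc⟩ := hex
  obtain ⟨u, hu0, hu⟩ := Matrix.exists_mulVec_eq_zero_iff.2 hc
  have hum : Measurable fun x : SamplePath T => u ⬝ᵥ lsPath 𝒯 k p x := by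
    have h1 : Continuous fun z : Fin p.1 ⊕ Fin p.2 → ℝ => u ⬝ᵥ z := by fun_prop
    exact h1.measurable.comp (measurable_lsPath 𝒯 k p)
  -- All classes that enter the estimate for `c` share its covariance matrix. Their transformed
  -- paths are therefore almost surely constant in the same kernel direction `u`, which then lies in
  -- the kernel of the estimate.
  have hconst : ∀ c', a c c' ≠ 0 → ∃ r : ℝ, ∀ᵐ ω ∂P', ∀ i, u ⬝ᵥ lsPath 𝒯 k p (v c' i ω) = r := by
    intro c' hc'
    have hG := hasGaussianLaw_lsPath (h.gaussian c') 𝒯 k p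
    rw [← hcov c c' hc' k p] at hu
    refine ⟨∫ ω, u ⬝ᵥ lsPath 𝒯 k p (G c' ω) ∂P, ae_all_iff.2 fun i => ?_⟩
    exact h.ae_sample (s := {x | u ⬝ᵥ lsPath 𝒯 k p x = ∫ ω, u ⬝ᵥ lsPath 𝒯 k p (G c' ω) ∂P}) (hum (measurableSet_singleton _))
      (ae_eq_of_covMatrix_mulVec_eq_zero (memLp_coord hG) hu) i
  have hall : ∀ᵐ ω ∂P', ∀ c', a c c' ≠ 0 → ∃ r : ℝ, ∀ i, u ⬝ᵥ lsPath 𝒯 k p (v c' i ω) = r := by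
    refine ae_all_iff.2 fun c' => ?_
    by_cases hc' : a c c' = 0
    · exact ae_of_all _ fun ω h => absurd hc' h
    · obtain ⟨r, hr⟩ := hconst c' hc'
      exact hr.mono fun ω hω _ => ⟨r, hω⟩
  filter_upwards [hall] with ω hω I x _
  rw [lsRule_plugInMethod]
  refine plugIn_eq_zero_of_det (c := c) (mixedCov_det_eq_zero hu0 fun c' hc' => ?_) _
  obtain ⟨r, hr⟩ := hω c' hc'
  exact sub_sampleMean_dotProduct fun i _ => hr i

/-- With too few observations the fitted rule is constant. -/
theorem lsRule_eq_zero_of_card (𝒯 : SamplingScheme T) (a : Fin 2 → Fin 2 → ℝ)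
    (w : Fin 2 → ℕ → SamplePath T) (k : ℕ) {I : Finset ℕ} {p : ℕ × ℕ}
    (hp : 2 * I.card < p.1 + p.2) (x : SamplePath T) :
    lsRule 𝒯 (plugInMethod a) w k I p x = 0 := by
  rw [lsRule_plugInMethod]
  exact plugIn_eq_zero_of_det (c := 0) (mixedCov_det_eq_zero_of_card a _ 0 (by simpa using hp)) _

/-- The whitened sample moments of class `c` are within `t` of their expectations. -/
def MomentsClose (P : Measure Ω) (G : Fin 2 → Ω → SamplePath T) (𝒯 : SamplingScheme T) (k : ℕ)
    (p : ℕ × ℕ) (c : Fin 2) (A : Matrix (Fin p.1 ⊕ Fin p.2) (Fin p.1 ⊕ Fin p.2) ℝ) (t : ℝ)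
    (I : Finset ℕ) (y : ℕ → SamplePath T) : Prop :=
  ∀ a b, |(I.card : ℝ)⁻¹ * ∑ i ∈ I, A⁻¹.mulVec (lsPath 𝒯 k p (y i) - lsMean P G 𝒯 k p c) a| ≤ t ∧
    |(I.card : ℝ)⁻¹ * ∑ i ∈ I, A⁻¹.mulVec (lsPath 𝒯 k p (y i) - lsMean P G 𝒯 k p c) a *
      A⁻¹.mulVec (lsPath 𝒯 k p (y i) - lsMean P G 𝒯 k p c) b -
        (1 : Matrix (Fin p.1 ⊕ Fin p.2) (Fin p.1 ⊕ Fin p.2) ℝ) a b| ≤ t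

theorem measureReal_not_momentsClose_le (h : IsGaussianSample P P' G v) (𝒯 : SamplingScheme T)
    (k : ℕ) (p : ℕ × ℕ) (c : Fin 2) {A : Matrix (Fin p.1 ⊕ Fin p.2) (Fin p.1 ⊕ Fin p.2) ℝ}
    (hA : A.det ≠ 0) (hAZ : A * A.transpose = lsCov P G 𝒯 k p c) {I : Finset ℕ} (hI : I.Nonempty)
    {t : ℝ} (ht : 0 < t) (ht1 : t ≤ 1) :
    P'.real {ω | ¬ MomentsClose P G 𝒯 k p c A t I fun i => v c i ω} ≤
      6 * ((p.1 + p.2 : ℕ) : ℝ) ^ 2 * Real.exp (-(I.card * t ^ 2 / 16)) := by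
  have hf : Measurable fun x : SamplePath T =>
      A⁻¹.mulVec (lsPath 𝒯 k p x - lsMean P G 𝒯 k p c) := by
    have h1 : Continuous fun z : Fin p.1 ⊕ Fin p.2 → ℝ => A⁻¹.mulVec (z - lsMean P G 𝒯 k p c) := by
      fun_prop
    exact h1.measurable.comp (measurable_lsPath 𝒯 k p)
  have := stdNormal_sample_moments
    (ξ := fun i ω => A⁻¹.mulVec (lsPath 𝒯 k p (v c i ω) - lsMean P G 𝒯 k p c))
    ((h.indep_class c).comp (fun _ x => A⁻¹.mulVec (lsPath 𝒯 k p x - lsMean P G 𝒯 k p c))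
      fun _ => hf) (fun i => hf.comp (h.measurable_sample c i))
    (fun i => (h.map_comp hf c i).trans
      (map_whiten_eq_stdNormal (hasGaussianLaw_lsPath (h.gaussian c) 𝒯 k p) A hA hAZ)) hI ht ht1
  simpa [MomentsClose] using this

omit [IsProbabilityMeasure P'] in
-- The estimate for class `c` is a convex combination of empirical covariance matrices whose classes
-- have the same whitening matrix, so its whitened deviation obeys the same entrywise bound as each
-- of them. `plugIn_risk_le` then applies, and the prior weight `1 / 2` reduces its error `8 * ε` to
-- `4 * ε`.
theorem risk_le_of_momentsClose (h : IsGaussianSample P P' G v) (𝒯 : SamplingScheme T)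
    {a : Fin 2 → Fin 2 → ℝ} (ha : ∀ c c', 0 ≤ a c c') (ha1 : ∀ c, ∑ c', a c c' = 1) (k : ℕ)
    (p : ℕ × ℕ) {A : Fin 2 → Matrix (Fin p.1 ⊕ Fin p.2) (Fin p.1 ⊕ Fin p.2) ℝ}
    (hA : ∀ c, (A c).det ≠ 0) (hAZ : ∀ c, A c * (A c).transpose = lsCov P G 𝒯 k p c)
    (hAa : ∀ c c', a c c' ≠ 0 → A c' = A c) {I : Finset ℕ} (hI : I.Nonempty) {t ε : ℝ}
    (hε : 0 < ε) (hε' : ε ≤ 1 / 2) (ht : 0 ≤ t) (ht1 : t ≤ 1)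
    (htε : 3 * ((p.1 + p.2 : ℕ) : ℝ) * t ≤ ε) {w : Fin 2 → ℕ → SamplePath T}
    (hw : ∀ c, MomentsClose P G 𝒯 k p c (A c) t I (w c)) {ψ : (Fin p.1 ⊕ Fin p.2 → ℝ) → ℝ}
    (hψm : Measurable ψ) (hψ : ∀ z, 0 ≤ ψ z) (hψ' : ∀ z, ψ z ≤ 1) :
    risk P G (lsRule 𝒯 (plugInMethod a) w k I p) ≤
      softRisk P G (fun x => ψ (lsPath 𝒯 k p x)) + 4 * ε := by
  set y : Fin 2 → ℕ → (Fin p.1 ⊕ Fin p.2 → ℝ) := fun c i => lsPath 𝒯 k p (w c i) with hy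
  have hmom := fun c => whitened_moments_le hI (lsMean P G 𝒯 k p c) (A c) (y c) ht1 (hw c)
  have hdev : ∀ c, whitenedDeviation (lsMean P G 𝒯 k p c) (A c) (sampleMean I (y c))
      (mixedCov a I y c) ≤ ε ^ 2 := by
    intro c
    refine whitenedDeviation_le _ _ _ _ (t := t) (by simpa using htε) ht fun i j =>
      ⟨(hmom c i j).1, ?_⟩
    have e : (A c)⁻¹ * mixedCov a I y c * (A c)⁻¹.transpose - 1 =
        ∑ c', a c c' • ((A c)⁻¹ * sampleCov I (y c') * (A c)⁻¹.transpose - 1) := by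
      simp only [smul_sub, Finset.sum_sub_distrib, ← Finset.sum_smul, ha1, one_smul, mixedCov,
        Matrix.mul_sum, Matrix.sum_mul, Matrix.mul_smul, Matrix.smul_mul]
    rw [e, Matrix.sum_apply]
    calc |∑ c', (a c c' • ((A c)⁻¹ * sampleCov I (y c') * (A c)⁻¹.transpose - 1)) i j|
        ≤ ∑ c', |(a c c' • ((A c)⁻¹ * sampleCov I (y c') * (A c)⁻¹.transpose - 1)) i j| :=
          Finset.abs_sum_le_sum_abs _ _
      _ ≤ ∑ c', a c c' * (2 * t) := by
          refine Finset.sum_le_sum fun c' _ => ?_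
          rw [Matrix.smul_apply, smul_eq_mul, abs_mul, abs_of_nonneg (ha c c')]
          by_cases hc : a c c' = 0
          · simp [hc]
          · rw [← hAa c c' hc]
            exact mul_le_mul_of_nonneg_left (hmom c' i j).2 (ha c c')
      _ = 2 * t := by rw [← Finset.sum_mul, ha1, one_mul]
  have hmap := fun c => map_eq_gaussLaw (hasGaussianLaw_lsPath (h.gaussian c) 𝒯 k p) (A c) (hA c)
    (hAZ c)
  have key := plugIn_risk_le (fun c => lsMean P G 𝒯 k p c) (fun c => sampleMean I (y c)) A
    (mixedCov a I y) hA (mixedCov_isSymm a I y) hε hε' hdev ψ hψm hψ hψ'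
  have hZm : ∀ c, Measurable fun ω => lsPath 𝒯 k p (G c ω) := fun c =>
    (measurable_lsPath 𝒯 k p).comp (h.measurable c)
  have hg : Measurable (plugIn (fun c => sampleMean I (y c)) (mixedCov a I y)) :=
    measurable_plugIn (fun c => continuous_const) (fun c => continuous_const) continuous_id
  have hreal : ∀ c, P.real {ω | lsRule 𝒯 (plugInMethod a) w k I p (G c ω) ≠ c} =
      (gaussLaw (lsMean P G 𝒯 k p c) (A c)).real
        {z | plugIn (fun c => sampleMean I (y c)) (mixedCov a I y) z ≠ c} := by
    intro c
    have hs : MeasurableSet {z | plugIn (fun c => sampleMean I (y c)) (mixedCov a I y) z ≠ c} :=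
      hg (measurableSet_singleton c).compl
    rw [lsMean, ← hmap c, map_measureReal_apply (hZm c) hs]
    rfl
  have hint : ∀ (c : Fin 2) (f : (Fin p.1 ⊕ Fin p.2 → ℝ) → ℝ), Measurable f →
      ∫ ω, f (lsPath 𝒯 k p (G c ω)) ∂P = ∫ z, f z ∂gaussLaw (lsMean P G 𝒯 k p c) (A c) := by
    intro c f hf
    rw [lsMean, ← hmap c, integral_map (hZm c).aemeasurable hf.aestronglyMeasurable]
  unfold risk softRisk
  rw [Fin.sum_univ_two, hreal, hreal, hint 0 ψ hψm,
    hint 1 (fun z => 1 - ψ z) (measurable_const.sub hψm)]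
  linarith

/-- Almost surely, for large samples, the rules whose dimension is small compared with the square
root of the sample size perform almost as well as any randomized rule based on the same
transform. -/
theorem ae_risk_le_softRisk (h : IsGaussianSample P P' G v) (𝒯 : SamplingScheme T)
    {a : Fin 2 → Fin 2 → ℝ} (ha : ∀ c c', 0 ≤ a c c') (ha1 : ∀ c, ∑ c', a c c' = 1)
    (hcov : ∀ c c', a c c' ≠ 0 → ∀ k p, lsCov P G 𝒯 k p c' = lsCov P G 𝒯 k p c)
    {I : ℕ → Finset ℕ} {D : ℕ → ℕ} {δ α : ℝ} (hδ : 0 < δ) (hα : α < 1 / 2)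
    (hI : ∀ᶠ k : ℕ in atTop, δ * k ≤ (I k).card)
    (hD : ∀ᶠ k : ℕ in atTop, (D k : ℝ) ≤ (k : ℝ) ^ α) :
    ∀ᵐ ω ∂P', ∀ ε : ℝ, 0 < ε → ∀ᶠ k in atTop, ∀ p : ℕ × ℕ, p.1 + p.2 ≤ D k →
      (∀ c, (lsCov P G 𝒯 k p c).det ≠ 0) → ∀ ψ : (Fin p.1 ⊕ Fin p.2 → ℝ) → ℝ, Measurable ψ →
        (∀ z, 0 ≤ ψ z) → (∀ z, ψ z ≤ 1) →
        risk P G (lsRule 𝒯 (plugInMethod a) (fun c i => v c i ω) k (I k) p) ≤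
          softRisk P G (fun x => ψ (lsPath 𝒯 k p x)) + ε := by
  have hfac : ∀ (p : ℕ × ℕ) (M : Matrix (Fin p.1 ⊕ Fin p.2) (Fin p.1 ⊕ Fin p.2) ℝ),
      ∃ A : Matrix (Fin p.1 ⊕ Fin p.2) (Fin p.1 ⊕ Fin p.2) ℝ,
        M.PosSemidef → M.det ≠ 0 → A.det ≠ 0 ∧ A * A.transpose = M := by
    intro p M
    by_cases hM : M.PosSemidef ∧ M.det ≠ 0
    · obtain ⟨A, hA⟩ := exists_mul_transpose_eq hM.1 hM.2
      exact ⟨A, fun _ _ => hA⟩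
    · exact ⟨1, fun h1 h2 => absurd ⟨h1, h2⟩ hM⟩
  -- The whitening factor is a function of the covariance matrix, so that classes with equal
  -- covariance matrices receive equal factors.
  choose F hF using hfac
  have hFc : ∀ k p c, (lsCov P G 𝒯 k p c).det ≠ 0 → (F p (lsCov P G 𝒯 k p c)).det ≠ 0 ∧
      F p (lsCov P G 𝒯 k p c) * (F p (lsCov P G 𝒯 k p c)).transpose = lsCov P G 𝒯 k p c :=
    fun k p c hc => hF p _
      (covMatrix_posSemidef (memLp_coord (hasGaussianLaw_lsPath (h.gaussian c) 𝒯 k p))) hc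
  have hIpos : ∀ᶠ k in atTop, (I k).Nonempty := by
    filter_upwards [hI, eventually_gt_atTop 0] with k hk hk0
    rw [← Finset.card_pos]
    have : (0 : ℝ) < δ * k := mul_pos hδ (by exact_mod_cast hk0)
    exact_mod_cast this.trans_le hk
  -- the exceptional events
  have main : ∀ j : ℕ, ∀ᵐ ω ∂P', ∀ᶠ k in atTop, ∀ p : ℕ × ℕ, p.1 + p.2 ≤ D k → ∀ c,
      (lsCov P G 𝒯 k p c).det ≠ 0 → MomentsClose P G 𝒯 k p c (F p (lsCov P G 𝒯 k p c))
        ((1 / ((j : ℝ) + 2)) / (3 * ((D k : ℝ) + 1))) (I k) fun i => v c i ω := by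
    intro j
    set ε : ℝ := 1 / ((j : ℝ) + 2) with hε
    have hε0 : 0 < ε := by positivity
    have hε1 : ε ≤ 1 := by
      rw [hε, div_le_one (by positivity)]; linarith [(Nat.cast_nonneg j : (0 : ℝ) ≤ j)]
    obtain ⟨b, hb, hbk⟩ := summable_bound_of_dimension hδ hε0 hα hD hI
    set s : ℕ → Set Ω' := fun k =>
      ⋃ q ∈ (Finset.range (D k + 1) ×ˢ Finset.range (D k + 1)) ×ˢ (Finset.univ : Finset (Fin 2)),
        {ω | q.1.1 + q.1.2 ≤ D k ∧ (lsCov P G 𝒯 k q.1 q.2).det ≠ 0 ∧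
          ¬ MomentsClose P G 𝒯 k q.1 q.2 (F q.1 (lsCov P G 𝒯 k q.1 q.2))
          (ε / (3 * ((D k : ℝ) + 1))) (I k) fun i => v q.2 i ω} with hs
    have hsb : ∀ᶠ k in atTop, P'.real (s k) ≤ b k := by
      filter_upwards [hbk, hIpos] with k hk hIk
      refine le_trans ?_ hk
      set t := ε / (3 * ((D k : ℝ) + 1)) with ht
      have hD1 : (1 : ℝ) ≤ (D k : ℝ) + 1 := by linarith [(Nat.cast_nonneg (D k) : (0 : ℝ) ≤ D k)]
      have ht0 : 0 < t := by positivity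
      have ht1 : t ≤ 1 := by
        rw [ht, div_le_one (by positivity)]; linarith
      refine (measureReal_biUnion_finset_le _ _).trans ?_
      refine (Finset.sum_le_card_nsmul _ _
        (6 * ((D k : ℝ) + 1) ^ 2 * Real.exp (-((I k).card * t ^ 2 / 16))) fun q _ => ?_).trans ?_
      · by_cases hq : q.1.1 + q.1.2 ≤ D k ∧ (lsCov P G 𝒯 k q.1 q.2).det ≠ 0
        · obtain ⟨h1, h2⟩ := hFc k q.1 q.2 hq.2
          refine (measureReal_mono fun ω hω => hω.2.2).trans
            ((measureReal_not_momentsClose_le h 𝒯 k q.1 q.2 h1 h2 hIk ht0 ht1).trans ?_)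
          have : ((q.1.1 + q.1.2 : ℕ) : ℝ) ≤ (D k : ℝ) + 1 := by
            have : ((q.1.1 + q.1.2 : ℕ) : ℝ) ≤ (D k : ℝ) := by exact_mod_cast hq.1
            linarith
          gcongr
        · have : {ω | q.1.1 + q.1.2 ≤ D k ∧ (lsCov P G 𝒯 k q.1 q.2).det ≠ 0 ∧
              ¬ MomentsClose P G 𝒯 k q.1 q.2 (F q.1 (lsCov P G 𝒯 k q.1 q.2)) t (I k)
                fun i => v q.2 i ω} = ∅ := by
            ext ω
            simp only [Set.mem_ofPred_eq, Set.mem_empty_iff_false, iff_false]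
            exact fun hω => hq ⟨hω.1, hω.2.1⟩
          rw [this, measureReal_empty]
          positivity
      · simp only [Finset.card_product, Finset.card_range, Finset.card_univ, Fintype.card_fin,
          nsmul_eq_mul]
        push_cast
        apply le_of_eq
        ring
    filter_upwards [ae_eventually_notMem_of_summable hb hsb] with ω hω
    filter_upwards [hω] with k hk p hp c hc
    by_contra hcon
    refine hk (Set.mem_biUnion (x := (p, c)) ?_ ⟨hp, hc, hcon⟩)
    simp
    omega
  filter_upwards [ae_all_iff.2 main] with ω hω ε hε
  -- Countably many accuracies suffice for one null set. The form `1 / (j + 2)` keeps them below `1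
  -- / 2`, and the division by four pays for the loss in `risk_le_of_momentsClose`.
  obtain ⟨j, hj⟩ := exists_nat_one_div_lt (show 0 < ε / 4 by positivity)
  filter_upwards [hω j, hIpos] with k hk hIk p hp hns ψ hψm hψ hψ'
  have hj0 : (0 : ℝ) ≤ j := Nat.cast_nonneg j
  have hD0 : (0 : ℝ) ≤ D k := Nat.cast_nonneg _
  have e1 : 1 / ((j : ℝ) + 2) ≤ 1 / 2 := by gcongr; linarith
  have e2 : 1 / ((j : ℝ) + 2) ≤ 1 / ((j : ℝ) + 1) := by gcongr; norm_num
  have hpD : ((p.1 + p.2 : ℕ) : ℝ) ≤ D k := by exact_mod_cast hp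
  refine (risk_le_of_momentsClose h 𝒯 ha ha1 k p (A := fun c => F p (lsCov P G 𝒯 k p c))
    (fun c => (hFc k p c (hns c)).1) (fun c => (hFc k p c (hns c)).2)
    (fun c c' hc => by rw [hcov c c' hc]) hIk (t := 1 / ((j : ℝ) + 2) / (3 * ((D k : ℝ) + 1)))
    (ε := 1 / ((j : ℝ) + 2)) (by positivity) e1 (by positivity) ?_ ?_ (fun c => hk p hp c (hns c))
    hψm hψ hψ').trans ?_
  · rw [div_le_one (by positivity)]; linarith
  · rw [mul_div_assoc', div_le_iff₀ (by positivity)]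
    have : 0 < 1 / ((j : ℝ) + 2) := by positivity
    nlinarith
  · linarith

end Fitted

/-! ### Concentration of error frequencies -/

section Frequency

variable {ι E F : Type*} [Fintype ι] [MeasurableSpace E] [MeasurableSpace F]

/-- Hoeffding's inequality for the empirical frequency of a set. -/
theorem measureReal_pi_frequency_deviation_le [Nonempty ι] (ν : Measure F) [IsProbabilityMeasure ν]
    {b : Set F} (hb : MeasurableSet b) {ε : ℝ} (hε : 0 ≤ ε) :
    (Measure.pi fun _ : ι => ν).real
        {y | ε ≤ |(Fintype.card ι : ℝ)⁻¹ * ∑ i, b.indicator 1 (y i) - ν.real b|} ≤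
      2 * Real.exp (-(2 * Fintype.card ι * ε ^ 2)) := by
  set n : ℝ := ((Fintype.card ι : ℕ) : ℝ) with hn
  have hn0 : 0 < n := by rw [hn]; exact_mod_cast Fintype.card_pos
  set f : F → ℝ := b.indicator 1 with hf
  have hfm : Measurable f := measurable_one.indicator hb
  have hfI : ∀ y, f y ∈ Set.Icc (0 : ℝ) 1 := fun y =>
    ⟨Set.indicator_nonneg (fun _ _ => zero_le_one) y,
      Set.indicator_le_self' (fun _ _ => zero_le_one) y⟩
  have hmean : ∀ i : ι, ∫ y : ι → F, f (y i) ∂Measure.pi (fun _ : ι => ν) = ν.real b := by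
    intro i
    have := (measurePreserving_eval (fun _ : ι => ν) i).map_eq
    rw [← integral_indicator_one hb]
    conv_rhs => rw [← this]
    rw [integral_map (measurable_pi_apply i).aemeasurable hfm.aestronglyMeasurable]
  have hind : iIndepFun (fun (i : ι) (y : ι → F) => f (y i) - ν.real b) (Measure.pi fun _ => ν) :=
    iIndepFun_pi (X := fun _ y => f y - ν.real b) fun _ => (hfm.sub_const _).aemeasurable
  have hsub : ∀ i : ι, HasSubgaussianMGF (fun y : ι → F => f (y i) - ν.real b)
      ((‖(1 : ℝ) - 0‖₊ / 2) ^ 2) (Measure.pi fun _ => ν) := by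
    intro i
    have := hasSubgaussianMGF_of_mem_Icc (μ := Measure.pi fun _ : ι => ν) (X := fun y => f (y i))
      (a := 0) (b := 1) (hfm.comp (measurable_pi_apply i)).aemeasurable
      (ae_of_all _ fun y => hfI (y i))
    rwa [hmean] at this
  have hind' : iIndepFun (fun (i : ι) (y : ι → F) => -(f (y i) - ν.real b))
      (Measure.pi fun _ => ν) := hind.comp (fun _ r => -r) fun _ => measurable_neg
  have hε' : 0 ≤ n * ε := by positivity
  have h1 := HasSubgaussianMGF.measure_sum_ge_le_of_iIndepFun hind (s := Finset.univ)
    (fun i _ => hsub i) hε'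
  have h2 := HasSubgaussianMGF.measure_sum_ge_le_of_iIndepFun hind' (s := Finset.univ)
    (fun i _ => (hsub i).neg) hε'
  -- Each variable with values in `[0, 1]` has variance proxy `1 / 4`.
  have hexp : -(n * ε) ^ 2 / (2 * ((∑ _i : ι, (‖(1 : ℝ) - 0‖₊ / 2) ^ 2 : NNReal) : ℝ)) =
      -(2 * n * ε ^ 2) := by
    have : ((∑ _i : ι, (‖(1 : ℝ) - 0‖₊ / 2) ^ 2 : NNReal) : ℝ) = n / 4 := by
      simp [hn]; ring
    rw [this]; field_simp; ring
  rw [hexp] at h1 h2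
  have hcover : {y : ι → F | ε ≤ |n⁻¹ * ∑ i, f (y i) - ν.real b|} ⊆
      {y | n * ε ≤ ∑ i, (f (y i) - ν.real b)} ∪ {y | n * ε ≤ ∑ i, -(f (y i) - ν.real b)} := by
    intro y hy
    have e : ∑ i, (f (y i) - ν.real b) = n * (n⁻¹ * ∑ i, f (y i) - ν.real b) := by
      rw [mul_sub, mul_inv_cancel_left₀ hn0.ne', Finset.sum_sub_distrib]
      simp [hn]
    simp only [Set.mem_union, Set.mem_ofPred_eq, Finset.sum_neg_distrib, e] at hy ⊢
    rcases le_abs.1 hy with h | h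
    · left; gcongr
    · right; rw [← mul_neg]; gcongr
  refine (measureReal_mono hcover).trans ((measureReal_union_le _ _).trans ?_)
  linarith

/-- Hoeffding's inequality for the empirical frequency of a random set that is independent of the
sample. -/
theorem measureReal_frequency_deviation_le [Nonempty ι] {Ω : Type*} [MeasurableSpace Ω]
    {P : Measure Ω} [IsProbabilityMeasure P] {X : Ω → E} (hX : Measurable X) {Y : ι → Ω → F}
    (hY : ∀ i, Measurable (Y i)) (hYind : iIndepFun Y P) {ν : Measure F} [IsProbabilityMeasure ν]
    (hν : ∀ i, P.map (Y i) = ν) (hXY : IndepFun X (fun ω i => Y i ω) P) {B : Set (E × F)}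
    (hB : MeasurableSet B) {ε : ℝ} (hε : 0 ≤ ε) :
    P.real {ω | ε ≤ |(Fintype.card ι : ℝ)⁻¹ * ∑ i, B.indicator 1 (X ω, Y i ω) -
        ν.real {y | (X ω, y) ∈ B}|} ≤
      2 * Real.exp (-(2 * Fintype.card ι * ε ^ 2)) := by
  have hYm : Measurable fun ω i => Y i ω := measurable_pi_lambda _ hY
  set C : Set (E × (ι → F)) := {q | ε ≤ |(Fintype.card ι : ℝ)⁻¹ *
    ∑ i, B.indicator 1 (q.1, q.2 i) - ν.real {y | (q.1, y) ∈ B}|} with hC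
  have hCm : MeasurableSet C := by
    refine measurableSet_le measurable_const ?_
    refine (((Finset.measurable_sum _ fun i _ => ?_).const_mul _).sub ?_).abs
    · exact (measurable_one.indicator hB).comp
        (measurable_fst.prodMk ((measurable_pi_apply i).comp measurable_snd))
    · exact (measurable_measure_prodMk_left hB).ennreal_toReal.comp measurable_fst
  have hlaw : P.map (fun ω => (X ω, fun i => Y i ω)) = (P.map X).prod (Measure.pi fun _ => ν) := by
    rw [hXY.map_prod_eq_prod_map_map hX.aemeasurable hYm.aemeasurable,
      hYind.map_fun_eq_pi_map fun i => (hY i).aemeasurable]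
    simp only [hν]
  have : IsProbabilityMeasure (P.map X) := Measure.isProbabilityMeasure_map hX.aemeasurable
  set r : ℝ := 2 * Real.exp (-(2 * Fintype.card ι * ε ^ 2)) with hr
  have hr0 : 0 ≤ r := by positivity
  have hle : (P.map fun ω => (X ω, fun i => Y i ω)) C ≤ ENNReal.ofReal r := by
    rw [hlaw, Measure.prod_apply hCm]
    -- By independence the joint law is a product. For each fixed value of `X` the random set is a
    -- fixed one, and the bound is uniform in this value.
    calc ∫⁻ x, (Measure.pi fun _ : ι => ν) (Prod.mk x ⁻¹' C) ∂P.map X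
        ≤ ∫⁻ _, ENNReal.ofReal r ∂P.map X := by
          refine lintegral_mono fun x => ?_
          rw [← ofReal_measureReal]
          refine ENNReal.ofReal_le_ofReal ?_
          exact measureReal_pi_frequency_deviation_le ν (b := Prod.mk x ⁻¹' B)
            (measurable_prodMk_left hB) hε
      _ = ENNReal.ofReal r := by simp
  rw [Measure.map_apply (hX.prodMk hYm) hCm] at hle
  exact (ENNReal.toReal_mono ENNReal.ofReal_ne_top hle).trans_eq (ENNReal.toReal_ofReal hr0)

end Frequency

/-! ### Cross-validated error rates -/

section CrossValidation

variable {Ω Ω' : Type*} [MeasurableSpace Ω] [MeasurableSpace Ω'] {T : ℝ}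

/-- Only training paths enter the rule; this is what makes the fitted rule independent of disjoint
validation data. -/
theorem lsRule_congr (𝒯 : SamplingScheme T) (a : Fin 2 → Fin 2 → ℝ) {w w' : Fin 2 → ℕ → SamplePath T}
    (k : ℕ) {I : Finset ℕ} (h : ∀ c, ∀ i ∈ I, w c i = w' c i) (p : ℕ × ℕ) (x : SamplePath T) :
    lsRule 𝒯 (plugInMethod a) w k I p x = lsRule 𝒯 (plugInMethod a) w' k I p x := by
  have h1 : ∀ c, sampleMean I (fun i => lsPath 𝒯 k p (w c i)) =
      sampleMean I fun i => lsPath 𝒯 k p (w' c i) := fun c => by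
    unfold sampleMean
    congr 1
    exact Finset.sum_congr rfl fun i hi => by simp only [h c i hi]
  have h2 : ∀ c, sampleCov I (fun i => lsPath 𝒯 k p (w c i)) =
      sampleCov I fun i => lsPath 𝒯 k p (w' c i) := fun c => by
    unfold sampleCov
    rw [h1 c]
    congr 1
    exact Finset.sum_congr rfl fun i hi => by simp only [h c i hi]
  rw [lsRule_plugInMethod, lsRule_plugInMethod]
  congr 1
  · exact funext h1
  · exact funext fun c => Finset.sum_congr rfl fun c' _ => by rw [h2]

theorem continuous_sampleMean {d : Type*} (I : Finset ℕ) :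
    Continuous fun y : ℕ → d → ℝ => sampleMean I y :=
  Continuous.const_smul (g := fun y : ℕ → d → ℝ => ∑ i ∈ I, y i)
    (continuous_finsetSum _ fun i _ => continuous_apply i) (I.card : ℝ)⁻¹

theorem continuous_sampleCov {d : Type*} (I : Finset ℕ) :
    Continuous fun y : ℕ → d → ℝ => sampleCov I y := by
  refine Continuous.const_smul (g := fun y : ℕ → d → ℝ => ∑ i ∈ I,
    Matrix.vecMulVec (y i - sampleMean I y) (y i - sampleMean I y))
    (continuous_finsetSum _ fun i _ => ?_) (I.card : ℝ)⁻¹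
  have h1 : Continuous fun y : ℕ → d → ℝ => y i - sampleMean I y :=
    (continuous_apply i).sub (continuous_sampleMean I)
  exact h1.matrix_vecMulVec h1

/-- Joint measurability in the training data and the classified path is needed to condition on the
training data. -/
theorem measurable_lsRule_uncurry (𝒯 : SamplingScheme T) (a : Fin 2 → Fin 2 → ℝ) (k : ℕ)
    (I : Finset ℕ) (p : ℕ × ℕ) {X : Type*} [MeasurableSpace X] {w : X → Fin 2 → ℕ → SamplePath T}
    (hw : ∀ c i, Measurable fun x => w x c i) {z : X → SamplePath T} (hz : Measurable z) :
    Measurable fun x => lsRule 𝒯 (plugInMethod a) (w x) k I p (z x) := by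
  let d := Fin p.1 ⊕ Fin p.2
  have happ : ∀ c, Continuous fun q : (Fin 2 → ℕ → d → ℝ) × (d → ℝ) => q.1 c := fun c =>
    (continuous_apply c).comp continuous_fst
  have hmean := fun c => (continuous_sampleMean (d := d) I).comp (happ c)
  have hmix : ∀ c, Continuous fun q : (Fin 2 → ℕ → d → ℝ) × (d → ℝ) => mixedCov a I q.1 c :=
    fun c => continuous_finsetSum _ fun c' _ =>
      ((continuous_sampleCov I).comp (happ c')).const_smul (a c c')
  have key : Measurable fun q : (Fin 2 → ℕ → d → ℝ) × (d → ℝ) =>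
      plugIn (fun c => sampleMean I (q.1 c)) (mixedCov a I q.1) q.2 :=
    measurable_plugIn hmean hmix continuous_snd
  refine key.comp (f := fun x => (fun c i => lsPath 𝒯 k p (w x c i), lsPath 𝒯 k p (z x))) ?_
  refine Measurable.prodMk ?_ ((measurable_lsPath 𝒯 k p).comp hz)
  exact measurable_pi_lambda _ fun c => measurable_pi_lambda _ fun i =>
    (measurable_lsPath 𝒯 k p).comp (hw c i)

theorem measurable_lsRule (𝒯 : SamplingScheme T) (a : Fin 2 → Fin 2 → ℝ)
    (w : Fin 2 → ℕ → SamplePath T) (k : ℕ) (I : Finset ℕ) (p : ℕ × ℕ) :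
    Measurable (lsRule 𝒯 (plugInMethod a) w k I p) :=
  measurable_lsRule_uncurry 𝒯 a k I p (w := fun _ => w) (z := fun x => x)
    (fun _ _ => measurable_const) measurable_id

open Classical in
/-- The average over the classes of the proportion of misclassified paths `w c i`, `i ∈ J`. -/
noncomputable def errorRate (g : SamplePath T → Fin 2) (w : Fin 2 → ℕ → SamplePath T)
    (J : Finset ℕ) : ℝ :=
  (2 * (J.card : ℝ))⁻¹ * ∑ c : Fin 2, ∑ i ∈ J, if g (w c i) ≠ c then (1 : ℝ) else 0

variable {P : Measure Ω} [IsProbabilityMeasure P] {P' : Measure Ω'} [IsProbabilityMeasure P']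
  {G : Fin 2 → Ω → SamplePath T} {v : Fin 2 → ℕ → Ω' → SamplePath T}

open Classical in
-- Hoeffding's inequality given the training paths of both classes: these are independent of the
-- validation paths of class `c` because the index sets are disjoint.
theorem measureReal_classErrorRate_deviation_le (h : IsGaussianSample P P' G v)
    (𝒯 : SamplingScheme T) (a : Fin 2 → Fin 2 → ℝ) (k : ℕ) (p : ℕ × ℕ) (c : Fin 2)
    {I J : Finset ℕ} (hIJ : Disjoint I J) (hJ : J.Nonempty) {ε : ℝ} (hε : 0 ≤ ε) :
    P'.real {ω | ε ≤ |(J.card : ℝ)⁻¹ * (∑ i ∈ J,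
        if lsRule 𝒯 (plugInMethod a) (fun c i => v c i ω) k I p (v c i ω) ≠ c then (1 : ℝ) else 0) -
        P.real {η | lsRule 𝒯 (plugInMethod a) (fun c i => v c i ω) k I p (G c η) ≠ c}|} ≤
      2 * Real.exp (-(2 * J.card * ε ^ 2)) := by
  set S : Finset (Fin 2 × ℕ) := Finset.univ ×ˢ I with hS
  set U : Finset (Fin 2 × ℕ) := {c} ×ˢ J with hU
  have hSU : Disjoint S U := by
    rw [Finset.disjoint_left] at hIJ ⊢
    intro q hq hq'
    exact hIJ (Finset.mem_product.1 hq).2 (Finset.mem_product.1 hq').2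
  have hUcard : Fintype.card U = J.card := by simp [hU]
  have : Nonempty U := by
    obtain ⟨i, hi⟩ := hJ
    exact ⟨⟨(c, i), by simp [hU, hi]⟩⟩
  have hmeas : ∀ q : Fin 2 × ℕ, Measurable (v q.1 q.2) := fun q => h.measurable_sample q.1 q.2
  -- Extends the training paths to a full array. The default path at other indices is never read by
  -- the rule.
  let w : (S → SamplePath T) → Fin 2 → ℕ → SamplePath T := fun x c i =>
    if hq : (c, i) ∈ S then x ⟨(c, i), hq⟩ else 0
  have hw : ∀ c i, Measurable fun x => w x c i := by
    intro c i
    by_cases hq : (c, i) ∈ S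
    · simp only [w, hq, dif_pos]; exact measurable_pi_apply _
    · simp only [w, hq, dif_neg, not_false_eq_true]; exact measurable_const
  let X : Ω' → S → SamplePath T := fun ω q => v q.1.1 q.1.2 ω
  have hX : Measurable X := measurable_pi_lambda _ fun q => hmeas q
  have hrule : ∀ ω x, lsRule 𝒯 (plugInMethod a) (w (X ω)) k I p x =
      lsRule 𝒯 (plugInMethod a) (fun c i => v c i ω) k I p x := fun ω x =>
    lsRule_congr 𝒯 a k (fun c i hi => dif_pos (by simp [hS, hi])) p x
  let B : Set ((S → SamplePath T) × SamplePath T) :=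
    {q | lsRule 𝒯 (plugInMethod a) (w q.1) k I p q.2 ≠ c}
  have hB : MeasurableSet B :=
    measurable_lsRule_uncurry 𝒯 a k I p (w := fun q : (S → SamplePath T) × SamplePath T => w q.1)
      (fun c i => (hw c i).comp measurable_fst) measurable_snd (measurableSet_singleton c).compl
  have : IsProbabilityMeasure (P.map (G c)) :=
    Measure.isProbabilityMeasure_map (h.measurable c).aemeasurable
  have key := measureReal_frequency_deviation_le (P := P') hX (Y := fun q : U => v q.1.1 q.1.2)
    (fun q => hmeas q) (h.indep.precomp Subtype.val_injective) (ν := P.map (G c))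
    (fun q => by
      have : q.1.1 = c := by simpa using (Finset.mem_product.1 q.2).1
      rw [h.law, this])
    (h.indep.indepFun_finset S U hSU hmeas) hB hε
  rw [hUcard] at key
  refine le_of_eq_of_le (congrArg P'.real ?_) key
  ext ω
  have e1 : ∑ q : U, B.indicator (1 : (S → SamplePath T) × SamplePath T → ℝ) (X ω, v q.1.1 q.1.2 ω) = ∑ i ∈ J,
      if lsRule 𝒯 (plugInMethod a) (fun c i => v c i ω) k I p (v c i ω) ≠ c then (1 : ℝ) else 0 := by
    rw [Finset.sum_coe_sort U fun q => B.indicator (1 : (S → SamplePath T) × SamplePath T → ℝ) (X ω, v q.1 q.2 ω), hU,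
      Finset.sum_product, Finset.sum_singleton]
    refine Finset.sum_congr rfl fun i _ => ?_
    simp only [Set.indicator_apply, B, Set.mem_ofPred_eq, hrule, Pi.one_apply]
  have e2 : (P.map (G c)).real {y | (X ω, y) ∈ B} =
      P.real {η | lsRule 𝒯 (plugInMethod a) (fun c i => v c i ω) k I p (G c η) ≠ c} := by
    rw [map_measureReal_apply (s := {y | (X ω, y) ∈ B}) (h.measurable c) (measurable_prodMk_left hB)]
    simp only [B, Set.preimage, Set.mem_ofPred_eq, hrule]
  simp only [Set.mem_ofPred_eq, e1, e2]

/-- Almost surely, the error rates of the fitted rules on validation samples approximate their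
risks, uniformly in the dimensions. -/
theorem ae_errorRate_sub_risk (h : IsGaussianSample P P' G v) (𝒯 : SamplingScheme T)
    (a : Fin 2 → Fin 2 → ℝ) {I J : ℕ → Finset ℕ} (hIJ : ∀ k, Disjoint (I k) (J k))
    (hIk : ∀ k, I k ⊆ Finset.range k) {δ : ℝ} (hδ : 0 < δ)
    (hJ : ∀ᶠ k : ℕ in atTop, δ * k ≤ (J k).card) :
    ∀ᵐ ω ∂P', ∀ ε : ℝ, 0 < ε → ∀ᶠ k in atTop, ∀ p : ℕ × ℕ,
      |errorRate (lsRule 𝒯 (plugInMethod a) (fun c i => v c i ω) k (I k) p) (fun c i => v c i ω)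
          (J k) -
        risk P G (lsRule 𝒯 (plugInMethod a) (fun c i => v c i ω) k (I k) p)| ≤ ε := by
  classical
  have hJpos : ∀ᶠ k in atTop, (J k).Nonempty := by
    filter_upwards [hJ, eventually_gt_atTop 0] with k hk hk0
    rw [← Finset.card_pos]
    have : (0 : ℝ) < δ * k := mul_pos hδ (by exact_mod_cast hk0)
    exact_mod_cast this.trans_le hk
  let dev : ℕ → ℕ × ℕ → Fin 2 → Ω' → ℝ := fun k p c ω => |((J k).card : ℝ)⁻¹ * (∑ i ∈ J k,
        if lsRule 𝒯 (plugInMethod a) (fun c i => v c i ω) k (I k) p (v c i ω) ≠ c then (1 : ℝ)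
          else 0) -
        P.real {η | lsRule 𝒯 (plugInMethod a) (fun c i => v c i ω) k (I k) p (G c η) ≠ c}|
  have main : ∀ j : ℕ, ∀ᵐ ω ∂P', ∀ᶠ k in atTop, ∀ p : ℕ × ℕ, p.1 + p.2 ≤ 2 * k → ∀ c,
      dev k p c ω ≤ 1 / ((j : ℝ) + 1) := by
    intro j
    set ε : ℝ := 1 / ((j : ℝ) + 1) with hε
    have hε0 : 0 < ε := by positivity
    -- The constant combines two classes, at most `9 * k ^ 2` pairs of dimensions and the factor two
    -- from Hoeffding's inequality.
    have hb : Summable fun k : ℕ => 36 * ((k : ℝ) ^ 2 * Real.exp (-(2 * δ * ε ^ 2) * (k : ℝ) ^ (1 : ℝ))) :=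
      (summable_sq_mul_exp_neg_rpow (by positivity) one_pos).mul_left _
    set s : ℕ → Set Ω' := fun k =>
      ⋃ q ∈ (Finset.range (2 * k + 1) ×ˢ Finset.range (2 * k + 1)) ×ˢ
        (Finset.univ : Finset (Fin 2)), {ω | ε ≤ dev k q.1 q.2 ω} with hs
    have hsb : ∀ᶠ k : ℕ in atTop, P'.real (s k) ≤
        36 * ((k : ℝ) ^ 2 * Real.exp (-(2 * δ * ε ^ 2) * (k : ℝ) ^ (1 : ℝ))) := by
      filter_upwards [hJ, hJpos, eventually_ge_atTop 1] with k hk hJk hk1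
      have hk1' : (1 : ℝ) ≤ k := by exact_mod_cast hk1
      refine (measureReal_biUnion_finset_le _ _).trans ?_
      refine (Finset.sum_le_card_nsmul _ _ (2 * Real.exp (-(2 * δ * ε ^ 2) * (k : ℝ) ^ (1 : ℝ)))
        fun q _ => ?_).trans ?_
      · refine (measureReal_classErrorRate_deviation_le h 𝒯 a k q.1 q.2 (hIJ k) hJk hε0.le).trans ?_
        rw [Real.rpow_one]
        gcongr
        nlinarith [sq_nonneg ε]
      · simp only [Finset.card_product, Finset.card_range, Finset.card_univ, Fintype.card_fin,
          nsmul_eq_mul]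
        push_cast
        have : (2 * (k : ℝ) + 1) * (2 * k + 1) ≤ 9 * (k : ℝ) ^ 2 := by nlinarith
        have he := Real.exp_pos (-(2 * δ * ε ^ 2) * (k : ℝ) ^ (1 : ℝ))
        nlinarith
    filter_upwards [ae_eventually_notMem_of_summable hb hsb] with ω hω
    filter_upwards [hω] with k hk p hp c
    by_contra hcon
    refine hk (Set.mem_biUnion (x := (p, c)) ?_ (not_le.1 hcon).le)
    simp
    omega
  filter_upwards [ae_all_iff.2 main] with ω hω ε hε
  obtain ⟨j, hj⟩ := exists_nat_one_div_lt hε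
  filter_upwards [hω j, hJpos] with k hk hJk p
  have hcard : ((J k).card : ℝ) ≠ 0 := by exact_mod_cast (Finset.card_pos.2 hJk).ne'
  have hdev : ∀ c, dev k p c ω ≤ 1 / ((j : ℝ) + 1) := by
    intro c
    by_cases hp : p.1 + p.2 ≤ 2 * k
    · exact hk p hp c
    have hIc : (I k).card ≤ k := by simpa using Finset.card_le_card (hIk k)
    -- Beyond `2 * k` dimensions the rule is constant, so in each class the observed and the true
    -- error frequency are both zero or both one.
    have hzero : ∀ x, lsRule 𝒯 (plugInMethod a) (fun c i => v c i ω) k (I k) p x = 0 := fun x =>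
      lsRule_eq_zero_of_card 𝒯 a _ k (by omega) x
    have : dev k p c ω = 0 := by
      simp only [dev, hzero]
      by_cases hc : (0 : Fin 2) = c
      · simp [hc]
      · simp [hc, hcard]
    rw [this]
    positivity
  have e : errorRate (lsRule 𝒯 (plugInMethod a) (fun c i => v c i ω) k (I k) p)
        (fun c i => v c i ω) (J k) -
      risk P G (lsRule 𝒯 (plugInMethod a) (fun c i => v c i ω) k (I k) p) =
      (1 / 2) * ∑ c : Fin 2, (((J k).card : ℝ)⁻¹ * (∑ i ∈ J k,
        if lsRule 𝒯 (plugInMethod a) (fun c i => v c i ω) k (I k) p (v c i ω) ≠ c then (1 : ℝ)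
          else 0) -
        P.real {η | lsRule 𝒯 (plugInMethod a) (fun c i => v c i ω) k (I k) p (G c η) ≠ c}) := by
    unfold errorRate risk
    rw [Finset.sum_sub_distrib, ← Finset.mul_sum, mul_inv]
    ring
  rw [e, abs_mul, Fin.sum_univ_two, abs_of_pos (by norm_num : (0 : ℝ) < 1 / 2)]
  have h0 := hdev 0
  have h1 := hdev 1
  have := abs_add_le _ _ |>.trans (add_le_add h0 h1)
  linarith

end CrossValidation

/-! ### Limits of Gaussian variables -/

section GaussianLimit

variable {Ω : Type*} [MeasurableSpace Ω] {P : Measure Ω} [IsProbabilityMeasure P]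

theorem tendsto_charFun_map {X : ℕ → Ω → ℝ} {Y : Ω → ℝ} (hX : ∀ n, AEMeasurable (X n) P)
    (hY : AEMeasurable Y P) (h : ∀ᵐ ω ∂P, Tendsto (fun n => X n ω) atTop (𝓝 (Y ω))) (t : ℝ) :
    Tendsto (fun n => charFun (P.map (X n)) t) atTop (𝓝 (charFun (P.map Y) t)) := by
  have hc : Continuous fun x : ℝ => Complex.exp (t * x * Complex.I) := by fun_prop
  have e : ∀ Z : Ω → ℝ, AEMeasurable Z P →
      charFun (P.map Z) t = ∫ ω, Complex.exp (t * Z ω * Complex.I) ∂P := fun Z hZ => by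
    rw [charFun_apply_real, integral_map hZ hc.aestronglyMeasurable]
  simp only [e _ (hX _), e _ hY]
  refine tendsto_integral_of_dominated_convergence (fun _ => 1)
    (fun n => (hc.measurable.comp_aemeasurable (hX n)).aestronglyMeasurable)
    (integrable_const _) (fun n => ae_of_all _ fun ω => ?_) ?_
  · have : (t : ℂ) * X n ω * Complex.I = ((t * X n ω : ℝ) : ℂ) * Complex.I := by push_cast; ring
    rw [this, Complex.norm_exp_ofReal_mul_I]
  · filter_upwards [h] with ω hω
    exact (hc.tendsto (Y ω)).comp hω

/-- An almost sure limit of Gaussian variables is square integrable. -/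
theorem memLp_two_of_tendsto_gaussian {X : ℕ → Ω → ℝ} {Y : Ω → ℝ}
    (hX : ∀ n, HasGaussianLaw (X n) P)
    (h : ∀ᵐ ω ∂P, Tendsto (fun n => X n ω) atTop (𝓝 (Y ω))) : MemLp Y 2 P := by
  have hXm : ∀ n, AEMeasurable (X n) P := fun n => (hX n).aemeasurable
  have hYm : AEMeasurable Y P := aemeasurable_of_tendsto_metrizable_ae atTop hXm h
  have hYprob : IsProbabilityMeasure (P.map Y) := Measure.isProbabilityMeasure_map hYm
  -- bounded variances
  obtain ⟨t, ht0, htY⟩ : ∃ t : ℝ, 0 < t ∧ 1 / 2 < ‖charFun (P.map Y) t‖ := by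
    have hcont : Continuous fun t => ‖charFun (P.map Y) t‖ := continuous_charFun.norm
    have h0 : ∀ᶠ t in 𝓝 (0 : ℝ), 1 / 2 < ‖charFun (P.map Y) t‖ :=
      hcont.tendsto 0 |>.eventually (lt_mem_nhds (by simp; norm_num))
    obtain ⟨t, ht⟩ := ((h0.filter_mono nhdsWithin_le_nhds).and
      (self_mem_nhdsWithin (s := Set.Ioi (0 : ℝ)))).exists
    exact ⟨t, ht.2, ht.1⟩
  -- The characteristic function of a normal variable of variance `σ ^ 2` has modulus `exp (-σ ^ 2 *
  -- t ^ 2 / 2)`. Staying above `1 / 2 > exp (-1)` at one `t > 0` bounds the variance.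
  have hvar : ∀ᶠ n in atTop, Var[X n; P] ≤ 2 / t ^ 2 := by
    filter_upwards [(tendsto_charFun_map hXm hYm h t).norm.eventually (lt_mem_nhds htY)] with n hn
    rw [(hX n).map_eq_gaussianReal, charFun_gaussianReal, Complex.norm_exp] at hn
    have hre : ((t : ℂ) * (∫ ω, X n ω ∂P : ℝ) * Complex.I -
        (Var[X n; P].toNNReal : ℂ) * t ^ 2 / 2).re = -(Var[X n; P] * t ^ 2 / 2) := by
      have : ((t : ℂ) * (∫ ω, X n ω ∂P : ℝ) * Complex.I -
        (Var[X n; P].toNNReal : ℂ) * t ^ 2 / 2) = ((t * ∫ ω, X n ω ∂P : ℝ) : ℂ) * Complex.I -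
          ((Var[X n; P] * t ^ 2 / 2 : ℝ) : ℂ) := by
        have h1 : ((Var[X n; P].toNNReal : ℝ) : ℂ) = (Var[X n; P] : ℂ) := by
          rw [Real.coe_toNNReal _ (variance_nonneg _ _)]
        push_cast
        rw [← h1]
      rw [this, Complex.sub_re, Complex.re_ofReal_mul, Complex.I_re, Complex.ofReal_re]
      ring
    rw [hre] at hn
    rw [le_div_iff₀ (by positivity)]
    by_contra! hcon
    have h2 : Real.exp (-(Var[X n; P] * t ^ 2 / 2)) ≤ Real.exp (-1) :=
      Real.exp_le_exp.2 (by linarith)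
    have h3 := Real.exp_neg_one_lt_half
    linarith
  -- bounded means
  set c : ℝ := 4 / t with hc
  have hc0 : 0 < c := by positivity
  obtain ⟨M, hM⟩ : ∃ M : ℕ, P.real {ω | (M : ℝ) < |Y ω|} < 1 / 4 := by
    have h1 : Tendsto (fun M : ℕ => P.real {ω | (M : ℝ) < |Y ω|}) atTop (𝓝 0) := by
      have h2 : Tendsto (fun M : ℕ => ∫ ω, {ω | (M : ℝ) < |Y ω|}.indicator (1 : Ω → ℝ) ω ∂P) atTop
          (𝓝 (∫ _, (0 : ℝ) ∂P)) := by
        refine tendsto_integral_of_dominated_convergence (fun _ => 1) (fun M => ?_)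
          (integrable_const _) (fun M => ae_of_all _ fun ω => ?_) (ae_of_all _ fun ω => ?_)
        · exact (aestronglyMeasurable_const (b := (1 : ℝ))).indicator₀
            (nullMeasurableSet_lt aemeasurable_const hYm.abs)
        · by_cases hω : (M : ℝ) < |Y ω| <;> simp [Set.indicator, hω]
        · refine tendsto_const_nhds.congr' ?_
          filter_upwards [eventually_ge_atTop ⌈|Y ω|⌉₊] with M hM
          have : ¬ (M : ℝ) < |Y ω| := not_lt.2 ((Nat.le_ceil _).trans (by exact_mod_cast hM))
          simp [Set.indicator, this]
      rw [integral_zero] at h2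
      refine h2.congr fun M => ?_
      have hnull : NullMeasurableSet {ω | (M : ℝ) < |Y ω|} P :=
        nullMeasurableSet_lt aemeasurable_const hYm.abs
      rw [integral_indicator₀ hnull]
      simp
    exact (h1.eventually (gt_mem_nhds (by norm_num))).exists
  have hmeasure : ∀ᶠ n in atTop, P.real {ω | 1 ≤ dist (X n ω) (Y ω)} < 1 / 4 := by
    have h1 := tendstoInMeasure_of_tendsto_ae (fun n => (hXm n).aestronglyMeasurable) h
    have h2 := tendstoInMeasure_iff_measureReal_dist.1 h1 1 one_pos
    exact h2.eventually (gt_mem_nhds (by norm_num))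
  have hmean : ∀ᶠ n in atTop, |∫ ω, X n ω ∂P| ≤ M + 1 + c := by
    filter_upwards [hvar, hmeasure] with n hn1 hn2
    have hcheb : P.real {ω | c ≤ |X n ω - ∫ ω, X n ω ∂P|} ≤ 1 / 8 := by
      have h1 := meas_ge_le_variance_div_sq (hX n).memLp_two hc0
      have h2 : Var[X n; P] / c ^ 2 ≤ 1 / 8 := by
        rw [div_le_iff₀ (by positivity)]
        refine hn1.trans (le_of_eq ?_)
        rw [hc]; field_simp; norm_num
      exact ENNReal.toReal_le_of_le_ofReal (by norm_num) (h1.trans (ENNReal.ofReal_le_ofReal h2))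
    have hU : P.real ({ω | (M : ℝ) < |Y ω|} ∪ {ω | 1 ≤ dist (X n ω) (Y ω)} ∪
        {ω | c ≤ |X n ω - ∫ ω, X n ω ∂P|}) < 1 := by
      refine (measureReal_union_le _ _).trans_lt ?_
      have := measureReal_union_le (μ := P) {ω | (M : ℝ) < |Y ω|} {ω | 1 ≤ dist (X n ω) (Y ω)}
      linarith
    -- The exceptional events have total probability below one. At a point outside them the
    -- deterministic mean is within `c` of `X n`, hence bounded.
    obtain ⟨ω, hω⟩ : ∃ ω, ω ∉ {ω | (M : ℝ) < |Y ω|} ∪ {ω | 1 ≤ dist (X n ω) (Y ω)} ∪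
        {ω | c ≤ |X n ω - ∫ ω, X n ω ∂P|} := by
      by_contra! hcon
      rw [Set.eq_univ_of_forall hcon, probReal_univ] at hU
      exact lt_irrefl _ hU
    simp only [Set.mem_union, Set.mem_ofPred_eq, not_or, not_le, not_lt, Real.dist_eq] at hω
    obtain ⟨⟨h1, h2⟩, h3⟩ := hω
    rw [abs_le] at h1 ⊢
    rw [abs_lt] at h2 h3
    constructor <;> linarith [h1.1, h1.2]
  -- Fatou
  have hsq : ∀ᶠ n in atTop, ∫⁻ ω, ENNReal.ofReal (X n ω ^ 2) ∂P ≤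
      ENNReal.ofReal (2 / t ^ 2 + (M + 1 + c) ^ 2) := by
    filter_upwards [hvar, hmean] with n hn1 hn2
    have h2 : Integrable (fun ω => X n ω ^ 2) P := (hX n).memLp_two.integrable_sq
    rw [← ofReal_integral_eq_lintegral_ofReal h2 (ae_of_all _ fun ω => sq_nonneg _)]
    refine ENNReal.ofReal_le_ofReal ?_
    have h3 := variance_eq_sub (hX n).memLp_two
    have h4 : (∫ ω, X n ω ∂P) ^ 2 ≤ (M + 1 + c) ^ 2 := sq_le_sq' (abs_le.1 hn2).1 (abs_le.1 hn2).2
    simp only [Pi.pow_apply] at h3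
    linarith
  have hfatou : ∫⁻ ω, ENNReal.ofReal (Y ω ^ 2) ∂P < ⊤ := by
    calc ∫⁻ ω, ENNReal.ofReal (Y ω ^ 2) ∂P
        = ∫⁻ ω, liminf (fun n => ENNReal.ofReal (X n ω ^ 2)) atTop ∂P := by
          refine lintegral_congr_ae ?_
          filter_upwards [h] with ω hω
          exact (((ENNReal.continuous_ofReal.tendsto _).comp (hω.pow 2)).liminf_eq).symm
      _ ≤ liminf (fun n => ∫⁻ ω, ENNReal.ofReal (X n ω ^ 2) ∂P) atTop :=
          lintegral_liminf_le' fun n => ((hXm n).pow_const 2).ennreal_ofReal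
      _ ≤ ENNReal.ofReal (2 / t ^ 2 + (M + 1 + c) ^ 2) :=
          liminf_le_of_frequently_le' hsq.frequently
      _ < ⊤ := ENNReal.ofReal_lt_top
  rw [memLp_two_iff_integrable_sq hYm.aestronglyMeasurable]
  refine ⟨(hYm.pow_const 2).aestronglyMeasurable, ?_⟩
  rw [hasFiniteIntegral_iff_ofReal (ae_of_all _ fun ω => sq_nonneg _)]
  exact hfatou

end GaussianLimit

/-! ### Covariance matrices of the transformed observations -/

section Covariance

variable {Ω : Type*} [MeasurableSpace Ω] {P : Measure Ω} [IsProbabilityMeasure P] {T : ℝ}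
  {G : Fin 2 → Ω → SamplePath T}

omit [IsProbabilityMeasure P] in
-- Each coordinate of the transform is a linear combination of finitely many path values, with
-- coefficients that do not depend on the class.
theorem lsCov_eq_of_covariance_eq (hG : ∀ c, IsGaussianProcess (fun t ω => G c ω t) P)
    {c c' : Fin 2} (h : ∀ s t : Set.Icc (0 : ℝ) T, cov[fun ω => G c ω s, fun ω => G c ω t; P] =
      cov[fun ω => G c' ω s, fun ω => G c' ω t; P]) (𝒯 : SamplingScheme T) (k : ℕ) (p : ℕ × ℕ) :
    lsCov P G 𝒯 k p c = lsCov P G 𝒯 k p c' := by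
  ext q q'
  obtain ⟨w, hw⟩ := exists_linearCombination_lsPath 𝒯 k p q
  obtain ⟨w', hw'⟩ := exists_linearCombination_lsPath 𝒯 k p q'
  have hprob := (hG c).isProbabilityMeasure
  have hexp : ∀ c, lsCov P G 𝒯 k p c q q' = ∑ s ∈ w.support, ∑ t ∈ w'.support,
      w' t * (w s * cov[fun ω => G c ω s, fun ω => G c ω t; P]) := by
    intro c
    have hL : ∀ t, MemLp (fun ω => G c ω t) 2 P := fun t => ((hG c).hasGaussianLaw_eval t).memLp_two
    change cov[fun ω => lsPath 𝒯 k p (G c ω) q, fun ω => lsPath 𝒯 k p (G c ω) q'; P] = _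
    simp only [hw, hw', Finsupp.linearCombination_apply, Finsupp.sum, smul_eq_mul]
    rw [covariance_fun_sum_fun_sum' (fun s _ => (hL s).const_mul (w s))
      (fun t _ => (hL t).const_mul (w' t))]
    simp only [covariance_const_mul_left, covariance_const_mul_right]
  simp only [hexp, h]

/-- The location transforms at late stages have nonsingular covariance matrices. -/
theorem lsCov_det_ne_zero_eventually (hT : 0 < T)
    (hG : ∀ c, IsGaussianProcess (fun t ω => G c ω t) P) (hcont : ∀ c, ∀ᵐ ω ∂P, Continuous (G c ω))
    {c : Fin 2} (hns : HasNonsingularLocations P hT.le (G c)) (𝒯 : SamplingScheme T) {L : ℕ}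
    (hL : 1 ≤ L) : ∀ᶠ k in atTop, (lsCov P G 𝒯 k (L, 0) c).det ≠ 0 := by
  by_contra hcon
  have hfreq : ∃ᶠ k in atTop, (lsCov P G 𝒯 k (L, 0) c).det = 0 := by
    simpa [Filter.Frequently] using hcon
  obtain ⟨φ, hφ, hdet⟩ := extraction_of_frequently_atTop hfreq
  -- the limit
  set z : Ω → Fin L ⊕ Fin 0 → ℝ := fun ω => Sum.elim (pathLocation hT.le L (G c ω)) Fin.elim0
    with hz
  have hlim : ∀ᵐ ω ∂P, Tendsto (fun k => lsPath 𝒯 k (L, 0) (G c ω)) atTop (𝓝 (z ω)) := by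
    filter_upwards [hcont c] with ω hω
    rw [tendsto_pi_nhds]
    rintro (i | i)
    · exact lsPath_tendsto_pathLocation hT 𝒯 hω L i
    · exact i.elim0
  have hzL : ∀ i, MemLp (fun ω => z ω i) 2 P := fun i =>
    memLp_two_of_tendsto_gaussian (X := fun k ω => lsPath 𝒯 k (L, 0) (G c ω) i)
      (fun k => (hasGaussianLaw_lsPath (hG c) 𝒯 k (L, 0)).eval i)
      (hlim.mono fun ω hω => (tendsto_pi_nhds.1 hω) i)
  -- unit vectors in the kernels
  have hker : ∀ n, ∃ u : Fin L ⊕ Fin 0 → ℝ, u ∈ Metric.sphere (0 : Fin L ⊕ Fin 0 → ℝ) 1 ∧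
      ∃ r : ℝ, ∀ᵐ ω ∂P, u ⬝ᵥ lsPath 𝒯 (φ n) (L, 0) (G c ω) = r := by
    intro n
    obtain ⟨u, hu0, hu⟩ := Matrix.exists_mulVec_eq_zero_iff.2 (hdet n)
    have hnorm : ‖u‖ ≠ 0 := norm_ne_zero_iff.2 hu0
    have hu' : (lsCov P G 𝒯 (φ n) (L, 0) c).mulVec (‖u‖⁻¹ • u) = 0 := by
      rw [Matrix.mulVec_smul, hu, smul_zero]
    refine ⟨‖u‖⁻¹ • u, by simp [norm_smul, hnorm], _, ae_eq_of_covMatrix_mulVec_eq_zero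
      (memLp_coord (hasGaussianLaw_lsPath (hG c) 𝒯 (φ n) (L, 0))) hu'⟩
  choose u hu r hr using hker
  obtain ⟨u', hu', χ, hχ, hlimu⟩ := (isCompact_sphere (0 : Fin L ⊕ Fin 0 → ℝ) 1).tendsto_subseq hu
  -- The projection of the limiting vector on `u'` is an almost sure limit of constants, hence
  -- constant. This replaces convergence of the covariance matrices.
  have hconst : ∀ᵐ ω ∂P, Tendsto (fun n => r (χ n)) atTop (𝓝 (u' ⬝ᵥ z ω)) := by
    filter_upwards [hlim, ae_all_iff.2 hr] with ω hω hrω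
    have h1 : Tendsto (fun n => lsPath 𝒯 (φ (χ n)) (L, 0) (G c ω)) atTop (𝓝 (z ω)) :=
      hω.comp (hφ.comp hχ).tendsto_atTop
    have h2 : Tendsto (fun n => u (χ n) ⬝ᵥ lsPath 𝒯 (φ (χ n)) (L, 0) (G c ω)) atTop
        (𝓝 (u' ⬝ᵥ z ω)) :=
      tendsto_finsetSum _ fun i _ => ((tendsto_pi_nhds.1 hlimu) i).mul ((tendsto_pi_nhds.1 h1) i)
    exact h2.congr fun n => hrω _
  obtain ⟨ω₀, hω₀⟩ := hconst.exists
  have hae : ∀ᵐ ω ∂P, u' ⬝ᵥ z ω = u' ⬝ᵥ z ω₀ := hconst.mono fun ω hω => tendsto_nhds_unique hω hω₀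
  have hsing : (covMatrix P z).mulVec u' = 0 := by
    ext i
    have h1 := covariance_dotProduct hzL (Pi.single i 1) u'
    rw [single_dotProduct, one_mul] at h1
    have hE : ∫ ω, u' ⬝ᵥ z ω ∂P = u' ⬝ᵥ z ω₀ := by
      rw [integral_congr_ae hae]; simp
    rw [← h1, covariance, hE, Pi.zero_apply]
    refine integral_eq_zero_of_ae (hae.mono fun ω hω => ?_)
    simp [hω]
  have hu'0 : u' ≠ 0 := by
    rintro rfl
    simp at hu'
  refine hns L hL (Matrix.exists_mulVec_eq_zero_iff.1 ⟨fun i => u' (Sum.inl i), ?_, ?_⟩)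
  · intro h0
    refine hu'0 (funext ?_)
    rintro (i | i)
    · exact congrFun h0 i
    · exact i.elim0
  · ext i
    have := congrFun hsing (Sum.inl i)
    simpa [Matrix.mulVec, dotProduct, covMatrix, Fintype.sum_sum_type, hz] using this

end Covariance

/-! ### Approximation of the Bayes risk -/

section Approximation

variable {Ω : Type*} [MeasurableSpace Ω] {P : Measure Ω} [IsFiniteMeasure P] {T : ℝ}
  {G : Fin 2 → Ω → SamplePath T}

omit [IsFiniteMeasure P] in
theorem risk_nonneg (g : SamplePath T → Fin 2) : 0 ≤ risk P G g :=
  mul_nonneg (by norm_num) (Finset.sum_nonneg fun _ _ => measureReal_nonneg)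

omit [IsFiniteMeasure P] in
theorem bayesRisk_le_risk {g : SamplePath T → Fin 2} (hg : Measurable g) :
    bayesRisk P G ≤ risk P G g :=
  ciInf_le (f := fun g : {g : SamplePath T → Fin 2 // Measurable g} => risk P G g)
    ⟨0, by rintro _ ⟨g, rfl⟩; exact risk_nonneg _⟩ ⟨g, hg⟩

omit [IsFiniteMeasure P] in
theorem risk_eq_softRisk (hG : ∀ c, Measurable (G c)) {g : SamplePath T → Fin 2}
    (hg : Measurable g) : risk P G g = softRisk P G ({x | g x = 1}.indicator 1) := by
  have hA : MeasurableSet {x | g x = 1} := hg (measurableSet_singleton 1)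
  have e0 : P.real {ω | g (G 0 ω) ≠ 0} = ∫ ω, {x | g x = 1}.indicator (1 : SamplePath T → ℝ)
      (G 0 ω) ∂P := by
    rw [← integral_indicator_one (s := {ω | g (G 0 ω) ≠ 0})]
    · refine integral_congr_ae (ae_of_all _ fun ω => ?_)
      simp only [Set.indicator_apply, Set.mem_ofPred_eq, fin_two_ne_zero_iff, Pi.one_apply]
    · exact (hg.comp (hG 0)) (measurableSet_singleton 0).compl
  have e1 : P.real {ω | g (G 1 ω) ≠ 1} = ∫ ω, (1 - {x | g x = 1}.indicator (1 : SamplePath T → ℝ)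
      (G 1 ω)) ∂P := by
    rw [← integral_indicator_one (s := {ω | g (G 1 ω) ≠ 1})]
    · refine integral_congr_ae (ae_of_all _ fun ω => ?_)
      by_cases h : g (G 1 ω) = 1 <;> simp [Set.indicator, h]
    · exact (hg.comp (hG 1)) (measurableSet_singleton 1).compl
  rw [risk, softRisk, Fin.sum_univ_two, e0, e1]

/-- The risk of a randomized rule is Lipschitz for the `L¹` distance with respect to the sum of the
two path laws, so density results in `L¹` transfer to risks. -/
theorem softRisk_le_add (hG : ∀ c, Measurable (G c)) {φ φ' : SamplePath T → ℝ}
    (hφ : Measurable φ) (hφ' : Measurable φ') (hφI : ∀ x, φ x ∈ Set.Icc (0 : ℝ) 1)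
    (hφI' : ∀ x, φ' x ∈ Set.Icc (0 : ℝ) 1) :
    softRisk P G φ ≤ softRisk P G φ' + ∫ x, |φ x - φ' x| ∂(P.map (G 0) + P.map (G 1)) := by
  have hb : ∀ {f : SamplePath T → ℝ}, Measurable f → (∀ x, f x ∈ Set.Icc (0 : ℝ) 1) → ∀ c,
      Integrable (fun ω => f (G c ω)) P := fun hf hI c =>
    Integrable.of_bound (hf.comp (hG c)).aestronglyMeasurable 1
      (ae_of_all _ fun ω => by rw [Real.norm_eq_abs, abs_le]; constructor <;> linarith [(hI (G c ω)).1, (hI (G c ω)).2])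
  have i := hb hφ hφI
  have i' := hb hφ' hφI'
  have hd : ∀ c, Integrable (fun ω => |φ (G c ω) - φ' (G c ω)|) P := fun c =>
    ((i c).sub (i' c)).abs
  have hm : Measurable fun x => |φ x - φ' x| := (hφ.sub hφ').abs
  have hmap : ∀ c, ∫ x, |φ x - φ' x| ∂P.map (G c) = ∫ ω, |φ (G c ω) - φ' (G c ω)| ∂P := fun c =>
    integral_map (hG c).aemeasurable hm.aestronglyMeasurable
  have hmi : ∀ c, Integrable (fun x => |φ x - φ' x|) (P.map (G c)) := fun c =>
    (integrable_map_measure hm.aestronglyMeasurable (hG c).aemeasurable).2 (hd c)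
  rw [integral_add_measure (hmi 0) (hmi 1), hmap, hmap]
  have h0 : ∫ ω, φ (G 0 ω) ∂P ≤ ∫ ω, φ' (G 0 ω) ∂P + ∫ ω, |φ (G 0 ω) - φ' (G 0 ω)| ∂P := by
    rw [← integral_add (i' 0) (hd 0)]
    exact integral_mono (i 0) ((i' 0).add (hd 0)) fun ω => by
      simp only
      linarith [le_abs_self (φ (G 0 ω) - φ' (G 0 ω))]
  have h1 : ∫ ω, (1 - φ (G 1 ω)) ∂P ≤
      ∫ ω, (1 - φ' (G 1 ω)) ∂P + ∫ ω, |φ (G 1 ω) - φ' (G 1 ω)| ∂P := by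
    have j : ∀ {f : Ω → ℝ}, Integrable f P → Integrable (fun ω => 1 - f ω) P :=
      fun hf => (integrable_const _).sub hf
    rw [← integral_add (j (i' 1)) (hd 1)]
    exact integral_mono (j (i 1)) ((j (i' 1)).add (hd 1)) fun ω => by
        simp only
        linarith [neg_abs_le (φ (G 1 ω) - φ' (G 1 ω))]
  have p0 : 0 ≤ ∫ ω, |φ (G 0 ω) - φ' (G 0 ω)| ∂P := integral_nonneg fun _ => abs_nonneg _
  have p1 : 0 ≤ ∫ ω, |φ (G 1 ω) - φ' (G 1 ω)| ∂P := integral_nonneg fun _ => abs_nonneg _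
  unfold softRisk
  linarith

theorem tendsto_softRisk {φ : ℕ → SamplePath T → ℝ} {φ' : SamplePath T → ℝ}
    (hφ : ∀ n c, AEStronglyMeasurable (fun ω => φ n (G c ω)) P)
    (hφI : ∀ n x, φ n x ∈ Set.Icc (0 : ℝ) 1)
    (h : ∀ c, ∀ᵐ ω ∂P, Tendsto (fun n => φ n (G c ω)) atTop (𝓝 (φ' (G c ω)))) :
    Tendsto (fun n => softRisk P G (φ n)) atTop (𝓝 (softRisk P G φ')) := by
  refine ((tendsto_integral_of_dominated_convergence (fun _ => 1) (fun n => hφ n 0)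
    (integrable_const _) (fun n => ae_of_all _ fun ω => ?_) (h 0)).add
    (tendsto_integral_of_dominated_convergence (fun _ => 1)
    (fun n => aestronglyMeasurable_const.sub (hφ n 1))
    (integrable_const _) (fun n => ae_of_all _ fun ω => ?_)
    ((h 1).mono fun ω hω => tendsto_const_nhds.sub hω))).const_mul _
  · rw [Real.norm_eq_abs, abs_le]
    constructor <;> linarith [(hφI n (G 0 ω)).1, (hφI n (G 0 ω)).2]
  · rw [Real.norm_eq_abs, abs_le]
    simp only [Pi.sub_apply]
    constructor <;> linarith [(hφI n (G 1 ω)).1, (hφI n (G 1 ω)).2]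

/-- Clipping to the unit interval is nonexpansive and fixes `r`. -/
theorem abs_clip_sub_le {r : ℝ} (hr : r ∈ Set.Icc (0 : ℝ) 1) (y : ℝ) :
    |max 0 (min 1 y) - r| ≤ |r - y| := by
  obtain ⟨h0, h1⟩ := hr
  rw [abs_le]
  rcases le_total y 0 with hy | hy
  · rw [min_eq_right (hy.trans zero_le_one), max_eq_left hy]
    constructor <;> linarith [le_abs_self (r - y), abs_nonneg (r - y)]
  · rw [max_eq_right (le_min zero_le_one hy)]
    rcases le_total y 1 with hy1 | hy1
    · rw [min_eq_right hy1]
      constructor <;> linarith [le_abs_self (r - y), neg_abs_le (r - y)]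
    · rw [min_eq_left hy1]
      constructor <;> linarith [neg_abs_le (r - y), abs_nonneg (r - y)]

open scoped symmDiff in
/-- Randomized rules that depend continuously on the values at finitely many points are nearly
optimal. -/
theorem exists_continuous_softRisk_le (hG : ∀ c, Measurable (G c)) {ε : ℝ} (hε : 0 < ε) :
    ∃ (F : Finset (Set.Icc (0 : ℝ) T)) (φ : (F → ℝ) → ℝ), Continuous φ ∧
      (∀ z, φ z ∈ Set.Icc (0 : ℝ) 1) ∧
      softRisk P G (fun x => φ (F.restrict x)) ≤ bayesRisk P G + ε := by
  have hne : Nonempty {g : SamplePath T → Fin 2 // Measurable g} := ⟨⟨fun _ => 0, measurable_const⟩⟩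
  obtain ⟨⟨g, hg⟩, hgR⟩ := exists_lt_of_ciInf_lt
    (show bayesRisk P G < bayesRisk P G + ε / 3 by linarith)
  simp only at hgR
  set μ : Measure (SamplePath T) := P.map (G 0) + P.map (G 1) with hμ
  set A : Set (SamplePath T) := {x | g x = 1} with hA
  have hAm : MeasurableSet A := hg (measurableSet_singleton 1)
  -- Cylinder sets form an algebra generating the product σ-algebra, hence approximate every
  -- measurable set under a finite measure.
  obtain ⟨B, hB, hAB⟩ := (Measure.MeasureDense.of_generateFrom_isSetAlgebra_finite (μ := μ)
    (isSetAlgebra_measurableCylinders (α := fun _ : Set.Icc (0 : ℝ) T => ℝ))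
    generateFrom_measurableCylinders.symm).approx A hAm (measure_ne_top _ _) (ε / 3) (by positivity)
  obtain ⟨F, S, hS, rfl⟩ := (mem_measurableCylinders B).1 hB
  have hFm : Measurable (F.restrict : SamplePath T → F → ℝ) := Finset.measurable_restrict F
  -- On the finite-dimensional marginal, bounded continuous functions are dense in `L¹`; clipping
  -- then makes the approximation a randomized rule.
  obtain ⟨f, hf, -⟩ := Integrable.exists_boundedContinuous_integral_sub_le
    (μ := μ.map F.restrict) (f := S.indicator (1 : (F → ℝ) → ℝ))
    ((integrable_const (1 : ℝ)).indicator hS) (show 0 < ε / 3 by positivity)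
  set φ : (F → ℝ) → ℝ := fun z => max 0 (min 1 (f z)) with hφ
  have hφc : Continuous φ := by
    have := f.continuous
    fun_prop
  have hφI : ∀ z, φ z ∈ Set.Icc (0 : ℝ) 1 := fun z =>
    ⟨le_max_left _ _, max_le zero_le_one (min_le_left _ _)⟩
  have hindI : ∀ {X : Type _} (s : Set X) (x : X), s.indicator (1 : X → ℝ) x ∈ Set.Icc (0 : ℝ) 1 :=
    fun s x => ⟨Set.indicator_nonneg (fun _ _ => zero_le_one) x,
      Set.indicator_le_self' (fun _ _ => zero_le_one) x⟩
  have hBm : MeasurableSet (cylinder F S : Set (SamplePath T)) := hS.cylinder F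
  refine ⟨F, φ, hφc, hφI, ?_⟩
  have h1 := softRisk_le_add (P := P) hG (φ := fun x => φ (F.restrict x))
    (φ' := (cylinder F S).indicator 1) (hφc.measurable.comp hFm) (measurable_one.indicator hBm)
    (fun x => hφI _) (hindI _)
  have h2 := softRisk_le_add (P := P) hG (φ := (cylinder F S).indicator 1)
    (φ' := A.indicator 1) (measurable_one.indicator hBm) (measurable_one.indicator hAm)
    (hindI _) (hindI _)
  rw [← risk_eq_softRisk hG hg] at h2
  have h3 : ∫ x, |φ (F.restrict x) - (cylinder F S).indicator (1 : SamplePath T → ℝ) x| ∂μ ≤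
      ε / 3 := by
    refine le_trans ?_ hf
    have hm : Measurable fun z => ‖S.indicator (1 : (F → ℝ) → ℝ) z - f z‖ :=
      ((measurable_one.indicator hS).sub f.continuous.measurable).norm
    rw [integral_map hFm.aemeasurable hm.aestronglyMeasurable]
    have hint : Integrable (fun x => ‖S.indicator (1 : (F → ℝ) → ℝ) (F.restrict x) -
        f (F.restrict x)‖) μ := by
      refine Integrable.of_bound (hm.comp hFm).aestronglyMeasurable (1 + ‖f‖)
        (ae_of_all _ fun x => ?_)
      rw [norm_norm]
      refine (norm_sub_le _ _).trans (add_le_add ?_ (f.norm_coe_le_norm _))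
      rw [Real.norm_eq_abs, abs_of_nonneg (hindI _ _).1]
      exact (hindI _ _).2
    refine integral_mono_of_nonneg (ae_of_all _ fun _ => abs_nonneg _) hint
      (ae_of_all _ fun x => ?_)
    change |max 0 (min 1 (f (F.restrict x))) - S.indicator (1 : (F → ℝ) → ℝ) (F.restrict x)| ≤
      |S.indicator (1 : (F → ℝ) → ℝ) (F.restrict x) - f (F.restrict x)|
    exact abs_clip_sub_le (hindI S (F.restrict x)) _
  have h4 : ∫ x, |(cylinder F S).indicator (1 : SamplePath T → ℝ) x - A.indicator 1 x| ∂μ ≤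
      ε / 3 := by
    have e : ∀ x, |(cylinder F S).indicator (1 : SamplePath T → ℝ) x - A.indicator 1 x| =
        (A ∆ cylinder F S).indicator 1 x := by
      intro x
      by_cases hx : x ∈ A <;> by_cases hx' : x ∈ (cylinder F S : Set (SamplePath T)) <;>
        simp [Set.mem_symmDiff, hx, hx', -mem_cylinder]
    simp only [e]
    rw [integral_indicator_one (hAm.symmDiff hBm)]
    exact ENNReal.toReal_le_of_le_ofReal (by positivity) hAB.le
  linarith

/-! ### Recovering a path from its local averages -/

/-- The index of one of the `L + 1` subintervals that contains `s`. -/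
noncomputable def locationIndex (T : ℝ) (L : ℕ) (s : ℝ) : Fin (L + 1) :=
  -- The minimum matters at `s = T`, where the floor would be `L + 1`.
  ⟨min ⌊s * (L + 1) / T⌋₊ L, by omega⟩

theorem locationIndex_le (hT : 0 < T) (L : ℕ) {s : ℝ} (hs : s ∈ Set.Icc 0 T) :
    T * (locationIndex T L s : ℕ) / ((L + 1 : ℕ) : ℝ) ≤ s ∧
      s ≤ T * ((locationIndex T L s : ℕ) + 1) / ((L + 1 : ℕ) : ℝ) := by
  have hL : (0 : ℝ) < ((L + 1 : ℕ) : ℝ) := by positivity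
  have h0 : 0 ≤ s * (L + 1) / T := by have := hs.1; positivity
  set y : ℝ := s * (L + 1) / T with hy
  have e : s * (L + 1) = T * y := by rw [hy]; field_simp
  have hi : (locationIndex T L s : ℕ) = min ⌊y⌋₊ L := rfl
  rw [div_le_iff₀ hL, le_div_iff₀ hL, hi]
  push_cast
  rw [e]
  constructor
  · refine mul_le_mul_of_nonneg_left ((min_le_left _ _).trans (Nat.floor_le h0)) hT.le
  · refine mul_le_mul_of_nonneg_left ?_ hT.le
    rcases le_total ⌊y⌋₊ L with h | h
    · rw [min_eq_left (by exact_mod_cast h)]; exact (Nat.lt_floor_add_one _).le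
    · rw [min_eq_right (by exact_mod_cast h), hy, div_le_iff₀ hT]
      nlinarith [hs.2]

/-- The factor `(L + 1) / T` turns the integral into a mean over an interval that contains `s` and
shrinks to it; uniform continuity does the rest. -/
theorem pathLocation_tendsto (hT : 0 < T) {x : SamplePath T} (hx : Continuous x)
    (s : Set.Icc (0 : ℝ) T) :
    Tendsto (fun L : ℕ => ((L + 1 : ℕ) : ℝ) / T *
      pathLocation hT.le (L + 1) x (locationIndex T L s)) atTop (𝓝 (x s)) := by
  rw [Metric.tendsto_nhds]
  intro η hη
  have huc : UniformContinuous x := CompactSpace.uniformContinuous_of_continuous hx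
  obtain ⟨δ, hδ, hxδ⟩ := Metric.uniformContinuous_iff.1 huc (η / 2) (by positivity)
  have hlim : Tendsto (fun L : ℕ => T / ((L + 1 : ℕ) : ℝ)) atTop (𝓝 0) :=
    (tendsto_const_div_atTop_nhds_zero_nat T).comp (tendsto_add_atTop_nat 1)
  filter_upwards [hlim.eventually (gt_mem_nhds hδ)] with L hLδ
  have hL : (0 : ℝ) < ((L + 1 : ℕ) : ℝ) := by positivity
  set i := locationIndex T L s with hi
  set a := T * ((i : ℕ) : ℝ) / ((L + 1 : ℕ) : ℝ) with ha
  set b := T * (((i : ℕ) : ℝ) + 1) / ((L + 1 : ℕ) : ℝ) with hb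
  have hab : b - a = T / ((L + 1 : ℕ) : ℝ) := by rw [ha, hb]; ring
  obtain ⟨has, hsb⟩ := locationIndex_le hT L s.2
  have haI : a ∈ Set.Icc 0 T := grid_mem_Icc hT.le i.2.le (Nat.succ_pos L)
  have hbI : b ∈ Set.Icc 0 T := by
    have := grid_mem_Icc hT.le (T := T) (i.2 : (i : ℕ) + 1 ≤ L + 1) (Nat.succ_pos L)
    rwa [Nat.cast_add_one (i : ℕ)] at this
  have hcont : Continuous (Set.IccExtend hT.le x) := hx.Icc_extend' (h := hT.le)
  have hint : (∫ r in a..b, Set.IccExtend hT.le x r) - T / ((L + 1 : ℕ) : ℝ) * x s =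
      ∫ r in a..b, (Set.IccExtend hT.le x r - x s) := by
    rw [intervalIntegral.integral_sub (hcont.intervalIntegrable _ _)
      intervalIntegrable_const, intervalIntegral.integral_const, hab, smul_eq_mul]
  have hle : a ≤ b := by linarith
  have hbound := intervalIntegral.norm_integral_le_of_norm_le_const (a := a) (b := b) (C := η / 2)
    (f := fun r => Set.IccExtend hT.le x r - x s) fun r hr => by
      rw [Set.uIoc_of_le hle] at hr
      have hrI : r ∈ Set.Icc 0 T := ⟨haI.1.trans hr.1.le, hr.2.trans hbI.2⟩
      rw [Set.IccExtend_of_mem hT.le x hrI]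
      refine (hxδ (show dist (⟨r, hrI⟩ : Set.Icc 0 T) s < δ from ?_)).le
      rw [Subtype.dist_eq, Real.dist_eq]
      refine lt_of_le_of_lt ?_ hLδ
      rw [abs_le]
      change a ≤ s at has
      change (s : ℝ) ≤ b at hsb
      constructor <;> linarith [hr.1, hr.2]
  rw [← hint, abs_of_nonneg (by linarith : 0 ≤ b - a), hab] at hbound
  rw [Real.dist_eq]
  have e : ((L + 1 : ℕ) : ℝ) / T * pathLocation hT.le (L + 1) x i - x s =
      ((L + 1 : ℕ) : ℝ) / T *
        ((∫ r in a..b, Set.IccExtend hT.le x r) - T / ((L + 1 : ℕ) : ℝ) * x s) := by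
    change ((L + 1 : ℕ) : ℝ) / T * (∫ r in a..b, Set.IccExtend hT.le x r) - x s = _
    field_simp
  rw [e, abs_mul, abs_of_pos (by positivity)]
  calc ((L + 1 : ℕ) : ℝ) / T * _ ≤ ((L + 1 : ℕ) : ℝ) / T * (η / 2 * (T / ((L + 1 : ℕ) : ℝ))) := by
        gcongr
        exact hbound
    _ = η / 2 := by field_simp
    _ < η := by linarith

/-- Some randomized rule based on a location transform of fixed dimension is nearly optimal at all
late stages. -/
theorem exists_location_softRisk_le (hT : 0 < T) (hG : ∀ c, Measurable (G c))
    (hcont : ∀ c, ∀ᵐ ω ∂P, Continuous (G c ω)) (𝒯 : SamplingScheme T) {ε : ℝ} (hε : 0 < ε) :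
    ∃ L : ℕ, 1 ≤ L ∧ ∃ ψ : (Fin L ⊕ Fin 0 → ℝ) → ℝ, Measurable ψ ∧ (∀ z, 0 ≤ ψ z) ∧
      (∀ z, ψ z ≤ 1) ∧ ∀ᶠ k in atTop,
        softRisk P G (fun x => ψ (lsPath 𝒯 k (L, 0) x)) ≤ bayesRisk P G + ε := by
  obtain ⟨F, φ, hφ, hφI, hφR⟩ := exists_continuous_softRisk_le (P := P) hG
    (show 0 < ε / 2 by positivity)
  let q : ∀ L : ℕ, (Fin (L + 1) ⊕ Fin 0 → ℝ) → F → ℝ := fun L z s =>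
    ((L + 1 : ℕ) : ℝ) / T * z (Sum.inl (locationIndex T L s))
  have hq : ∀ L, Continuous (q L) := fun L => by fun_prop
  let loc : ∀ L : ℕ, SamplePath T → Fin L ⊕ Fin 0 → ℝ := fun L x =>
    Sum.elim (pathLocation hT.le L x) Fin.elim0
  have hloc : ∀ L, ∀ c, ∀ᵐ ω ∂P,
      Tendsto (fun k => lsPath 𝒯 k (L, 0) (G c ω)) atTop (𝓝 (loc L (G c ω))) := by
    intro L c
    filter_upwards [hcont c] with ω hω
    rw [tendsto_pi_nhds]
    rintro (i | i)
    · exact lsPath_tendsto_pathLocation hT 𝒯 hω L i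
    · exact i.elim0
  have hstage : ∀ L, Tendsto (fun k => softRisk P G fun x => φ (q L (lsPath 𝒯 k (L + 1, 0) x)))
      atTop (𝓝 (softRisk P G fun x => φ (q L (loc (L + 1) x)))) := by
    intro L
    refine tendsto_softRisk (fun k c => ?_) (fun _ _ => hφI _) fun c => ?_
    · exact ((hφ.comp (hq L)).measurable.comp
        ((measurable_lsPath 𝒯 k (L + 1, 0)).comp (hG c))).aestronglyMeasurable
    · filter_upwards [hloc (L + 1) c] with ω hω
      exact ((hφ.comp (hq L)).tendsto _).comp hω
  have hdim : Tendsto (fun L => softRisk P G fun x => φ (q L (loc (L + 1) x))) atTop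
      (𝓝 (softRisk P G fun x => φ (F.restrict x))) := by
    refine tendsto_softRisk (fun L c => ?_) (fun _ _ => hφI _) fun c => ?_
    · have : AEMeasurable (fun ω => loc (L + 1) (G c ω)) P :=
        aemeasurable_of_tendsto_metrizable_ae atTop
          (fun k => ((measurable_lsPath 𝒯 k (L + 1, 0)).comp (hG c)).aemeasurable) (hloc (L + 1) c)
      exact ((hφ.comp (hq L)).measurable.comp_aemeasurable this).aestronglyMeasurable
    · filter_upwards [hcont c] with ω hω
      refine (hφ.tendsto _).comp (tendsto_pi_nhds.2 fun s => ?_)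
      exact pathLocation_tendsto hT hω s
  -- The dimension is fixed first, by means of unsampled local averages; only then does the stage
  -- tend to infinity.
  obtain ⟨L, hL⟩ := (hdim.eventually
    (gt_mem_nhds (show _ < bayesRisk P G + ε by linarith))).exists
  refine ⟨L + 1, by omega, fun z => φ (q L z), (hφ.comp (hq L)).measurable,
    fun z => (hφI _).1, fun z => (hφI _).2, ?_⟩
  exact ((hstage L).eventually (gt_mem_nhds hL)).mono fun k hk => hk.le

end Approximation

/-! ### Bayes optimality of the fitted rules -/

section Optimal

variable {Ω Ω' : Type*} [MeasurableSpace Ω] [MeasurableSpace Ω'] {T : ℝ}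
  {P : Measure Ω} [IsProbabilityMeasure P] {P' : Measure Ω'} [IsProbabilityMeasure P']
  {G : Fin 2 → Ω → SamplePath T} {v : Fin 2 → ℕ → Ω' → SamplePath T}

/-- For suitable fixed dimensions the fitted rules are nearly optimal. -/
theorem exists_ae_risk_location_le (hT : 0 < T) (h : IsGaussianSample P P' G v)
    (hcont : ∀ c, ∀ᵐ ω ∂P, Continuous (G c ω)) (hns : ∀ c, HasNonsingularLocations P hT.le (G c))
    (𝒯 : SamplingScheme T) {a : Fin 2 → Fin 2 → ℝ} (ha : ∀ c c', 0 ≤ a c c')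
    (ha1 : ∀ c, ∑ c', a c c' = 1)
    (hcov : ∀ c c', a c c' ≠ 0 → ∀ k p, lsCov P G 𝒯 k p c' = lsCov P G 𝒯 k p c) {ε : ℝ}
    (hε : 0 < ε) :
    ∃ L : ℕ, 1 ≤ L ∧ ∀ (I : ℕ → Finset ℕ) (δ : ℝ), 0 < δ →
      (∀ᶠ k : ℕ in atTop, δ * k ≤ (I k).card) → ∀ᵐ ω ∂P', ∀ᶠ k in atTop,
        risk P G (lsRule 𝒯 (plugInMethod a) (fun c i => v c i ω) k (I k) (L, 0)) ≤
          bayesRisk P G + ε := by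
  obtain ⟨L, hL, ψ, hψm, hψ0, hψ1, hψ⟩ := exists_location_softRisk_le (P := P) hT h.measurable hcont
    𝒯 (half_pos hε)
  refine ⟨L, hL, fun I δ hδ hI => ?_⟩
  -- A constant dimension lies below any positive power of `k`; the power `1 / 4` is one admissible
  -- choice below `1 / 2`.
  have hD : ∀ᶠ k : ℕ in atTop, (((fun _ => L) k : ℕ) : ℝ) ≤ (k : ℝ) ^ (1 / 4 : ℝ) :=
    ((tendsto_rpow_atTop (by norm_num : (0 : ℝ) < 1 / 4)).comp
      tendsto_natCast_atTop_atTop).eventually (eventually_ge_atTop (L : ℝ))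
  filter_upwards [ae_risk_le_softRisk h 𝒯 ha ha1 hcov hδ (by norm_num : (1 / 4 : ℝ) < 1 / 2) hI hD]
    with ω hω
  have hdet := eventually_all.2 fun c => lsCov_det_ne_zero_eventually hT h.gaussian hcont (hns c) 𝒯 hL
  filter_upwards [hω (ε / 2) (half_pos hε), hdet, hψ] with k hk hdetk hψk
  have := hk (L, 0) le_rfl hdetk ψ hψm hψ0 hψ1
  linarith

/-- The risk of a low-dimensional rule fitted to one sample is not much larger than that of the
rule fitted to another sample. -/
theorem ae_risk_le_risk (h : IsGaussianSample P P' G v) (𝒯 : SamplingScheme T)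
    {a : Fin 2 → Fin 2 → ℝ} (ha : ∀ c c', 0 ≤ a c c') (ha1 : ∀ c, ∑ c', a c c' = 1)
    (hcov : ∀ c c', a c c' ≠ 0 → ∀ k p, lsCov P G 𝒯 k p c' = lsCov P G 𝒯 k p c)
    {I : ℕ → Finset ℕ} {D : ℕ → ℕ} {δ α : ℝ} (hδ : 0 < δ) (hα : α < 1 / 2)
    (hI : ∀ᶠ k : ℕ in atTop, δ * k ≤ (I k).card)
    (hD : ∀ᶠ k : ℕ in atTop, (D k : ℝ) ≤ (k : ℝ) ^ α) :
    ∀ᵐ ω ∂P', ∀ ε : ℝ, 0 < ε → ∀ᶠ k in atTop, ∀ p : ℕ × ℕ, p.1 + p.2 ≤ D k → ∀ J : Finset ℕ,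
      risk P G (lsRule 𝒯 (plugInMethod a) (fun c i => v c i ω) k (I k) p) ≤
        risk P G (lsRule 𝒯 (plugInMethod a) (fun c i => v c i ω) k J p) + ε := by
  filter_upwards [ae_risk_le_softRisk h 𝒯 ha ha1 hcov hδ hα hI hD,
    ae_lsRule_eq_zero_of_singular h 𝒯 hcov] with ω hω hsing ε hε
  filter_upwards [hω ε hε] with k hk p hp J
  by_cases hdet : ∀ c, (lsCov P G 𝒯 k p c).det ≠ 0
  · set w : Fin 2 → ℕ → SamplePath T := fun c i => v c i ω with hw
    set g := plugIn (fun c => sampleMean J fun i => lsPath 𝒯 k p (w c i))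
      (mixedCov a J fun c i => lsPath 𝒯 k p (w c i)) with hg
    have hgm : Measurable g :=
      measurable_plugIn (fun _ => continuous_const) (fun _ => continuous_const) continuous_id
    rw [risk_eq_softRisk h.measurable (measurable_lsRule 𝒯 a w k J p)]
    -- The rule fitted to `J` is itself a competitor based on the same transform. Its dependence on
    -- the sample is harmless, because for fixed `ω` the bound holds for all `ψ` at once.
    exact hk p hp hdet ({z | g z = 1}.indicator 1)
      (measurable_one.indicator (hgm (measurableSet_singleton 1)))
      (fun z => Set.indicator_nonneg (fun _ _ => zero_le_one) z)
      (fun z => Set.indicator_le_self' (fun _ _ => zero_le_one) z)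
  · push Not at hdet
    -- If a covariance matrix is singular, both fitted rules are constant and coincide.
    have e : lsRule 𝒯 (plugInMethod a) (fun c i => v c i ω) k (I k) p =
        lsRule 𝒯 (plugInMethod a) (fun c i => v c i ω) k J p :=
      funext fun x => (hsing k p (I k) x hdet).trans (hsing k p J x hdet).symm
    rw [e]
    linarith

theorem cvError_eq_sum_errorRate (𝒯 : SamplingScheme T) (D : LearningMethod) {V : ℕ}
    (𝓕 : FoldScheme V) (w : Fin 2 → ℕ → SamplePath T) (k : ℕ) (p : ℕ × ℕ) :
    cvError 𝒯 D 𝓕 w k p =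
      (V : ℝ)⁻¹ * ∑ u, errorRate (lsRule 𝒯 D w k (𝓕.train k u) p) w (𝓕.valid k u) := rfl

/-- If the average of `r` is at most about `R`, and all values are at least `R`, then all values are
about `R`. -/
theorem le_of_sum_errorRate_le {V : ℕ} {e e' r r' : Fin V → ℝ} {R ε : ℝ}
    (h : ∑ u, e u ≤ ∑ u, e' u) (he : ∀ u, |e u - r u| ≤ ε) (he' : ∀ u, |e' u - r' u| ≤ ε)
    (hr' : ∀ u, r' u ≤ R + ε) (hr : ∀ u, R ≤ r u) (u : Fin V) : r u ≤ R + V * (3 * ε) := by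
  have h1 : ∑ u, (r u - R) ≤ V * (3 * ε) := by
    -- One `ε` comes from `r u ≤ e u + ε`, two from `e' u ≤ r' u + ε ≤ R + 2 * ε`.
    have h2 : ∑ u, (r u - R) ≤ ∑ u, (e u - e' u + 3 * ε) := Finset.sum_le_sum fun u _ => by
      have a1 := (abs_le.1 (he u)).1
      have a2 := (abs_le.1 (he' u)).2
      linarith [hr' u]
    rw [Finset.sum_add_distrib, Finset.sum_sub_distrib e e'] at h2
    simp only [Finset.sum_const, Finset.card_univ, Fintype.card_fin, nsmul_eq_mul] at h2
    linarith
  have h3 := Finset.single_le_sum (f := fun u => r u - R) (fun u _ => sub_nonneg.2 (hr u))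
    (Finset.mem_univ u)
  linarith

/-- Dimensions that cross-validation prefers to suitable fixed dimensions yield nearly optimal
rules. -/
theorem ae_fold_risk_le (hT : 0 < T) (h : IsGaussianSample P P' G v)
    (hcont : ∀ c, ∀ᵐ ω ∂P, Continuous (G c ω)) (hns : ∀ c, HasNonsingularLocations P hT.le (G c))
    (𝒯 : SamplingScheme T) {a : Fin 2 → Fin 2 → ℝ} (ha : ∀ c c', 0 ≤ a c c')
    (ha1 : ∀ c, ∑ c', a c c' = 1)
    (hcov : ∀ c c', a c c' ≠ 0 → ∀ k p, lsCov P G 𝒯 k p c' = lsCov P G 𝒯 k p c) {V : ℕ}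
    (𝓕 : FoldScheme V) {ε : ℝ} (hε : 0 < ε) :
    ∃ L : ℕ, 1 ≤ L ∧ ∀ᵐ ω ∂P', ∀ᶠ k in atTop, ∀ p : ℕ × ℕ,
      cvError 𝒯 (plugInMethod a) 𝓕 (fun c i => v c i ω) k p ≤
        cvError 𝒯 (plugInMethod a) 𝓕 (fun c i => v c i ω) k (L, 0) →
      ∀ u, risk P G (lsRule 𝒯 (plugInMethod a) (fun c i => v c i ω) k (𝓕.train k u) p) ≤
        bayesRisk P G + ε := by
  obtain ⟨δ, hδ, hprop⟩ := 𝓕.proportion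
  -- Makes the total loss `V * (3 * η)` at most `ε`; the summand one avoids division by zero when
  -- there are no folds.
  set η : ℝ := ε / (3 * (V + 1)) with hη
  have hη0 : 0 < η := by positivity
  obtain ⟨L, hL, hrisk⟩ := exists_ae_risk_location_le hT h hcont hns 𝒯 ha ha1 hcov hη0
  refine ⟨L, hL, ?_⟩
  have h1 := ae_all_iff.2 fun u => hrisk (fun k => 𝓕.train k u) δ hδ (hprop.mono fun k hk => (hk u).1)
  have h2 := ae_all_iff.2 fun u => ae_errorRate_sub_risk h 𝒯 a (fun k => 𝓕.disjoint k u)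
    (fun k => 𝓕.train_subset k u) hδ (hprop.mono fun k hk => (hk u).2)
  filter_upwards [h1, h2] with ω hω1 hω2
  filter_upwards [eventually_all.2 hω1, eventually_all.2 fun u => hω2 u η hη0] with k hk1 hk2 p hp u
  have hV : (0 : ℝ) < V := by exact_mod_cast u.pos
  rw [cvError_eq_sum_errorRate, cvError_eq_sum_errorRate,
    mul_le_mul_iff_right₀ (inv_pos.2 hV)] at hp
  refine (le_of_sum_errorRate_le hp (fun u => hk2 u p) (fun u => hk2 u (L, 0)) hk1
    (fun u => bayesRisk_le_risk (measurable_lsRule 𝒯 a _ k _ p)) u).trans ?_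
  have : (V : ℝ) * (3 * η) ≤ ε := by
    rw [hη]
    have e : (V : ℝ) * (3 * (ε / (3 * (V + 1)))) = V / (V + 1) * ε := by field_simp
    rw [e]
    have : (V : ℝ) / (V + 1) ≤ 1 := by rw [div_le_one (by positivity)]; linarith
    nlinarith
  linarith

omit [IsProbabilityMeasure P] [IsProbabilityMeasure P'] in
/-- Almost sure properties of measurable Gaussian samples also hold for samples that are measurable
up to modification on null sets. -/
theorem ae_of_isGaussianSample (hG : ∀ c, Measurable (G c))
    (hGauss : ∀ c, IsGaussianProcess (fun t ω => G c ω t) P)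
    (hlaw : ∀ c i, IdentDistrib (v c i) (G c) P' P)
    (hindep : iIndepFun (fun q : Fin 2 × ℕ => v q.1 q.2) P')
    {Q : (Fin 2 → ℕ → SamplePath T) → Prop}
    (hQ : ∀ v' : Fin 2 → ℕ → Ω' → SamplePath T, IsGaussianSample P P' G v' →
      ∀ᵐ ω ∂P', Q fun c i => v' c i ω) :
    ∀ᵐ ω ∂P', Q fun c i => v c i ω := by
  have hm := fun c i => (hlaw c i).aemeasurable_fst
  have hae := fun c i => (hm c i).ae_eq_mk
  have hs : IsGaussianSample P P' G fun c i => (hm c i).mk (v c i) :=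
    { measurable := hG
      gaussian := hGauss
      measurable_sample := fun c i => (hm c i).measurable_mk
      law := fun c i => (Measure.map_congr (hae c i)).symm.trans (hlaw c i).map_eq
      indep := hindep.congr fun q => hae q.1 q.2 }
  filter_upwards [hQ _ hs, ae_all_iff.2 fun c => ae_all_iff.2 (hae c)] with ω hω heq
  simpa only [heq] using hω

theorem tendsto_of_forall_eventually_le {f : ℕ → ℝ} {R : ℝ} (hlow : ∀ k, R ≤ f k)
    (h : ∀ n : ℕ, ∀ᶠ k in atTop, f k ≤ R + 1 / ((n : ℝ) + 1)) : Tendsto f atTop (𝓝 R) := by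
  rw [Metric.tendsto_nhds]
  intro ε hε
  obtain ⟨n, hn⟩ := exists_nat_one_div_lt hε
  filter_upwards [h n] with k hk
  rw [Real.dist_eq, abs_of_nonneg (sub_nonneg.2 (hlow k))]
  linarith

/-- The three selections share one comparison with a nearly optimal fixed pair `(L, 0)`: through the
infimum of the risks, through the cross-validated errors, or through these and a refit. The
condition `hcov` says that empirical covariance matrices are mixed only between classes with equal
true covariance matrices. -/
theorem isBayesOptimal_plugInMethod (hT : 0 < T) (hG : ∀ c, Measurable (G c))
    (hGauss : ∀ c, IsGaussianProcess (fun t ω => G c ω t) P)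
    (hcont : ∀ c, ∀ᵐ ω ∂P, Continuous (G c ω)) (hns : ∀ c, HasNonsingularLocations P hT.le (G c))
    (hlaw : ∀ c i, IdentDistrib (v c i) (G c) P' P)
    (hindep : iIndepFun (fun q : Fin 2 × ℕ => v q.1 q.2) P')
    (𝒯 : SamplingScheme T) {𝒮 : ℕ → Set ℕ} (h𝒮 : ∀ k, 0 ∈ 𝒮 k) {a : Fin 2 → Fin 2 → ℝ}
    (ha : ∀ c c', 0 ≤ a c c') (ha1 : ∀ c, ∑ c', a c c' = 1)
    (hcov : ∀ c c', a c c' ≠ 0 → ∀ k p, lsCov P G 𝒯 k p c' = lsCov P G 𝒯 k p c) :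
    IsBayesOptimal P P' G v 𝒯 (fun k => 𝒯.locationNumbers k ×ˢ 𝒮 k) (plugInMethod a) := by
  have hpos : ∀ n : ℕ, (0 : ℝ) < 1 / ((n : ℝ) + 1) := fun n => by positivity
  have hmem : ∀ {L : ℕ}, 1 ≤ L → ∀ᶠ k in atTop, (L, 0) ∈ 𝒯.locationNumbers k ×ˢ 𝒮 k := fun hL =>
    (𝒯.mem_locationNumbers_eventually hT hL).mono fun k hk => ⟨hk, h𝒮 k⟩
  have hlow : ∀ ω k I p, bayesRisk P G ≤
      risk P G (lsRule 𝒯 (plugInMethod a) (fun c i => v c i ω) k I p) := fun ω k I p =>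
    bayesRisk_le_risk (measurable_lsRule 𝒯 a _ k I p)
  have hrange : ∀ᶠ k : ℕ in atTop, (1 : ℝ) * k ≤ (Finset.range k).card :=
    Eventually.of_forall fun k => by simp
  -- cross-validation over a class of dimensions
  have hfold : ∀ {V : ℕ} (𝓕 : FoldScheme V), ∀ᵐ ω ∂P', ∀ n : ℕ, ∃ L : ℕ, 1 ≤ L ∧
      ∀ᶠ k in atTop, ∀ p : ℕ × ℕ, cvError 𝒯 (plugInMethod a) 𝓕 (fun c i => v c i ω) k p ≤
        cvError 𝒯 (plugInMethod a) 𝓕 (fun c i => v c i ω) k (L, 0) → ∀ u,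
        risk P G (lsRule 𝒯 (plugInMethod a) (fun c i => v c i ω) k (𝓕.train k u) p) ≤
          bayesRisk P G + 1 / ((n : ℝ) + 1) := by
    intro V 𝓕
    refine ae_all_iff.2 fun n => ae_of_isGaussianSample (Q := fun w => ∃ L : ℕ, 1 ≤ L ∧
      ∀ᶠ k in atTop, ∀ p : ℕ × ℕ, cvError 𝒯 (plugInMethod a) 𝓕 w k p ≤
        cvError 𝒯 (plugInMethod a) 𝓕 w k (L, 0) → ∀ u,
        risk P G (lsRule 𝒯 (plugInMethod a) w k (𝓕.train k u) p) ≤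
          bayesRisk P G + 1 / ((n : ℝ) + 1)) hG hGauss hlaw hindep fun v' hv' => ?_
    obtain ⟨L, hL, hae⟩ := ae_fold_risk_le hT hv' hcont hns 𝒯 ha ha1 hcov 𝓕 (hpos n)
    exact hae.mono fun ω hω => ⟨L, hL, hω⟩
  refine ⟨?_, ?_, ?_⟩
  · intro sel _ hsel
    have hloc : ∀ᵐ ω ∂P', ∀ n : ℕ, ∃ L : ℕ, 1 ≤ L ∧ ∀ᶠ k in atTop,
        risk P G (lsRule 𝒯 (plugInMethod a) (fun c i => v c i ω) k (Finset.range k) (L, 0)) ≤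
          bayesRisk P G + 1 / ((n : ℝ) + 1) := by
      refine ae_all_iff.2 fun n => ae_of_isGaussianSample (Q := fun w => ∃ L : ℕ, 1 ≤ L ∧
        ∀ᶠ k in atTop, risk P G (lsRule 𝒯 (plugInMethod a) w k (Finset.range k) (L, 0)) ≤
          bayesRisk P G + 1 / ((n : ℝ) + 1)) hG hGauss hlaw hindep fun v' hv' => ?_
      obtain ⟨L, hL, hae⟩ := exists_ae_risk_location_le hT hv' hcont hns 𝒯 ha ha1 hcov (hpos n)
      exact (hae _ 1 one_pos hrange).mono fun ω hω => ⟨L, hL, hω⟩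
    filter_upwards [hsel, hloc] with ω hω hlocω
    refine tendsto_of_forall_eventually_le (fun k => hlow _ _ _ _) fun n => ?_
    -- Half of the tolerance is for the fixed dimension, half for the distance of the selection from
    -- the infimum.
    obtain ⟨m, hm⟩ := exists_nat_one_div_lt (half_pos (hpos n))
    obtain ⟨L, hL, hLk⟩ := hlocω m
    filter_upwards [hLk, hmem hL, hω.eventually (gt_mem_nhds (half_pos (hpos n)))] with k hk hkC hks
    have := ciInf_le (f := fun p : (𝒯.locationNumbers k ×ˢ 𝒮 k : Set (ℕ × ℕ)) =>
        risk P G (lsRule 𝒯 (plugInMethod a) (fun c i => v c i ω) k (Finset.range k) p))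
      ⟨0, by rintro _ ⟨p, rfl⟩; exact risk_nonneg _⟩ ⟨(L, 0), hkC⟩
    simp only at this
    linarith
  · intro V 𝓕 sel _ hmin
    filter_upwards [hfold 𝓕] with ω hω u
    refine tendsto_of_forall_eventually_le (fun k => hlow _ _ _ _) fun n => ?_
    obtain ⟨L, hL, hLk⟩ := hω n
    filter_upwards [hLk, hmem hL] with k hk hkC
    exact hk _ (hmin k ω _ hkC) u
  · intro V 𝓕 dmax sel hV hd ⟨α, hα, hdα⟩ hmin
    have hrefit := ae_of_isGaussianSample (Q := fun w => ∀ ε : ℝ, 0 < ε → ∀ᶠ k in atTop,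
      ∀ p : ℕ × ℕ, p.1 + p.2 ≤ dmax k → ∀ J : Finset ℕ,
        risk P G (lsRule 𝒯 (plugInMethod a) w k (Finset.range k) p) ≤
          risk P G (lsRule 𝒯 (plugInMethod a) w k J p) + ε) hG hGauss hlaw hindep fun v' hv' =>
      ae_risk_le_risk hv' 𝒯 ha ha1 hcov one_pos hα hrange hdα
    filter_upwards [hfold 𝓕, hrefit] with ω hω hr
    refine tendsto_of_forall_eventually_le (fun k => hlow _ _ _ _) fun n => ?_
    obtain ⟨m, hm⟩ := exists_nat_one_div_lt (half_pos (hpos n))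
    obtain ⟨L, hL, hLk⟩ := hω m
    filter_upwards [hLk, hmem hL, hd.eventually_ge_atTop L, hr _ (half_pos (hpos n)), hmin]
      with k hk hkC hkL hkr hkmin
    obtain ⟨-, hdim, hcv⟩ := hkmin ω
    -- One fold is enough: its rule is nearly optimal in the selected dimension, and the refitted
    -- rule is not much worse.
    have h1 := hk _ (hcv _ hkC hkL) ⟨0, hV⟩
    have h2 := hkr _ hdim (𝓕.train k ⟨0, hV⟩)
    linarith

end Optimal

theorem theorem1 {Ω Ω' : Type*} [MeasurableSpace Ω] [MeasurableSpace Ω']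
    (P : Measure Ω) [IsProbabilityMeasure P] (P' : Measure Ω') [IsProbabilityMeasure P']
    (T : ℝ) (hT : 0 < T)
    -- the two Gaussian processes
    (G : Fin 2 → Ω → SamplePath T) (hGmeas : ∀ c, Measurable (G c))
    (hGauss : ∀ c, IsGaussianProcess (fun t ω => G c ω t) P)
    (hsmooth : ∀ c, ∀ᵐ ω ∂P, IsPiecewiseSmooth (G c ω))
    (hnonsing : ∀ c, HasNonsingularLocations P hT.le (G c))
    -- the independent i.i.d. samples of paths
    (v : Fin 2 → ℕ → Ω' → SamplePath T)
    (hlaw : ∀ c i, IdentDistrib (v c i) (G c) P' P)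
    (hindep : iIndepFun (fun (q : Fin 2 × ℕ) => v q.1 q.2) P')
    -- the sampling scheme, and the admissible numbers of slope intervals
    (𝒯 : SamplingScheme T) (𝒮 : ℕ → Set ℕ) (h𝒮 : ∀ k, 0 ∈ 𝒮 k) :
    IsBayesOptimal P P' G v 𝒯 (fun k => 𝒯.locationNumbers k ×ˢ 𝒮 k) QDA ∧
    ((∀ s t : Set.Icc (0 : ℝ) T,
        cov[fun ω => G 0 ω s, fun ω => G 0 ω t; P] = cov[fun ω => G 1 ω s, fun ω => G 1 ω t; P]) →
      IsBayesOptimal P P' G v 𝒯 (fun k => 𝒯.locationNumbers k ×ˢ 𝒮 k) LDA) := by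
  have hcont : ∀ c, ∀ᵐ ω ∂P, Continuous (G c ω) := fun c => (hsmooth c).mono fun ω hω => hω.1
  constructor
  · rw [QDA_eq_plugInMethod]
    refine isBayesOptimal_plugInMethod hT hGmeas hGauss hcont hnonsing hlaw hindep 𝒯 h𝒮
      (fun c c' => by split_ifs <;> norm_num) (fun c => by simp) fun c c' hc k p => ?_
    -- A nonzero QDA weight forces the two classes to coincide, so no assumption on the covariance
    -- functions is needed.
    rw [ite_ne_right_iff.1 hc |>.1]
  · intro heq
    rw [LDA_eq_plugInMethod]
    have h01 := lsCov_eq_of_covariance_eq hGauss heq 𝒯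
    refine isBayesOptimal_plugInMethod hT hGmeas hGauss hcont hnonsing hlaw hindep 𝒯 h𝒮
      (fun c c' => by norm_num) (fun c => by simp) fun c c' _ k p => ?_
    fin_cases c <;> fin_cases c' <;> simp [h01]
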